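/- Let $M$ be a connected smooth manifold of dimension $2n+1$ and let $(\varphi,\xi,\eta,g)$ be a paracontact metric structure on $M$: $\eta$ is a $1$-form with $\eta\wedge(d\eta)^n\neq 0$ everywhere, $\xi$ is its Reeb vector field ($\eta(\xi)=1$, $d\eta(\xi,\cdot)=0$), $g$ is a semi-Riemannian metric and $\varphi$ is a smooth tensor field of type $(1,1)$ such that $$\eta=g(\xi,\cdot),\qquad d\eta(\cdot,\cdot)=g(\cdot,\varphi\,\cdot),\qquad \varphi^2=I-\eta\otimes\xi,$$ where $2\,d\eta(X,Y)=X(\eta(Y))-Y(\eta(X))-\eta([X,Y])$. A smooth vector field $V$ of constant length $g(V,V)=r\neq0$ is called harmonic if it is a critical point of the energy $$E_D(V)=\tfrac12\int_D \mathrm{tr}_g(V^*g^s)\,dv_g,\qquad (V^*g^s)(X,Y)=g(X,Y)+g(\nabla_XV,\nabla_YV)$$ ($\nabla$ the Levi-Civita connection of $g$, $g^s$ the Sasaki metric on $TM$), over every relatively compact open set $D$, with respect to smooth variations of $V$ through vector fields of the same constant length $r$ that agree with $V$ outside a compact subset of $D$. The structure is called $H$-paracontact if $\xi$ is a harmonic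 vector field. For a real number $t\neq0$, the $D$-homothetic deformation of $(\varphi,\xi,\eta,g)$ is $$\varphi_t=\varphi,\qquad \xi_t=\tfrac1t\,\xi,\qquad \eta_t=t\,\eta,\qquad g_t=t\,g+t(t-1)\,\eta\otimes\eta .$$ **Theorem.** For every $t\neq 0$, $(\varphi_t,\xi_t,\eta_t,g_t)$ is a paracontact metric structure, and it is $H$-paracontact if and only if $(\varphi,\xi,\eta,g)$ is. Moreover, the Ricci tensors $\varrho$ of $g$ and $\varrho_t$ of $g_t$ satisfy $$\varrho_t(X,\xi_t)=\tfrac1t\,\varrho(X,\xi)\qquad\text{for every } X\in\ker\eta .$$ -/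

import Mathlib

open scoped Manifold ContDiff Topology Matrix
open Bundle MeasureTheory

noncomputable section

namespace Paracontact

/-! Throughout, `M` is a smooth manifold without boundary modelled on `ℝᵐ`. In Mathlib the tangent
space `T_x M` is a copy of `ℝᵐ`, identified through the preferred chart at `x`, so that the standard
vectors of `ℝᵐ` are the coordinate vectors of that chart at `x`. -/

section Tensors

variable (m : ℕ) (M : Type*) [TopologicalSpace M] [ChartedSpace (EuclideanSpace ℝ (Fin m)) M]

/-- (Not necessarily smooth) vector fields on `M`. -/
abbrev VField := ∀ x : M, TangentSpace (𝓡 m) x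

/-- (Not necessarily smooth) one-forms on `M`. -/
abbrev OneForm := ∀ x : M, TangentSpace (𝓡 m) x →L[ℝ] ℝ

/-- (Not necessarily smooth) tensor fields of type `(0,2)` on `M`. -/
abbrev BilinField := ∀ x : M, TangentSpace (𝓡 m) x →L[ℝ] TangentSpace (𝓡 m) x →L[ℝ] ℝ

/-- (Not necessarily smooth) tensor fields of type `(1,1)` on `M`. -/
abbrev EndField := ∀ x : M, TangentSpace (𝓡 m) x →L[ℝ] TangentSpace (𝓡 m) x

end Tensors

section Geometry

variable {m : ℕ} {M : Type*} [TopologicalSpace M] [ChartedSpace (EuclideanSpace ℝ (Fin m)) M]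
  [IsManifold (𝓡 m) ∞ M]

/-- Smooth vector fields. -/
def IsSmoothField (V : VField m M) : Prop :=
  ContMDiff (𝓡 m) (𝓡 m).tangent ∞ (fun x ↦ (⟨x, V x⟩ : TangentBundle (𝓡 m) M))

/-- The `i`-th vector of the standard basis of `T_x M = ℝᵐ`. -/
def stdVec (x : M) (i : Fin m) : TangentSpace (𝓡 m) x :=
  (EuclideanSpace.single i (1 : ℝ) : EuclideanSpace ℝ (Fin m))

/-- The `i`-th coordinate of a tangent vector in the standard basis of `T_x M = ℝᵐ`. -/
def coord (x : M) (v : TangentSpace (𝓡 m) x) (i : Fin m) : ℝ :=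
  (show EuclideanSpace ℝ (Fin m) from v) i

/-- The vector field, smooth near `x`, with constant coordinates in the preferred chart at `x`
that extends the tangent vector `v` at `x`. -/
def ext {x : M} (v : TangentSpace (𝓡 m) x) : VField m M :=
  FiberBundle.extend (EuclideanSpace ℝ (Fin m)) (E := fun y : M ↦ TangentSpace (𝓡 m) y) v

/-- The directional derivative `v(f)` at `x` of a function `f`. -/
def dirDeriv (f : M → ℝ) (x : M) (v : TangentSpace (𝓡 m) x) : ℝ :=
  mvfderiv (𝓡 m) f x v

/-- The exterior derivative of a one-form, in the normalization
`2 dη(X, Y) = X(η(Y)) - Y(η(X)) - η([X, Y])`. -/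
def extD (η : OneForm m M) (x : M) (v w : TangentSpace (𝓡 m) x) : ℝ :=
  (1 / 2 : ℝ) * (dirDeriv (fun y ↦ η y (ext w y)) x v - dirDeriv (fun y ↦ η y (ext v y)) x w
    - η x (VectorField.mlieBracket (𝓡 m) (ext v) (ext w) x))

/-- A semi-Riemannian metric: a smooth, symmetric, nondegenerate tensor field of type `(0,2)`
(on a connected manifold its index is then constant). -/
structure IsSemiRiemannianMetric (g : BilinField m M) : Prop where
  smooth : ContMDiff (𝓡 m)
    ((𝓡 m).prod 𝓘(ℝ, EuclideanSpace ℝ (Fin m) →L[ℝ] EuclideanSpace ℝ (Fin m) →L[ℝ] ℝ)) ∞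
    (fun x ↦ TotalSpace.mk'
      (EuclideanSpace ℝ (Fin m) →L[ℝ] EuclideanSpace ℝ (Fin m) →L[ℝ] ℝ)
      (E := fun x : M ↦ TangentSpace (𝓡 m) x →L[ℝ] TangentSpace (𝓡 m) x →L[ℝ] ℝ) x (g x))
  symm : ∀ x v w, g x v w = g x w v
  nondegenerate : ∀ x v, (∀ w, g x v w = 0) → v = 0

/-- The Gram matrix of `g` in the standard basis of `T_x M`. -/
def gram (g : BilinField m M) (x : M) : Matrix (Fin m) (Fin m) ℝ :=
  Matrix.of fun i j ↦ g x (stdVec x i) (stdVec x j)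

/-- The metric trace `tr_g B = ∑ g^{ij} B(e_i, e_j)` of a bilinear form `B` on `T_x M`. -/
def metricTrace (g : BilinField m M) (x : M)
    (B : TangentSpace (𝓡 m) x → TangentSpace (𝓡 m) x → ℝ) : ℝ :=
  ∑ i, ∑ j, (gram g x)⁻¹ i j * B (stdVec x i) (stdVec x j)

/-- The vector `∑ g^{ij} α(e_j) e_i` of `T_x M` that is `g`-dual to a linear form `α`. -/
def sharp (g : BilinField m M) (x : M) (α : TangentSpace (𝓡 m) x → ℝ) : TangentSpace (𝓡 m) x :=
  ∑ i, (∑ j, (gram g x)⁻¹ i j * α (stdVec x j)) • stdVec x i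

/-- The right-hand side of the Koszul formula,
`X g(Y,Z) + Y g(Z,X) - Z g(X,Y) + g([X,Y],Z) - g([Y,Z],X) + g([Z,X],Y)`. -/
def koszul (g : BilinField m M) (X Y Z : VField m M) (x : M) : ℝ :=
  dirDeriv (fun y ↦ g y (Y y) (Z y)) x (X x)
  + dirDeriv (fun y ↦ g y (Z y) (X y)) x (Y x)
  - dirDeriv (fun y ↦ g y (X y) (Y y)) x (Z x)
  + g x (VectorField.mlieBracket (𝓡 m) X Y x) (Z x)
  - g x (VectorField.mlieBracket (𝓡 m) Y Z x) (X x)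
  + g x (VectorField.mlieBracket (𝓡 m) Z X x) (Y x)

/-- The Levi-Civita covariant derivative `∇_v Y` at `x` of a vector field `Y` in the direction
`v ∈ T_x M`: by the Koszul formula, it is the vector with
`2 g(∇_v Y, z) = koszul(v, Y, z)` for all `z ∈ T_x M`. -/
def nabla (g : BilinField m M) (Y : VField m M) (x : M) (v : TangentSpace (𝓡 m) x) :
    TangentSpace (𝓡 m) x :=
  sharp g x fun z ↦ (1 / 2 : ℝ) * koszul g (ext v) Y (ext z) x

/-- The curvature `R_{XY} Z = ∇_{[X,Y]} Z - ∇_X ∇_Y Z + ∇_Y ∇_X Z` on vector fields. -/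
def curvField (g : BilinField m M) (X Y Z : VField m M) (x : M) : TangentSpace (𝓡 m) x :=
  nabla g Z x (VectorField.mlieBracket (𝓡 m) X Y x)
  - nabla g (fun y ↦ nabla g Z y (Y y)) x (X x)
  + nabla g (fun y ↦ nabla g Z y (X y)) x (Y x)

/-- The curvature tensor `R(u,v)w` on tangent vectors at `x`. -/
def curv (g : BilinField m M) (x : M) (u v w : TangentSpace (𝓡 m) x) : TangentSpace (𝓡 m) x :=
  curvField g (ext u) (ext v) (ext w) x

/-- The Ricci tensor `ρ(v,w) = tr (z ↦ R(v,z)w)` of type `(0,2)`. -/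
def ricci (g : BilinField m M) (x : M) (v w : TangentSpace (𝓡 m) x) : ℝ :=
  ∑ i, coord x (curv g x v (stdVec x i) w) i

end Geometry

section Energy

variable {m : ℕ} {M : Type*} [TopologicalSpace M] [ChartedSpace (EuclideanSpace ℝ (Fin m)) M]
  [IsManifold (𝓡 m) ∞ M]

/-- The pullback `V^* g^s` to `M` of the Sasaki metric `g^s` of `TM` by a vector field
`V : M → TM`: the vector `dV(v)` has horizontal part `v` and vertical part `∇_v V`, so that
`(V^* g^s)(v,w) = g(v,w) + g(∇_v V, ∇_w V)`. -/
def pullbackSasaki (g : BilinField m M) (V : VField m M) (x : M)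
    (v w : TangentSpace (𝓡 m) x) : ℝ :=
  g x v w + g x (nabla g V x v) (nabla g V x w)

/-- The energy density `(1/2) tr_g (V^* g^s)` of a vector field. -/
def energyDensity (g : BilinField m M) (V : VField m M) (x : M) : ℝ :=
  (1 / 2 : ℝ) * metricTrace g x (pullbackSasaki g V x)

/-- The density `|det (g_{ij})|^{1/2}` of the semi-Riemannian volume in the coordinates of the
preferred chart at `p`, as a function of the coordinate vector `y`. -/
def chartDensity (g : BilinField m M) (p : M) (y : EuclideanSpace ℝ (Fin m)) : ℝ :=
  let ψ := (chartAt (EuclideanSpace ℝ (Fin m)) p).symm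
  let b : Fin m → TangentSpace (𝓡 m) (ψ y) := fun i ↦
    mfderiv (𝓡 m) (𝓡 m) ψ y (EuclideanSpace.single i (1 : ℝ) : EuclideanSpace ℝ (Fin m))
  Real.sqrt |(Matrix.of fun i j ↦ g (ψ y) (b i) (b j)).det|

variable [MeasurableSpace M]

/-- The semi-Riemannian volume on the domain of the preferred chart at `p`, extended by zero. -/
def chartVolume (g : BilinField m M) (p : M) : Measure M :=
  (((volume : Measure (EuclideanSpace ℝ (Fin m))).restrict
      (chartAt (EuclideanSpace ℝ (Fin m)) p).target).withDensity
    fun y ↦ ENNReal.ofReal (chartDensity g p y)).map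
    (chartAt (EuclideanSpace ℝ (Fin m)) p).symm

/-- The semi-Riemannian volume measure. The measures `chartVolume g p` agree on overlaps of charts,
and their supremum is the measure that restricts to each of them on the domain of its chart. -/
def volumeMeasure (g : BilinField m M) : Measure M :=
  ⨆ p : M, chartVolume g p

/-- The energy `E_D(V) = (1/2) ∫_D tr_g (V^* g^s) dv` of a vector field over a domain `D`. -/
def energy (g : BilinField m M) (V : VField m M) (D : Set M) : ℝ :=
  ∫ x in D, energyDensity g V x ∂(volumeMeasure g)

/-- `W` is a smooth variation, with parameter `s ∈ (-δ, δ)`, of the vector field `V` through vector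
fields of constant length `g(W_s, W_s) = r`, and `W_s = V` outside `K`. -/
structure IsVariation (g : BilinField m M) (r : ℝ) (V : VField m M) (K : Set M) (δ : ℝ)
    (W : ℝ → VField m M) : Prop where
  smooth : ContMDiffOn ((𝓘(ℝ, ℝ)).prod (𝓡 m)) (𝓡 m).tangent ∞
    (fun q : ℝ × M ↦ (⟨q.2, W q.1 q.2⟩ : TangentBundle (𝓡 m) M))
    (Set.Ioo (-δ) δ ×ˢ Set.univ)
  zero : W 0 = V
  length : ∀ s ∈ Set.Ioo (-δ) δ, ∀ x, g x (W s x) (W s x) = r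
  eq_off : ∀ s ∈ Set.Ioo (-δ) δ, ∀ x, x ∉ K → W s x = V x

/-- `V` is a harmonic vector field: a smooth vector field of constant length `r ≠ 0` that is a
critical point of the energy restricted to the vector fields of length `r`, where the
energy is taken over relatively compact domains `D` and the variations are supported in compact
subsets of `D`. -/
def IsHarmonicField (g : BilinField m M) (V : VField m M) : Prop :=
  IsSmoothField V ∧ ∃ r : ℝ, r ≠ 0 ∧ (∀ x, g x (V x) (V x) = r) ∧
    ∀ D K : Set M, IsOpen D → IsCompact (closure D) → IsCompact K → K ⊆ D →
      ∀ δ > 0, ∀ W : ℝ → VField m M, IsVariation g r V K δ W →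
        HasDerivAt (fun s ↦ energy g (W s) D) 0 0

end Energy

section Structure

/-- Tensor fields `(φ, ξ, η, g)` on a manifold of dimension `2n+1`; the laws of a paracontact metric
structure are in `IsParacontactMetric`. -/
structure Tensors (n : ℕ) (M : Type*) [TopologicalSpace M]
    [ChartedSpace (EuclideanSpace ℝ (Fin (2 * n + 1))) M] where
  φ : EndField (2 * n + 1) M
  ξ : VField (2 * n + 1) M
  η : OneForm (2 * n + 1) M
  g : BilinField (2 * n + 1) M

variable {n : ℕ} {M : Type*} [TopologicalSpace M]
  [ChartedSpace (EuclideanSpace ℝ (Fin (2 * n + 1))) M]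
  [IsManifold (𝓡 (2 * n + 1)) ∞ M]

/-- The value of the form `η ∧ (dη)ⁿ` on `2n+1` tangent vectors, up to a
positive constant that depends only on `n`. -/
def wedgeForm (η : OneForm (2 * n + 1) M) (x : M)
    (v : Fin (2 * n + 1) → TangentSpace (𝓡 (2 * n + 1)) x) : ℝ :=
  ∑ σ : Equiv.Perm (Fin (2 * n + 1)), ((Equiv.Perm.sign σ : ℤ) : ℝ) * η x (v (σ 0)) *
    ∏ k : Fin n, extD η x (v (σ ⟨2 * (k : ℕ) + 1, by omega⟩)) (v (σ ⟨2 * (k : ℕ) + 2, by omega⟩))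

/-- `(φ, ξ, η, g)` is a paracontact metric structure: `η` is a contact form with Reeb vector field
`ξ`, and `g` is a metric associated to `η` through `φ`. -/
structure IsParacontactMetric (S : Tensors n M) : Prop where
  smooth_φ : ContMDiff (𝓡 (2 * n + 1))
    ((𝓡 (2 * n + 1)).prod 𝓘(ℝ, EuclideanSpace ℝ (Fin (2 * n + 1)) →L[ℝ]
      EuclideanSpace ℝ (Fin (2 * n + 1)))) ∞
    (fun x ↦ TotalSpace.mk'
      (EuclideanSpace ℝ (Fin (2 * n + 1)) →L[ℝ] EuclideanSpace ℝ (Fin (2 * n + 1)))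
      (E := fun x : M ↦ TangentSpace (𝓡 (2 * n + 1)) x →L[ℝ] TangentSpace (𝓡 (2 * n + 1)) x)
      x (S.φ x))
  smooth_ξ : IsSmoothField S.ξ
  smooth_η : ContMDiff (𝓡 (2 * n + 1))
    ((𝓡 (2 * n + 1)).prod 𝓘(ℝ, EuclideanSpace ℝ (Fin (2 * n + 1)) →L[ℝ] ℝ)) ∞
    (fun x ↦ TotalSpace.mk' (EuclideanSpace ℝ (Fin (2 * n + 1)) →L[ℝ] ℝ)
      (E := fun x : M ↦ TangentSpace (𝓡 (2 * n + 1)) x →L[ℝ] ℝ) x (S.η x))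
  metric : IsSemiRiemannianMetric S.g
  contact : ∀ x, ∃ v, wedgeForm S.η x v ≠ 0
  η_ξ : ∀ x, S.η x (S.ξ x) = 1
  dη_ξ : ∀ x v, extD S.η x (S.ξ x) v = 0
  η_eq : ∀ x v, S.η x v = S.g x (S.ξ x) v
  dη_eq : ∀ x v w, extD S.η x v w = S.g x v (S.φ x w)
  φ_sq : ∀ x v, S.φ x (S.φ x v) = v - S.η x v • S.ξ x

/-- H-paracontact: a paracontact metric structure whose Reeb vector field is harmonic. -/
def IsHParacontact [MeasurableSpace M] (S : Tensors n M) : Prop :=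
  IsParacontactMetric S ∧ IsHarmonicField S.g S.ξ

/-- The `D`-homothetic deformation
`φ_t = φ`, `ξ_t = t⁻¹ ξ`, `η_t = t η`, `g_t = t g + t (t - 1) η ⊗ η`. -/
def Tensors.deform (S : Tensors n M) (t : ℝ) : Tensors n M where
  φ := S.φ
  ξ := fun x ↦ t⁻¹ • S.ξ x
  η := fun x ↦ t • S.η x
  g := fun x ↦ t • S.g x + (t * (t - 1)) • (S.η x).smulRight (S.η x)

end Structure

end Paracontact

end

/-! Everything rests on comparing the Levi-Civita connections of `g` and `g_t` in a chart. Let `∇`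
be the connection of `g`, `P = ∇ξ`, and `A` the difference of the two connections. The Koszul
formula gives (`christoffel_deformMetric`) A(u,v) = ((t-1)/t) · sym(u,v) ξ - (t-1)(η(v) φu + η(u)
φv), with sym(u,v) the symmetrization of g(Pu,v). Since Pξ = 0, φξ = 0 and η∘P = 0, it follows that
A(u,ξ) = -(t-1)φu and ∇ᵗξ_t = t⁻¹(P - (t-1)φ).

The second ingredient is that the divergence of φ, the trace of z ↦ (∇_z φ)v, vanishes for v in ker
η (`trace_covDerivEndFlip`). It follows from three identities for ∇φ: skewness, the cyclic identity
d(dη) = 0, and the derivative of φ² = I - η⊗ξ.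

Ricci tensor: the difference of z ↦ R_t(v,z)ξ and z ↦ R(v,z)ξ is a sum of terms of trace zero. They
are the divergence of φ on ker η, a commutator, the maps A(·,x) and their derivatives, and maps A(v,
L·) where L kills ξ and has image in ker η (`trace_ricciEnd_deformMetric`). The factor 1/t is the
one in ξ_t = ξ/t.

Harmonicity: ξ is harmonic exactly when ∫_D tr_g g(∇U,∇ξ) = 0 for all compactly supported U
orthogonal to ξ, with the support in D (`isHarmonicField_iff`). Orthogonality to ξ and to ξ_t are
the same condition η(U) = 0. For such U the integrand for the deformed structure is t⁻¹ tr_g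
g(∇U,∇ξ) + ((t-1)/t) div(φU) (`formTrace_deformMetric`), where the vanishing divergence of φ turns
tr(φ∘∇U) into div(φU). The volume is multiplied by the constant |t|^(n+1), and the divergence
integrates to zero, so the two first variations differ by a nonzero constant factor. -/

set_option maxSynthPendingDepth 3

noncomputable section

namespace Paracontact

/-! ### Nondegenerate bilinear forms, traces and Christoffel symbols -/

section LinearAlgebra

variable {E : Type*} [NormedAddCommGroup E] [NormedSpace ℝ E] [FiniteDimensional ℝ E]

/-- The form G identifies E with its dual and carries `L` to the transpose of `L'`, and the trace is
invariant under conjugation and transposition. No positivity is involved, so indefinite metrics are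
covered. -/
lemma trace_eq_of_adjoint {G : E →L[ℝ] E →L[ℝ] ℝ} (hG : ∀ v, (∀ w, G v w = 0) → v = 0)
    {L L' : E →ₗ[ℝ] E} (h : ∀ u v, G (L u) v = G u (L' v)) :
    LinearMap.trace ℝ E L = LinearMap.trace ℝ E L' := by
  let Φ₀ : E →ₗ[ℝ] Module.Dual ℝ E :=
    { toFun := fun u ↦ (G u : E →ₗ[ℝ] ℝ), map_add' := by intros; ext; simp,
      map_smul' := by intros; ext; simp }
  have hinj : Function.Injective Φ₀ := by
    rw [← LinearMap.ker_eq_bot, LinearMap.ker_eq_bot']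
    intro v hv
    exact hG v fun w ↦ LinearMap.congr_fun hv w
  let Φ : E ≃ₗ[ℝ] Module.Dual ℝ E := LinearEquiv.ofInjectiveOfFinrankEq Φ₀ hinj
    (Subspace.dual_finrank_eq).symm
  have : LinearMap.dualMap L' = Φ.conj L := by
    ext α v
    obtain ⟨u, rfl⟩ := Φ.surjective α
    simp only [LinearEquiv.conj_apply, LinearMap.comp_apply, LinearEquiv.coe_coe,
      LinearEquiv.symm_apply_apply, LinearMap.dualMap_apply]
    exact (h u v).symm
  rw [← LinearMap.trace_transpose' L', show Module.Dual.transpose L' = L'.dualMap from rfl, this,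
    LinearMap.trace_conj']

lemma isInvertible_of_nondegenerate {G : E →L[ℝ] E →L[ℝ] ℝ}
    (hG : ∀ v, (∀ w, G v w = 0) → v = 0) : G.IsInvertible := by
  have hinj : Function.Injective (G : E →ₗ[ℝ] E →L[ℝ] ℝ) := by
    rw [← LinearMap.ker_eq_bot, LinearMap.ker_eq_bot']
    intro v hv
    exact hG v fun w ↦ by
      have : G v = 0 := hv
      simp [this]
  have e : Module.finrank ℝ E = Module.finrank ℝ (E →L[ℝ] ℝ) := by
    rw [← (LinearMap.toContinuousLinearMap : (E →ₗ[ℝ] ℝ) ≃ₗ[ℝ] _).finrank_eq]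
    exact (Subspace.dual_finrank_eq).symm
  refine ⟨(LinearEquiv.ofInjectiveOfFinrankEq _ hinj e).toContinuousLinearEquiv, ?_⟩
  ext; rfl

lemma apply_inverse_of_nondegenerate {G : E →L[ℝ] E →L[ℝ] ℝ}
    (hG : ∀ v, (∀ w, G v w = 0) → v = 0) (α : E →L[ℝ] ℝ) : G (G.inverse α) = α := by
  obtain ⟨e, rfl⟩ := isInvertible_of_nondegenerate hG
  simp

omit [FiniteDimensional ℝ E] in
lemma eq_of_forall_apply_eq {G : E →L[ℝ] E →L[ℝ] ℝ} (hG : ∀ v, (∀ w, G v w = 0) → v = 0)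
    {u v : E} (h : ∀ w, G u w = G v w) : u = v :=
  sub_eq_zero.1 (hG _ fun w ↦ by simp [h w])

/-- The half of `D(u)(v,w) + D(v)(u,w) - D(w)(u,v)`. -/
def koszulForm (D : E →L[ℝ] E →L[ℝ] E →L[ℝ] ℝ) : E →L[ℝ] E →L[ℝ] E →L[ℝ] ℝ :=
  (1 / 2 : ℝ) • (D + D.flip -
    ((ContinuousLinearMap.flipₗᵢ ℝ E E ℝ).toContinuousLinearEquiv :
      (E →L[ℝ] E →L[ℝ] ℝ) →L[ℝ] (E →L[ℝ] E →L[ℝ] ℝ)) ∘L D.flip)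

omit [FiniteDimensional ℝ E] in
lemma koszulForm_apply (D : E →L[ℝ] E →L[ℝ] E →L[ℝ] ℝ) (u v w : E) :
    koszulForm D u v w = (1 / 2 : ℝ) * (D u v w + D v u w - D w u v) := by
  simp [koszulForm]

/-- The Christoffel symbols of a metric `G` on an open subset of a vector space. -/
def christoffel (G : E → E →L[ℝ] E →L[ℝ] ℝ) (y : E) : E →L[ℝ] E →L[ℝ] E :=
  (ContinuousLinearMap.compL ℝ E (E →L[ℝ] ℝ) E (G y).inverse) ∘L koszulForm (fderiv ℝ G y)

omit [FiniteDimensional ℝ E] in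
lemma christoffel_apply (G : E → E →L[ℝ] E →L[ℝ] ℝ) (y u v : E) :
    christoffel G y u v = (G y).inverse (koszulForm (fderiv ℝ G y) u v) := rfl

/-- The covariant derivative `v ↦ ∇_v V` at `y`. -/
def covDeriv (G : E → E →L[ℝ] E →L[ℝ] ℝ) (V : E → E) (y : E) : E →L[ℝ] E :=
  fderiv ℝ V y + (christoffel G y).flip (V y)

omit [FiniteDimensional ℝ E] in
lemma covDeriv_apply (G : E → E →L[ℝ] E →L[ℝ] ℝ) (V : E → E) (y v : E) :
    covDeriv G V y v = fderiv ℝ V y v + christoffel G y v (V y) := rfl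

/-- The trace of a bilinear form with respect to a metric. -/
def formTrace (G B : E →L[ℝ] E →L[ℝ] ℝ) : ℝ :=
  LinearMap.trace ℝ E (G.inverse ∘L B : E →L[ℝ] E)

/-- Metric traces are computed by exhibiting the endomorphism that represents `B`, without inverting
`G`. -/
lemma formTrace_eq {G B : E →L[ℝ] E →L[ℝ] ℝ} (hG : ∀ v, (∀ w, G v w = 0) → v = 0)
    {L : E →ₗ[ℝ] E} (h : ∀ u v, G (L u) v = B u v) : formTrace G B = LinearMap.trace ℝ E L := by
  unfold formTrace
  congr 1
  ext u
  refine eq_of_forall_apply_eq hG fun w ↦ ?_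
  simp [h, apply_inverse_of_nondegenerate hG]

end LinearAlgebra

/-! ### The Levi-Civita connection of a metric on an open set -/

section Metric

variable {E : Type*} [NormedAddCommGroup E] [NormedSpace ℝ E]

/-- A metric on an open subset of a vector space. -/
structure LocalMetric (Ω : Set E) (G : E → E →L[ℝ] E →L[ℝ] ℝ) : Prop where
  isOpen : IsOpen Ω
  smooth : ContDiffOn ℝ ∞ G Ω
  symm : ∀ y ∈ Ω, ∀ u v, G y u v = G y v u
  nondeg : ∀ y ∈ Ω, ∀ v, (∀ w, G y v w = 0) → v = 0

namespace LocalMetric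

variable {Ω : Set E} {G : E → E →L[ℝ] E →L[ℝ] ℝ} (h : LocalMetric Ω G) {y : E} (hy : y ∈ Ω)
include h hy

lemma contDiffAt : ContDiffAt ℝ ∞ G y := h.smooth.contDiffAt (h.isOpen.mem_nhds hy)

lemma differentiableAt : DifferentiableAt ℝ G y := (h.contDiffAt hy).differentiableAt (by simp)

lemma fderiv_symm (u v w : E) : fderiv ℝ G y u v w = fderiv ℝ G y u w v := by
  have hd := (h.differentiableAt hy).hasFDerivAt
  have h1 : HasFDerivAt (fun z ↦ G z v w) _ y :=
    (hd.clm_apply (hasFDerivAt_const v y)).clm_apply (hasFDerivAt_const w y)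
  have h2 : HasFDerivAt (fun z ↦ G z w v) _ y :=
    (hd.clm_apply (hasFDerivAt_const w y)).clm_apply (hasFDerivAt_const v y)
  have h3 := h1.congr_of_eventuallyEq (f₁ := fun z ↦ G z w v)
    (by filter_upwards [h.isOpen.mem_nhds hy] with z hz using h.symm z hz _ _)
  simpa using DFunLike.congr_fun (h3.unique h2) u

variable [FiniteDimensional ℝ E]

lemma apply_christoffel (u v w : E) : G y (christoffel G y u v) w =
    (1 / 2 : ℝ) * (fderiv ℝ G y u v w + fderiv ℝ G y v u w - fderiv ℝ G y w u v) := by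
  rw [christoffel_apply, apply_inverse_of_nondegenerate (h.nondeg y hy), koszulForm_apply]

lemma christoffel_symm (u v : E) : christoffel G y u v = christoffel G y v u := by
  refine eq_of_forall_apply_eq (h.nondeg y hy) fun w ↦ ?_
  rw [h.apply_christoffel hy, h.apply_christoffel hy, h.fderiv_symm hy w u v]
  ring

/-- Metric compatibility ∇G = 0 in coordinates. Derivatives of `G` are traded for Christoffel
symbols by means of it. -/
lemma fderiv_eq (u v w : E) : fderiv ℝ G y u v w =
    G y (christoffel G y u v) w + G y v (christoffel G y u w) := by
  rw [h.symm y hy v, h.apply_christoffel hy, h.apply_christoffel hy, h.fderiv_symm hy v u w,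
    h.fderiv_symm hy w u v, h.fderiv_symm hy u w v]
  ring

omit hy in
lemma contDiffOn_inverse : ContDiffOn ℝ ∞ (fun y ↦ (G y).inverse) Ω := by
  intro y hy
  obtain ⟨e, he⟩ := isInvertible_of_nondegenerate (h.nondeg y hy)
  have := contDiffAt_map_inverse (n := ∞) e
  rw [he] at this
  exact (this.comp y (h.contDiffAt hy)).contDiffWithinAt

omit hy in
lemma contDiffOn_christoffel : ContDiffOn ℝ ∞ (christoffel G) Ω := by
  have hD : ContDiffOn ℝ ∞ (fderiv ℝ G) Ω := h.smooth.fderiv_of_isOpen h.isOpen (by simp)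
  have hK : ContDiffOn ℝ ∞ (fun y ↦ koszulForm (fderiv ℝ G y)) Ω := by
    rw [contDiffOn_clm_apply]; intro u
    rw [contDiffOn_clm_apply]; intro v
    rw [contDiffOn_clm_apply]; intro w
    simp only [koszulForm_apply]
    fun_prop
  rw [contDiffOn_clm_apply]; intro u
  rw [contDiffOn_clm_apply]; intro v
  simp only [christoffel_apply]
  have := h.contDiffOn_inverse
  fun_prop

omit hy in
lemma contDiffOn_covDeriv {V : E → E} (hV : ContDiffOn ℝ ∞ V Ω) :
    ContDiffOn ℝ ∞ (covDeriv G V) Ω := by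
  have hD : ContDiffOn ℝ ∞ (fderiv ℝ V) Ω := hV.fderiv_of_isOpen h.isOpen (by simp)
  have hΓ := h.contDiffOn_christoffel
  rw [contDiffOn_clm_apply]; intro u
  simp only [covDeriv_apply]
  fun_prop

end LocalMetric

end Metric

/-! ### Paracontact identities in coordinates and the divergence of φ -/

section LocalStructure

variable {E : Type*} [NormedAddCommGroup E] [NormedSpace ℝ E]

/-- A paracontact metric structure on an open subset of a vector space. -/
structure LocalParacontact (Ω : Set E) (φ : E → E →L[ℝ] E) (ξ : E → E) (η : E → E →L[ℝ] ℝ)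
    (G : E → E →L[ℝ] E →L[ℝ] ℝ) : Prop extends LocalMetric Ω G where
  smooth_φ : ContDiffOn ℝ ∞ φ Ω
  smooth_ξ : ContDiffOn ℝ ∞ ξ Ω
  smooth_η : ContDiffOn ℝ ∞ η Ω
  η_ξ : ∀ y ∈ Ω, η y (ξ y) = 1
  dη_ξ : ∀ y ∈ Ω, ∀ v, fderiv ℝ η y (ξ y) v = fderiv ℝ η y v (ξ y)
  η_eq : ∀ y ∈ Ω, ∀ v, η y v = G y (ξ y) v
  dη_eq : ∀ y ∈ Ω, ∀ v w,
    (1 / 2 : ℝ) * (fderiv ℝ η y v w - fderiv ℝ η y w v) = G y v (φ y w)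
  φ_sq : ∀ y ∈ Ω, ∀ v, φ y (φ y v) = v - η y v • ξ y

/-- The covariant derivative `w ↦ (∇_v φ) w` of a field of endomorphisms. -/
def covDerivEnd (G : E → E →L[ℝ] E →L[ℝ] ℝ) (φ : E → E →L[ℝ] E) (y v : E) : E →L[ℝ] E :=
  fderiv ℝ φ y v + christoffel G y v ∘L φ y - φ y ∘L christoffel G y v

lemma covDerivEnd_apply (G : E → E →L[ℝ] E →L[ℝ] ℝ) (φ : E → E →L[ℝ] E) (y v w : E) :
    covDerivEnd G φ y v w = fderiv ℝ φ y v w + christoffel G y v (φ y w)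
      - φ y (christoffel G y v w) := rfl

namespace LocalParacontact

variable {Ω : Set E} {φ : E → E →L[ℝ] E} {ξ : E → E} {η : E → E →L[ℝ] ℝ}
  {G : E → E →L[ℝ] E →L[ℝ] ℝ} (h : LocalParacontact Ω φ ξ η G) {y : E} (hy : y ∈ Ω)
include h hy

lemma mem_nhds : Ω ∈ 𝓝 y := h.isOpen.mem_nhds hy

lemma hasFDerivAt_φ : HasFDerivAt φ (fderiv ℝ φ y) y :=
  ((h.smooth_φ.contDiffAt (h.mem_nhds hy)).differentiableAt (by simp)).hasFDerivAt

lemma hasFDerivAt_ξ : HasFDerivAt ξ (fderiv ℝ ξ y) y :=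
  ((h.smooth_ξ.contDiffAt (h.mem_nhds hy)).differentiableAt (by simp)).hasFDerivAt

lemma hasFDerivAt_η : HasFDerivAt η (fderiv ℝ η y) y :=
  ((h.smooth_η.contDiffAt (h.mem_nhds hy)).differentiableAt (by simp)).hasFDerivAt

lemma hasFDerivAt_G : HasFDerivAt G (fderiv ℝ G y) y :=
  (h.differentiableAt hy).hasFDerivAt

lemma η_φ (v : E) : η y (φ y v) = 0 := by
  rw [h.η_eq y hy, ← h.dη_eq y hy, h.dη_ξ y hy]
  ring

lemma φ_skew (u v : E) : G y (φ y u) v = - G y u (φ y v) := by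
  rw [h.symm y hy, ← h.dη_eq y hy, ← h.dη_eq y hy]
  ring

lemma φ_ξ : φ y (ξ y) = 0 := by
  refine h.nondeg y hy _ fun w ↦ ?_
  rw [h.φ_skew hy, ← h.η_eq y hy, h.η_φ hy, neg_zero]

variable [FiniteDimensional ℝ E]

/-- The left side is (∇_u η)(v). Since ∇G = 0, differentiating η = G(ξ,·) moves the derivative onto
ξ. -/
lemma covDeriv_η (u v : E) :
    fderiv ℝ η y u v - η y (christoffel G y u v) = G y (covDeriv G ξ y u) v := by
  have h1 : HasFDerivAt (fun z ↦ G z (ξ z) v) _ y :=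
    ((h.hasFDerivAt_G hy).clm_apply (h.hasFDerivAt_ξ hy)).clm_apply (hasFDerivAt_const v y)
  have h2 : HasFDerivAt (fun z ↦ η z v) _ y :=
    (h.hasFDerivAt_η hy).clm_apply (hasFDerivAt_const v y)
  have h3 := h1.congr_of_eventuallyEq (f₁ := fun z ↦ η z v)
    (by filter_upwards [h.mem_nhds hy] with z hz using h.η_eq z hz v)
  have h4 := DFunLike.congr_fun (h3.unique h2) u
  simp only [zero_add, _root_.add_apply, ContinuousLinearMap.comp_zero,
    ContinuousLinearMap.comp_apply, ContinuousLinearMap.flip_apply] at h4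
  rw [← h4, h.fderiv_eq hy, covDeriv_apply, map_add, h.η_eq y hy]
  simp only [_root_.add_apply]
  ring

/-- Differentiating η(ξ) = 1 gives (∇_u η)(ξ) + η(∇_u ξ) = 0, and the two summands are equal by
`covDeriv_η`. -/
lemma η_covDeriv_ξ (u : E) : η y (covDeriv G ξ y u) = 0 := by
  have h1 : HasFDerivAt (fun z ↦ η z (ξ z)) _ y :=
    (h.hasFDerivAt_η hy).clm_apply (h.hasFDerivAt_ξ hy)
  have h3 := h1.congr_of_eventuallyEq (f₁ := fun z ↦ (1 : ℝ))
    (by filter_upwards [h.mem_nhds hy] with z hz using (h.η_ξ z hz).symm)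
  have h4 := DFunLike.congr_fun (h3.unique (hasFDerivAt_const 1 y)) u
  simp only [_root_.add_apply, ContinuousLinearMap.comp_apply,
    ContinuousLinearMap.flip_apply, _root_.zero_apply] at h4
  have h5 := h.covDeriv_η hy u (ξ y)
  rw [h.symm y hy, ← h.η_eq y hy] at h5
  rw [covDeriv_apply, map_add] at h5 ⊢
  linarith

/-- The Reeb field is geodesic: dη(ξ,·) = 0 gives (∇_ξ η)(w) = (∇_w η)(ξ), which is G(∇_w ξ, ξ) = 0.
-/
lemma covDeriv_ξ_ξ : covDeriv G ξ y (ξ y) = 0 := by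
  refine h.nondeg y hy _ fun w ↦ ?_
  rw [← h.covDeriv_η hy, h.dη_ξ y hy, h.christoffel_symm hy, h.covDeriv_η hy, h.symm y hy,
    ← h.η_eq y hy, h.η_covDeriv_ξ hy]

/-- The connection is torsion-free, so the antisymmetric part of ∇η is dη = G(·,φ·). The 2 comes
from the factor 1/2 in the normalization of dη. -/
lemma covDeriv_ξ_sub (u v : E) :
    G y (covDeriv G ξ y u) v - G y (covDeriv G ξ y v) u = 2 * G y u (φ y v) := by
  rw [← h.covDeriv_η hy, ← h.covDeriv_η hy, h.christoffel_symm hy u v, ← h.dη_eq y hy]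
  ring

/-- Covariant derivative of the skewness of φ. -/
lemma covDerivEnd_skew (u v w : E) :
    G y (covDerivEnd G φ y u v) w = - G y v (covDerivEnd G φ y u w) := by
  have h1 : HasFDerivAt (fun z ↦ G z (φ z v) w) _ y :=
    ((h.hasFDerivAt_G hy).clm_apply ((h.hasFDerivAt_φ hy).clm_apply
      (hasFDerivAt_const v y))).clm_apply (hasFDerivAt_const w y)
  have h2 : HasFDerivAt (fun z ↦ - G z v (φ z w)) _ y :=
    (((h.hasFDerivAt_G hy).clm_apply (hasFDerivAt_const v y)).clm_apply
      ((h.hasFDerivAt_φ hy).clm_apply (hasFDerivAt_const w y))).neg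
  have h3 := h1.congr_of_eventuallyEq (f₁ := fun z ↦ - G z v (φ z w))
    (by filter_upwards [h.mem_nhds hy] with z hz using (h.φ_skew hz v w).symm)
  have h4 := DFunLike.congr_fun (h3.unique h2) u
  simp only [zero_add, _root_.add_apply, ContinuousLinearMap.comp_zero,
    ContinuousLinearMap.comp_apply, ContinuousLinearMap.flip_apply, h.fderiv_eq hy,
    _root_.neg_apply] at h4
  have h5 := h.φ_skew hy v (christoffel G y u w)
  have h6 := h.φ_skew hy (christoffel G y u v) w
  simp only [covDerivEnd_apply, map_add, map_sub, _root_.add_apply,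
    _root_.sub_apply]
  linarith

/-- The form `G(·, φ ·)` is closed, being half the exterior derivative of `η`. -/
lemma covDerivEnd_cyclic (u v w : E) : G y v (covDerivEnd G φ y u w) +
    G y w (covDerivEnd G φ y v u) + G y u (covDerivEnd G φ y w v) = 0 := by
  have hη : ContDiffAt ℝ ∞ η y := h.smooth_η.contDiffAt (h.mem_nhds hy)
  have hsym : IsSymmSndFDerivAt ℝ η y := hη.isSymmSndFDerivAt (by simpa using ENat.LEInfty.out)
  have hD : HasFDerivAt (fderiv ℝ η) (fderiv ℝ (fderiv ℝ η) y) y :=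
    ((hη.fderiv_right (m := 1) (by norm_num; exact ENat.LEInfty.out)).differentiableAt (by simp)).hasFDerivAt
  -- This is the u-derivative of dη(v,w) = G(v, φw). In the cyclic sum the second derivatives of η
  -- cancel by symmetry, and the Christoffel terms cancel by skewness of φ and vanishing torsion.
  have key : ∀ u v w : E, (1 / 2 : ℝ) * (fderiv ℝ (fderiv ℝ η) y u v w
      - fderiv ℝ (fderiv ℝ η) y u w v) = G y (christoffel G y u v) (φ y w) +
      G y v (φ y (christoffel G y u w)) + G y v (covDerivEnd G φ y u w) := by
    intro u v w
    have h1 : HasFDerivAt (fun z ↦ G z v (φ z w)) _ y :=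
      ((h.hasFDerivAt_G hy).clm_apply (hasFDerivAt_const v y)).clm_apply
        ((h.hasFDerivAt_φ hy).clm_apply (hasFDerivAt_const w y))
    have h2 : HasFDerivAt (fun z ↦ (1 / 2 : ℝ) * (fderiv ℝ η z v w - fderiv ℝ η z w v)) _ y :=
      (((hD.clm_apply (hasFDerivAt_const v y)).clm_apply (hasFDerivAt_const w y)).sub
      ((hD.clm_apply (hasFDerivAt_const w y)).clm_apply (hasFDerivAt_const v y))).const_mul _
    have h3 := h1.congr_of_eventuallyEq
      (f₁ := fun z ↦ (1 / 2 : ℝ) * (fderiv ℝ η z v w - fderiv ℝ η z w v))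
      (by filter_upwards [h.mem_nhds hy] with z hz using h.dη_eq z hz v w)
    have h4 := DFunLike.congr_fun (h3.unique h2) u
    simp only [zero_add, _root_.add_apply, ContinuousLinearMap.comp_zero,
      ContinuousLinearMap.comp_apply, ContinuousLinearMap.flip_apply, h.fderiv_eq hy,
      _root_.sub_apply, _root_.smul_apply, smul_eq_mul] at h4
    rw [← h4]
    simp only [covDerivEnd_apply, map_add, map_sub]
    ring
  have k1 := key u v w
  have k2 := key v w u
  have k3 := key w u v
  rw [hsym.eq u v] at k1
  rw [hsym.eq v w] at k2
  rw [hsym.eq w u] at k3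
  have e1 := h.φ_skew hy (christoffel G y u v) w
  have e2 := h.φ_skew hy (christoffel G y v w) u
  have e3 := h.φ_skew hy (christoffel G y w u) v
  rw [h.symm y hy] at e1 e2 e3
  rw [h.christoffel_symm hy u w] at k1
  rw [h.christoffel_symm hy v u] at k2
  rw [h.christoffel_symm hy w v] at k3
  linarith

/-- Covariant derivative of φ² = I - η⊗ξ, with ∇η rewritten through ∇ξ. -/
lemma covDerivEnd_comp (u v : E) :
    covDerivEnd G φ y u (φ y v) + φ y (covDerivEnd G φ y u v) =
      - (G y (covDeriv G ξ y u) v • ξ y) - η y v • covDeriv G ξ y u := by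
  have h1 : HasFDerivAt (fun z ↦ φ z (φ z v)) _ y :=
    (h.hasFDerivAt_φ hy).clm_apply ((h.hasFDerivAt_φ hy).clm_apply (hasFDerivAt_const v y))
  have h2 : HasFDerivAt (fun z ↦ v - η z v • ξ z) _ y :=
    (hasFDerivAt_const v y).sub
      (((h.hasFDerivAt_η hy).clm_apply (hasFDerivAt_const v y)).smul (h.hasFDerivAt_ξ hy))
  have h3 := h1.congr_of_eventuallyEq (f₁ := fun z ↦ v - η z v • ξ z)
    (by filter_upwards [h.mem_nhds hy] with z hz using (h.φ_sq z hz v).symm)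
  have h4 := DFunLike.congr_fun (h3.unique h2) u
  simp only [zero_add, _root_.add_apply, ContinuousLinearMap.comp_zero,
    ContinuousLinearMap.comp_apply, ContinuousLinearMap.flip_apply,
    _root_.sub_apply, _root_.smul_apply, 
    _root_.zero_apply, ContinuousLinearMap.smulRight_apply] at h4
  have h5 := h.φ_sq y hy v
  have h6 := h.φ_sq y hy (christoffel G y u v)
  rw [← h.covDeriv_η hy]
  simp only [covDerivEnd_apply, map_add, map_sub, h6, h5, map_smul, covDeriv_apply]
  rw [show fderiv ℝ φ y u (φ y v) = 0 - (η y v • fderiv ℝ ξ y u + fderiv ℝ η y u v • ξ y)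
    - φ y (fderiv ℝ φ y u v) from by rw [← h4]; abel]
  module

/-- In the trace of `covDerivEnd_comp` the two products on the left have equal traces. The rank-one
terms on the right contribute G(∇_a ξ, ξ) and η(∇_a ξ), both zero. -/
lemma trace_covDerivEnd_comp (a : E) :
    LinearMap.trace ℝ E (covDerivEnd G φ y a ∘L φ y : E →L[ℝ] E) = 0 := by
  have h1 : (covDerivEnd G φ y a ∘L φ y : E →ₗ[ℝ] E) + (φ y ∘L covDerivEnd G φ y a : E →L[ℝ] E) =
      - ((G y (covDeriv G ξ y a) : E →ₗ[ℝ] ℝ).smulRight (ξ y))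
      - (η y : E →ₗ[ℝ] ℝ).smulRight (covDeriv G ξ y a) := by
    ext v
    simpa using h.covDerivEnd_comp hy a v
  have h2 := congrArg (LinearMap.trace ℝ E) h1
  rw [map_add, map_sub, map_neg, LinearMap.trace_smulRight, LinearMap.trace_smulRight] at h2
  have h3 : LinearMap.trace ℝ E (φ y ∘L covDerivEnd G φ y a : E →L[ℝ] E) =
      LinearMap.trace ℝ E (covDerivEnd G φ y a ∘L φ y : E →L[ℝ] E) :=
    LinearMap.trace_mul_comm ℝ (φ y : E →ₗ[ℝ] E) (covDerivEnd G φ y a : E →ₗ[ℝ] E)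
  simp only [ContinuousLinearMap.coe_coe, h.η_covDeriv_ξ hy, h3] at h2
  rw [h.symm y hy, ← h.η_eq y hy, h.η_covDeriv_ξ hy] at h2
  linarith

/-- The linear map `z ↦ (∇_z φ) a`. -/
def covDerivEndFlip (G : E → E →L[ℝ] E →L[ℝ] ℝ) (φ : E → E →L[ℝ] E) (y a : E) : E →L[ℝ] E :=
  (fderiv ℝ φ y).flip a + (christoffel G y).flip (φ y a) - φ y ∘L (christoffel G y).flip a

omit h hy [FiniteDimensional ℝ E] in
lemma covDerivEndFlip_apply (a z : E) :
    covDerivEndFlip G φ y a z = covDerivEnd G φ y z a := rfl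

/-- Let T z = (∇_z φ)a. By the cyclic identity and skewness, T∘φ - (∇_a φ)∘φ is the G-adjoint of
-φ∘T. Taking traces, with tr((∇_a φ)∘φ) = 0 and tr(T∘φ) = tr(φ∘T), gives 2 tr(φ∘T) = 0. -/
lemma trace_comp_covDerivEndFlip (a : E) :
    LinearMap.trace ℝ E (φ y ∘L covDerivEndFlip G φ y a : E →L[ℝ] E) = 0 := by
  let T := covDerivEndFlip G φ y a
  have h1 : LinearMap.trace ℝ E (T ∘L φ y - covDerivEnd G φ y a ∘L φ y : E →L[ℝ] E) =
      LinearMap.trace ℝ E (-(φ y ∘L T) : E →L[ℝ] E) := by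
    refine trace_eq_of_adjoint (h.nondeg y hy) fun u v ↦ ?_
    have c := h.covDerivEnd_cyclic hy a v (φ y u)
    have s1 := h.covDerivEnd_skew hy (φ y u) v a
    rw [h.symm y hy] at s1
    have s2 := h.φ_skew hy u (covDerivEnd G φ y v a)
    have s3 := h.symm y hy v (covDerivEnd G φ y a (φ y u))
    have s4 := h.symm y hy v (covDerivEnd G φ y (φ y u) a)
    simp only [ContinuousLinearMap.coe_coe, _root_.sub_apply, map_sub, map_neg,
      _root_.neg_apply, ContinuousLinearMap.comp_apply, T, covDerivEndFlip_apply]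
    linarith
  have h2 := h.trace_covDerivEnd_comp hy a
  have h3 : LinearMap.trace ℝ E (T ∘L φ y : E →L[ℝ] E) =
      LinearMap.trace ℝ E (φ y ∘L T : E →L[ℝ] E) :=
    LinearMap.trace_mul_comm ℝ (T : E →ₗ[ℝ] E) (φ y : E →ₗ[ℝ] E)
  rw [ContinuousLinearMap.toLinearMap_sub, ContinuousLinearMap.toLinearMap_neg, map_sub, map_neg,
    h2, h3] at h1
  linarith

/-- The divergence of `φ` vanishes on `ker η`. -/
lemma trace_covDerivEndFlip {v : E} (hv : η y v = 0) :
    LinearMap.trace ℝ E (covDerivEndFlip G φ y v : E →L[ℝ] E) = 0 := by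
  -- The identity `covDerivEnd_comp` is applied to φv, where φ²v = v because η(v) = 0. The rank-one
  -- remainder has trace G(φv, ∇_ξ ξ) = 0.
  have h1 : (φ y ∘L covDerivEndFlip G φ y (φ y v) : E →L[ℝ] E) = - covDerivEndFlip G φ y v -
      (G y (φ y v) ∘L covDeriv G ξ y).smulRight (ξ y) := by
    ext z
    have e1 := h.covDerivEnd_comp hy z (φ y v)
    rw [h.φ_sq y hy, hv, zero_smul, sub_zero, h.η_φ hy, zero_smul, sub_zero, h.symm y hy] at e1
    simp only [ContinuousLinearMap.comp_apply, covDerivEndFlip_apply,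
      _root_.sub_apply, _root_.neg_apply,
      ContinuousLinearMap.smulRight_apply]
    rw [← sub_eq_zero] at e1 ⊢
    rw [← e1]
    abel
  have h2 := h.trace_comp_covDerivEndFlip hy (φ y v)
  rw [h1, ContinuousLinearMap.toLinearMap_sub, ContinuousLinearMap.toLinearMap_neg, map_sub,
    map_neg] at h2
  have h3 : LinearMap.trace ℝ E ((G y (φ y v) ∘L covDeriv G ξ y).smulRight (ξ y) : E →L[ℝ] E)
      = G y (φ y v) (covDeriv G ξ y (ξ y)) :=
    LinearMap.trace_smulRight ((G y (φ y v) ∘L covDeriv G ξ y : E →L[ℝ] ℝ) : E →ₗ[ℝ] ℝ) (ξ y)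
  rw [h3, h.covDeriv_ξ_ξ hy, map_zero] at h2
  linarith

end LocalParacontact

end LocalStructure

/-! ### Connection, energy density and Ricci curvature of the deformed metric -/

section LocalDeformation

variable {E : Type*} [NormedAddCommGroup E] [NormedSpace ℝ E]

/-- The metric `t G + t (t - 1) η ⊗ η`. -/
def deformMetric (t : ℝ) (η : E → E →L[ℝ] ℝ) (G : E → E →L[ℝ] E →L[ℝ] ℝ) (y : E) :
    E →L[ℝ] E →L[ℝ] ℝ :=
  t • G y + (t * (t - 1)) • (η y).smulRight (η y)

lemma deformMetric_apply (t : ℝ) (η : E → E →L[ℝ] ℝ) (G : E → E →L[ℝ] E →L[ℝ] ℝ) (y u v : E) :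
    deformMetric t η G y u v = t * G y u v + t * (t - 1) * (η y u * η y v) := by
  simp [deformMetric]

/-- The endomorphism `z ↦ R(v, z) w`, whose trace is the Ricci tensor. -/
def ricciEnd (G : E → E →L[ℝ] E →L[ℝ] ℝ) (y v w : E) : E →L[ℝ] E :=
  ((fderiv ℝ (christoffel G) y).flip v).flip w + (christoffel G y).flip (christoffel G y v w)
    - (fderiv ℝ (christoffel G) y v).flip w - christoffel G y v ∘L (christoffel G y).flip w

lemma ricciEnd_apply (G : E → E →L[ℝ] E →L[ℝ] ℝ) (y v w z : E) :
    ricciEnd G y v w z = fderiv ℝ (christoffel G) y z v w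
      + christoffel G y z (christoffel G y v w)
      - fderiv ℝ (christoffel G) y v z w - christoffel G y v (christoffel G y z w) := rfl

namespace LocalParacontact

variable {Ω : Set E} {φ : E → E →L[ℝ] E} {ξ : E → E} {η : E → E →L[ℝ] ℝ}
  {G : E → E →L[ℝ] E →L[ℝ] ℝ} (h : LocalParacontact Ω φ ξ η G) {t : ℝ} (ht : t ≠ 0)
  (ht' : LocalMetric Ω (deformMetric t η G)) {y : E} (hy : y ∈ Ω)
include h hy

lemma fderiv_deformMetric (u v w : E) : fderiv ℝ (deformMetric t η G) y u v w =
    t * fderiv ℝ G y u v w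
      + t * (t - 1) * (fderiv ℝ η y u v * η y w + η y v * fderiv ℝ η y u w) := by
  have hη := h.hasFDerivAt_η hy
  have hG := h.hasFDerivAt_G hy
  have hd : DifferentiableAt ℝ (deformMetric t η G) y :=
    (hG.differentiableAt.const_smul t).add
      (DifferentiableAt.const_smul (((ContinuousLinearMap.smulRightL ℝ E
        (E →L[ℝ] ℝ)).differentiableAt.comp y hη.differentiableAt).clm_apply
          hη.differentiableAt) (t * (t - 1)))
  have h1 : HasFDerivAt (fun z ↦ deformMetric t η G z v w) _ y :=
    (hd.hasFDerivAt.clm_apply (hasFDerivAt_const v y)).clm_apply (hasFDerivAt_const w y)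
  have h2 : HasFDerivAt (fun z ↦ t * G z v w + t * (t - 1) * (η z v * η z w)) _ y :=
    (((hG.clm_apply (hasFDerivAt_const v y)).clm_apply (hasFDerivAt_const w y)).const_mul t).add
      (((hη.clm_apply (hasFDerivAt_const v y)).mul
        (hη.clm_apply (hasFDerivAt_const w y))).const_mul (t * (t - 1)))
  simp only [deformMetric_apply] at h1
  have h4 := DFunLike.congr_fun (h1.unique h2) u
  simp only [zero_add, _root_.add_apply, ContinuousLinearMap.comp_zero,
    ContinuousLinearMap.flip_apply, _root_.smul_apply, smul_eq_mul] at h4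
  rw [h4]
  ring

variable [FiniteDimensional ℝ E]
include ht ht'

/-- Pair both sides with w under the deformed metric and apply the Koszul formula. In the derivative
of η⊗η, the symmetric part of ∇η yields the ξ-term, while the antisymmetric part is dη and yields
the φ-terms. -/
lemma christoffel_deformMetric (u v : E) : christoffel (deformMetric t η G) y u v =
    christoffel G y u v + ((t - 1) / t * (1 / 2 * (G y (covDeriv G ξ y u) v
      + G y (covDeriv G ξ y v) u))) • ξ y - (t - 1) • (η y v • φ y u + η y u • φ y v) := by
  refine eq_of_forall_apply_eq (ht'.nondeg y hy) fun w ↦ ?_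
  rw [ht'.apply_christoffel hy, deformMetric_apply]
  simp only [h.fderiv_deformMetric hy, map_add, map_sub, map_smul, _root_.add_apply,
    _root_.sub_apply, _root_.smul_apply, smul_eq_mul, h.apply_christoffel hy, h.η_φ hy,
    h.η_ξ y hy, ← h.η_eq y hy w]
  have e : ∀ u v, fderiv ℝ η y u v =
      η y (christoffel G y u v) + G y (covDeriv G ξ y u) v := fun u v ↦ by
    rw [← h.covDeriv_η hy]; ring
  simp only [e, h.φ_skew hy, h.christoffel_symm hy v u, h.christoffel_symm hy w u,
    h.christoffel_symm hy w v]
  have e1 := h.covDeriv_ξ_sub hy u w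
  have e2 := h.covDeriv_ξ_sub hy v w
  field_simp
  linear_combination (t * (t - 1)) * (η y v * e1 + η y u * e2)

lemma covDeriv_deformMetric_ξ (u : E) :
    covDeriv (deformMetric t η G) (fun z ↦ t⁻¹ • ξ z) y u =
      t⁻¹ • (covDeriv G ξ y u - (t - 1) • φ y u) := by
  have e : fderiv ℝ (fun z ↦ t⁻¹ • ξ z) y = t⁻¹ • fderiv ℝ ξ y :=
    fderiv_fun_const_smul (h.hasFDerivAt_ξ hy).differentiableAt _
  rw [covDeriv_apply, e, map_smul, h.christoffel_deformMetric ht ht' hy, h.covDeriv_ξ_ξ hy,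
    h.symm y hy (covDeriv G ξ y u), ← h.η_eq y hy, h.η_covDeriv_ξ hy, h.η_ξ y hy, h.φ_ξ hy,
    covDeriv_apply]
  simp only [map_zero, _root_.zero_apply, _root_.smul_apply]
  module

omit ht ht' in
-- The G-adjoint of ∇ξ is ∇ξ + 2φ.
lemma adjoint_covDeriv_ξ (u v : E) :
    G y u (covDeriv G ξ y v) = G y (covDeriv G ξ y u + (2 : ℝ) • φ y u) v := by
  have e1 := h.covDeriv_ξ_sub hy v u
  rw [h.symm y hy u]
  simp only [map_add, map_smul, _root_.add_apply, _root_.smul_apply, smul_eq_mul]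
  rw [h.symm y hy (φ y u)]
  linarith

omit ht ht' in
-- By the product rule div(φU) = (div φ)(U) + tr(φ∘∇U), and div φ vanishes on ker η.
lemma trace_covDeriv_φ {U : E → E} (hU : DifferentiableAt ℝ U y) (hη : η y (U y) = 0) :
    LinearMap.trace ℝ E (covDeriv G (fun z ↦ φ z (U z)) y : E →L[ℝ] E) =
      LinearMap.trace ℝ E (φ y ∘L covDeriv G U y : E →L[ℝ] E) := by
  have e : covDeriv G (fun z ↦ φ z (U z)) y =
      covDerivEndFlip G φ y (U y) + φ y ∘L covDeriv G U y := by
    ext z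
    have h1 : HasFDerivAt (fun z ↦ φ z (U z)) _ y := (h.hasFDerivAt_φ hy).clm_apply hU.hasFDerivAt
    simp only [covDeriv_apply, h1.fderiv, _root_.add_apply, ContinuousLinearMap.comp_apply,
      ContinuousLinearMap.flip_apply, covDerivEndFlip_apply, covDerivEnd_apply, map_add]
    abel
  rw [e, ContinuousLinearMap.toLinearMap_add, map_add, h.trace_covDerivEndFlip hy hη, zero_add]

/-- The density of the first variation of the energy under a deformation. -/
lemma formTrace_deformMetric {U : E → E} (hU : DifferentiableAt ℝ U y) (hη : η y (U y) = 0)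
    {B Bt : E →L[ℝ] E →L[ℝ] ℝ}
    (hB : ∀ u v, B u v = G y (covDeriv G U y u) (covDeriv G ξ y v))
    (hBt : ∀ u v, Bt u v = deformMetric t η G y (covDeriv (deformMetric t η G) U y u)
      (covDeriv (deformMetric t η G) (fun z ↦ t⁻¹ • ξ z) y v)) :
    formTrace (deformMetric t η G y) Bt = t⁻¹ * formTrace (G y) B + (t - 1) / t *
      LinearMap.trace ℝ E (covDeriv G (fun z ↦ φ z (U z)) y : E →L[ℝ] E) := by
  let P := covDeriv G ξ y
  let N := covDeriv G U y
  have hL : formTrace (G y) B =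
      LinearMap.trace ℝ E ((P + (2 : ℝ) • φ y) ∘L N : E →L[ℝ] E) := by
    refine formTrace_eq (h.nondeg y hy) fun u v ↦ ?_
    rw [hB, h.adjoint_covDeriv_ξ hy]
    rfl
  -- `Q` is the G-adjoint of P - (t-1)φ, since P has adjoint P + 2φ and φ is skew.
  let Q : E →L[ℝ] E := P + (t + 1) • φ y
  have hQ : ∀ x v, G y x (P v - (t - 1) • φ y v) = G y (Q x) v := fun x v ↦ by
    have e1 := h.adjoint_covDeriv_ξ hy x v
    have e2 := h.φ_skew hy x v
    simp only [map_sub, map_add, map_smul, _root_.add_apply, _root_.smul_apply, smul_eq_mul,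
      P, Q] at e1 ⊢
    linear_combination e1 - (t - 1) * e2
  have hηQ : ∀ x, η y (Q x) = 0 := fun x ↦ by
    simp [Q, P, h.η_φ hy, h.η_covDeriv_ξ hy]
  -- As η(U) = 0, the deformed derivative of U is N u - (t-1)η(u)φU plus a multiple of ξ. That
  -- multiple drops out because P - (t-1)φ takes values in ker η. On a pair with one argument in ker
  -- η the deformed metric is t times G.
  have hLt : formTrace (deformMetric t η G y) Bt = LinearMap.trace ℝ E
      (t⁻¹ • (Q ∘L N - (t - 1) • (η y).smulRight (Q (φ y (U y)))) : E →L[ℝ] E) := by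
    refine formTrace_eq (ht'.nondeg y hy) fun u v ↦ ?_
    rw [hBt, h.covDeriv_deformMetric_ξ ht ht' hy, covDeriv_apply,
      h.christoffel_deformMetric ht ht' hy, deformMetric_apply, deformMetric_apply, hη]
    have e1 : η y (P v - (t - 1) • φ y v) = 0 := by simp [P, h.η_φ hy, h.η_covDeriv_ξ hy]
    have e2 := h.η_eq y hy (P v - (t - 1) • φ y v)
    have e3 := hQ (N u) v
    have e4 := hQ (φ y (U y)) v
    change _ = t * G y _ (t⁻¹ • (P v - (t - 1) • φ y v))
      + t * (t - 1) * (_ * η y (t⁻¹ • (P v - (t - 1) • φ y v)))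
    generalize P v - (t - 1) • φ y v = w at e1 e2 e3 e4 ⊢
    rw [e1] at e2
    simp only [covDeriv_apply, map_add, _root_.add_apply, N] at e3
    simp only [ContinuousLinearMap.coe_coe, map_smul, e1, _root_.smul_apply, _root_.sub_apply,
      map_sub, map_add, _root_.add_apply, ContinuousLinearMap.comp_apply, hηQ, N,
      ContinuousLinearMap.smulRight_apply, covDeriv_apply, smul_eq_mul, mul_zero, ← e2, zero_mul,
      add_zero, sub_zero, zero_smul, zero_add]
    linear_combination (- t * t⁻¹) * e3 + t * t⁻¹ * (t - 1) * η y u * e4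
  have hN : LinearMap.trace ℝ E (φ y ∘L N : E →L[ℝ] E) =
      LinearMap.trace ℝ E (covDeriv G (fun z ↦ φ z (U z)) y : E →L[ℝ] E) :=
    (h.trace_covDeriv_φ hy hU hη).symm
  have hs : LinearMap.trace ℝ E ((η y).smulRight (Q (φ y (U y))) : E →L[ℝ] E) = 0 :=
    (LinearMap.trace_smulRight (η y : E →ₗ[ℝ] ℝ) _).trans (hηQ _)
  -- Here Q = (P + 2φ) + (t-1)φ: the first part reproduces the undeformed trace, the second gives
  -- the divergence of φU.
  rw [hL, hLt, ← hN]
  simp only [ContinuousLinearMap.toLinearMap_smul, ContinuousLinearMap.toLinearMap_sub, map_smul,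
    map_sub, hs, Q, ContinuousLinearMap.add_comp, ContinuousLinearMap.smul_comp,
    ContinuousLinearMap.toLinearMap_add, map_add, smul_eq_mul]
  field_simp
  ring

omit ht ht' in
-- The trace is linear, hence commutes with differentiation.
lemma trace_fderiv_eq_zero {A : E → E →L[ℝ] E →L[ℝ] E} (hA : DifferentiableAt ℝ A y) (w : E)
    (h0 : ∀ z ∈ Ω, LinearMap.trace ℝ E ((A z).flip w : E →L[ℝ] E) = 0) (v : E) :
    LinearMap.trace ℝ E ((fderiv ℝ A y v).flip w : E →L[ℝ] E) = 0 := by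
  let τ : (E →L[ℝ] E →L[ℝ] E) →L[ℝ] ℝ := LinearMap.toContinuousLinearMap
    { toFun := fun B ↦ LinearMap.trace ℝ E (B.flip w : E →L[ℝ] E)
      map_add' := fun B C ↦ by rw [← map_add]; rfl
      map_smul' := fun c B ↦ by rw [RingHom.id_apply, ← map_smul]; rfl }
  have h1 : HasFDerivAt (fun z ↦ τ (A z)) (τ ∘L fderiv ℝ A y) y :=
    τ.hasFDerivAt.comp y hA.hasFDerivAt
  have h3 := h1.congr_of_eventuallyEq (f₁ := fun _ ↦ (0 : ℝ))
    (by filter_upwards [h.mem_nhds hy] with z hz using (h0 z hz).symm)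
  exact DFunLike.congr_fun (h3.unique (hasFDerivAt_const 0 y)) v

/-- On `ker η`, the deformation does not change the Ricci curvature in the direction of `ξ`. -/
lemma trace_ricciEnd_deformMetric {v : E} (hv : η y v = 0) :
    LinearMap.trace ℝ E (ricciEnd (deformMetric t η G) y v (ξ y) : E →L[ℝ] E) =
      LinearMap.trace ℝ E (ricciEnd G y v (ξ y) : E →L[ℝ] E) := by
  let Γ := christoffel G
  let Γt := christoffel (deformMetric t η G)
  let A : E → E →L[ℝ] E →L[ℝ] E := fun z ↦ Γt z - Γ z
  have hΓ : DifferentiableAt ℝ Γ y :=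
    (h.contDiffOn_christoffel.contDiffAt (h.mem_nhds hy)).differentiableAt (by simp)
  have hΓt : DifferentiableAt ℝ Γt y :=
    (ht'.contDiffOn_christoffel.contDiffAt (h.mem_nhds hy)).differentiableAt (by simp)
  have hA : DifferentiableAt ℝ A y := hΓt.sub hΓ
  have hDA : fderiv ℝ A y = fderiv ℝ Γt y - fderiv ℝ Γ y := fderiv_sub hΓt hΓ
  have A_eq : ∀ z ∈ Ω, ∀ u v, A z u v = ((t - 1) / t * (1 / 2 * (G z (covDeriv G ξ z u) v
      + G z (covDeriv G ξ z v) u))) • ξ z - (t - 1) • (η z v • φ z u + η z u • φ z v) := by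
    intro z hz u v
    simp only [A, Γt, Γ, _root_.sub_apply, h.christoffel_deformMetric ht ht' hz]
    abel
  have A_ξ : ∀ z ∈ Ω, ∀ u, A z u (ξ z) = - (t - 1) • φ z u := by
    intro z hz u
    rw [A_eq z hz, h.covDeriv_ξ_ξ hz, h.symm z hz (covDeriv G ξ z u), ← h.η_eq z hz,
      h.η_covDeriv_ξ hz, h.η_ξ z hz, h.φ_ξ hz, map_zero, _root_.zero_apply]
    module
  have trφ : ∀ z ∈ Ω, LinearMap.trace ℝ E (φ z : E →ₗ[ℝ] E) = 0 := by
    intro z hz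
    have : LinearMap.trace ℝ E (φ z : E →ₗ[ℝ] E) = LinearMap.trace ℝ E (-φ z : E →ₗ[ℝ] E) :=
      trace_eq_of_adjoint (h.nondeg z hz) fun u v ↦ by simp [h.φ_skew hz]
    rw [map_neg] at this
    linarith
  -- The trace of α⊗x is α(x). So the ξ-term contributes G(∇_ξ ξ, w) + G(∇_w ξ, ξ) up to a constant,
  -- and the other terms contribute η(w) tr φ and η(φw). All of these vanish.
  have trA : ∀ w, ∀ z ∈ Ω, LinearMap.trace ℝ E ((A z).flip w : E →L[ℝ] E) = 0 := by
    intro w z hz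
    have e : ((A z).flip w : E →L[ℝ] E) = ((((t - 1) / t * (1 / 2)) •
        ((G z).flip w ∘L covDeriv G ξ z + G z (covDeriv G ξ z w))).smulRight (ξ z))
        - (t - 1) • (η z w • φ z + (η z).smulRight (φ z w)) := by
      ext u
      simp only [ContinuousLinearMap.flip_apply, A_eq z hz, _root_.sub_apply, _root_.add_apply,
        _root_.smul_apply, ContinuousLinearMap.smulRight_apply, ContinuousLinearMap.comp_apply,
        smul_eq_mul]
      rw [mul_assoc]
    have t1 : ∀ (α : E →L[ℝ] ℝ) (x : E), LinearMap.trace ℝ E (α.smulRight x : E →L[ℝ] E) = α x :=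
      fun α x ↦ LinearMap.trace_smulRight (α : E →ₗ[ℝ] ℝ) x
    rw [e]
    simp only [ContinuousLinearMap.toLinearMap_sub, ContinuousLinearMap.toLinearMap_smul,
      ContinuousLinearMap.toLinearMap_add, map_sub, map_add, map_smul, t1, trφ z hz, h.η_φ hz,
      _root_.smul_apply, _root_.add_apply, ContinuousLinearMap.comp_apply,
      h.covDeriv_ξ_ξ hz, map_zero,
      h.symm z hz (covDeriv G ξ z w), ← h.η_eq z hz, h.η_covDeriv_ξ hz]
    simp
  -- Derivative in direction z of A(v,ξ) = -(t-1)φv. It replaces ∂A by ∂φ, which is how the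
  -- divergence of φ enters the Ricci tensor.
  have DA_ξ : ∀ z, fderiv ℝ A y z v (ξ y) + A y v (fderiv ℝ ξ y z) =
      - (t - 1) • fderiv ℝ φ y z v := by
    intro z
    have h1 : HasFDerivAt (fun z ↦ A z v (ξ z)) _ y :=
      (hA.hasFDerivAt.clm_apply (hasFDerivAt_const v y)).clm_apply (h.hasFDerivAt_ξ hy)
    have h2 : HasFDerivAt (fun z ↦ - (t - 1) • φ z v) _ y :=
      ((h.hasFDerivAt_φ hy).clm_apply (hasFDerivAt_const v y)).const_smul (- (t - 1))
    have h3 := h1.congr_of_eventuallyEq (f₁ := fun z ↦ - (t - 1) • φ z v)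
      (by filter_upwards [h.mem_nhds hy] with z hz using (A_ξ z hz v).symm)
    have h4 := DFunLike.congr_fun (h3.unique h2) z
    simp only [zero_add, _root_.add_apply, ContinuousLinearMap.comp_zero,
      ContinuousLinearMap.comp_apply, ContinuousLinearMap.flip_apply, _root_.smul_apply] at h4
    rw [← h4]
    abel
  -- With η(v) = 0 and the image of L in ker η, the φ-terms of A(v, L·) disappear. What remains is
  -- α⊗ξ with α factoring through L, of trace α(ξ) = 0.
  have trAL : ∀ L : E →L[ℝ] E, L (ξ y) = 0 → (∀ z, η y (L z) = 0) →
      LinearMap.trace ℝ E (A y v ∘L L : E →L[ℝ] E) = 0 := by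
    intro L hLξ hηL
    have e : A y v ∘L L = (((t - 1) / t * (1 / 2)) • (G y (covDeriv G ξ y v) ∘L L +
        (G y).flip v ∘L covDeriv G ξ y ∘L L)).smulRight (ξ y) := by
      ext u
      simp only [ContinuousLinearMap.comp_apply, A_eq y hy, hηL, hv, zero_smul, add_zero,
        smul_zero, sub_zero, ContinuousLinearMap.smulRight_apply, _root_.add_apply,
        _root_.smul_apply, ContinuousLinearMap.flip_apply, smul_eq_mul]
      rw [mul_assoc]
    rw [e]
    refine (LinearMap.trace_smulRight (_ : E →ₗ[ℝ] ℝ) _).trans ?_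
    simp [hLξ]
  let w := ξ y
  have Γt_eq : ∀ u v, Γt y u v = Γ y u v + A y u v := fun u v ↦ by simp [A]
  have DΓt_eq : ∀ z u v, fderiv ℝ Γt y z u v = fderiv ℝ Γ y z u v + fderiv ℝ A y z u v :=
    fun z u v ↦ by simp [hDA]
  -- Each correction term is traceless: the covariant divergence of φ together with a commutator,
  -- the maps A(·,x), their derivative in direction v, and two instances of `trAL` with L = ∇ξ and L
  -- = A(·,ξ).
  have e : ricciEnd (deformMetric t η G) y v w = ricciEnd G y v w
      + (- (t - 1)) • (covDerivEndFlip G φ y v + φ y ∘L Γ y v - Γ y v ∘L φ y)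
      + (A y).flip (Γ y v w + A y v w) - A y v ∘L covDeriv G ξ y
      - (fderiv ℝ A y v).flip w - A y v ∘L (A y).flip w := by
    ext z
    have d1 := DA_ξ z
    have d2 := A_ξ y hy v
    have d3 := A_ξ y hy z
    have d4 := h.christoffel_symm hy v z
    rw [← eq_sub_iff_add_eq] at d1
    change fderiv ℝ Γt y z v w + Γt y z (Γt y v w) - fderiv ℝ Γt y v z w - Γt y v (Γt y z w) = _
    simp only [_root_.add_apply, _root_.sub_apply, _root_.smul_apply,
      ContinuousLinearMap.comp_apply, ContinuousLinearMap.flip_apply, covDerivEndFlip_apply,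
      covDerivEnd_apply, ricciEnd_apply, covDeriv_apply, Γt_eq, DΓt_eq, map_add, w, d1, d2, d3,
      map_smul, Γ, d4]
    module
  have tr_comm : LinearMap.trace ℝ E (φ y ∘L Γ y v : E →L[ℝ] E) =
      LinearMap.trace ℝ E (Γ y v ∘L φ y : E →L[ℝ] E) :=
    LinearMap.trace_mul_comm ℝ (φ y : E →ₗ[ℝ] E) (Γ y v : E →ₗ[ℝ] E)
  have tA := trAL _ (h.covDeriv_ξ_ξ hy) (h.η_covDeriv_ξ hy)
  have tA' := trAL ((A y).flip w)
    (by rw [ContinuousLinearMap.flip_apply, A_ξ y hy, h.φ_ξ hy, smul_zero])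
    (fun z ↦ by rw [ContinuousLinearMap.flip_apply, A_ξ y hy, map_smul, h.η_φ hy, smul_zero])
  have tD := h.trace_fderiv_eq_zero hy hA w (trA w) v
  change LinearMap.trace ℝ E (ricciEnd (deformMetric t η G) y v w : E →L[ℝ] E) = _
  rw [e]
  simp only [ContinuousLinearMap.toLinearMap_sub, ContinuousLinearMap.toLinearMap_smul,
      ContinuousLinearMap.toLinearMap_add, map_sub, map_add, map_smul, tA, tA', tD,
      trA _ y hy, h.trace_covDerivEndFlip hy hv, tr_comm]
  simp [w]

end LocalParacontact

end LocalDeformation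

/-! ### Coordinate representations of tensor fields -/

section Charts

variable {m : ℕ} {M : Type*} [TopologicalSpace M] [ChartedSpace (EuclideanSpace ℝ (Fin m)) M]
  [IsManifold (𝓡 m) ∞ M]

local notation "𝓔" => EuclideanSpace ℝ (Fin m)
local notation "𝓒" => chartAt (EuclideanSpace ℝ (Fin m))
local notation "𝓣" => trivializationAt (EuclideanSpace ℝ (Fin m)) (TangentSpace (𝓡 m))

variable (m) in
/-- The coordinates of tangent vectors in the chart at `p`. -/
def toModel (p x : M) : TangentSpace (𝓡 m) x →L[ℝ] 𝓔 := (𝓣 p).continuousLinearMapAt ℝ x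

variable (m) in
/-- The tangent vectors with given coordinates in the chart at `p`. -/
def fromModel (p x : M) : 𝓔 →L[ℝ] TangentSpace (𝓡 m) x := (𝓣 p).symmL ℝ x

section

variable {p x : M}

lemma mem_baseSet_of_mem_chart_source (hx : x ∈ (𝓒 p).source) : x ∈ (𝓣 p).baseSet := by simpa using hx

lemma toModel_fromModel (hx : x ∈ (𝓒 p).source) (u : 𝓔) : toModel m p x (fromModel m p x u) = u :=
  Trivialization.continuousLinearMapAt_symmL _ (mem_baseSet_of_mem_chart_source hx) u

lemma fromModel_toModel (hx : x ∈ (𝓒 p).source) (v : TangentSpace (𝓡 m) x) : fromModel m p x (toModel m p x v) = v :=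
  Trivialization.symmL_continuousLinearMapAt _ (mem_baseSet_of_mem_chart_source hx) v

lemma toModel_apply (hx : x ∈ (𝓒 p).source) (v : TangentSpace (𝓡 m) x) :
    toModel m p x v = (𝓣 p ⟨x, v⟩).2 :=
  (𝓣 p).continuousLinearMapAt_apply_of_mem (R := ℝ) (mem_baseSet_of_mem_chart_source hx) v

lemma toModel_eq_mfderiv (hx : x ∈ (𝓒 p).source) : toModel m p x = mfderiv (𝓡 m) 𝓘(ℝ, 𝓔) (𝓒 p) x := by
  have := TangentBundle.continuousLinearMapAt_trivializationAt (I := 𝓡 m) (𝕜 := ℝ) hx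
  rwa [extChartAt_coe, modelWithCornersSelf_coe, Function.id_comp] at this

lemma fromModel_eq_mfderiv (hx : x ∈ (𝓒 p).source) :
    fromModel m p x = mfderiv 𝓘(ℝ, 𝓔) (𝓡 m) (𝓒 p).symm (𝓒 p x) := by
  have := TangentBundle.symmL_trivializationAt (I := 𝓡 m) (𝕜 := ℝ) hx
  rwa [modelWithCornersSelf_coe, Set.range_id, mfderivWithin_univ, extChartAt_coe,
    extChartAt_coe_symm, modelWithCornersSelf_coe, modelWithCornersSelf_coe_symm,
    Function.id_comp, Function.comp_id] at this

end

lemma toModel_self (x : M) (v : TangentSpace (𝓡 m) x) : toModel m x x v = v := by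
  have := mfderiv_extChartAt_self (I := 𝓡 m) (x := x)
  rw [extChartAt_coe, modelWithCornersSelf_coe, Function.id_comp] at this
  rw [toModel_eq_mfderiv (mem_chart_source _ x), this]
  rfl

lemma fromModel_self (x : M) (v : 𝓔) : fromModel m x x v = v := by
  have := toModel_fromModel (mem_chart_source 𝓔 x) v
  rwa [toModel_self] at this

lemma ext_apply {x : M} (v : TangentSpace (𝓡 m) x) {y : M} (hy : y ∈ (𝓒 x).source) :
    ext v y = fromModel m x y v := by
  have : (𝓣 x ⟨x, v⟩).2 = v := by
    rw [← toModel_apply (mem_chart_source 𝓔 x), toModel_self]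
  unfold ext FiberBundle.extend
  rw [this]
  exact ((𝓣 x).symmL_apply (mem_baseSet_of_mem_chart_source hy) _).symm

/-- The coordinate representation of a vector field in the chart at `p`. -/
def fieldRep (p : M) (V : VField m M) (y : 𝓔) : 𝓔 :=
  toModel m p ((𝓒 p).symm y) (V ((𝓒 p).symm y))

/-- The coordinate representation of a one-form in the chart at `p`. -/
def formRep (p : M) (η : OneForm m M) (y : 𝓔) : 𝓔 →L[ℝ] ℝ :=
  η ((𝓒 p).symm y) ∘L fromModel m p ((𝓒 p).symm y)

/-- The coordinate representation of a tensor field of type `(1,1)` in the chart at `p`. -/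
def endRep (p : M) (φ : EndField m M) (y : 𝓔) : 𝓔 →L[ℝ] 𝓔 :=
  toModel m p ((𝓒 p).symm y) ∘L φ ((𝓒 p).symm y) ∘L fromModel m p ((𝓒 p).symm y)

/-- The coordinate representation of a bilinear tensor field in the chart at `p`. -/
def metricRep (p : M) (g : BilinField m M) (y : 𝓔) : 𝓔 →L[ℝ] 𝓔 →L[ℝ] ℝ :=
  ContinuousLinearMap.bilinearComp
    (show 𝓔 →L[ℝ] 𝓔 →L[ℝ] ℝ from g ((𝓒 p).symm y))
    (show 𝓔 →L[ℝ] 𝓔 from fromModel m p ((𝓒 p).symm y))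
    (show 𝓔 →L[ℝ] 𝓔 from fromModel m p ((𝓒 p).symm y))

lemma metricRep_apply (p : M) (g : BilinField m M) (y u v : 𝓔) :
    metricRep p g y u v = g ((𝓒 p).symm y) (fromModel m p ((𝓒 p).symm y) u)
      (fromModel m p ((𝓒 p).symm y) v) := rfl

lemma formRep_apply (p : M) (η : OneForm m M) (y u : 𝓔) :
    formRep p η y u = η ((𝓒 p).symm y) (fromModel m p ((𝓒 p).symm y) u) := rfl

lemma endRep_apply (p : M) (φ : EndField m M) (y u : 𝓔) :
    endRep p φ y u = toModel m p ((𝓒 p).symm y)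
      (φ ((𝓒 p).symm y) (fromModel m p ((𝓒 p).symm y) u)) := rfl

section

variable {p : M} {y : 𝓔}

lemma contDiffOn_comp_chart_symm {F : Type*} [NormedAddCommGroup F] [NormedSpace ℝ F] {f : M → F}
    (hf : ContMDiffOn (𝓡 m) 𝓘(ℝ, F) ∞ f (𝓒 p).source) :
    ContDiffOn ℝ ∞ (fun y ↦ f ((𝓒 p).symm y)) (𝓒 p).target := by
  rw [← contMDiffOn_iff_contDiffOn]
  exact hf.comp (contMDiffOn_chart_symm (n := ∞)) (fun y hy ↦ (𝓒 p).map_target hy)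

lemma contMDiffOn_toModel {V : VField m M} (hV : IsSmoothField V) :
    ContMDiffOn (𝓡 m) 𝓘(ℝ, 𝓔) ∞ (fun x ↦ toModel m p x (V x)) (𝓒 p).source := by
  intro x hx
  have := (((𝓣 p).contMDiffAt_section_iff (mem_baseSet_of_mem_chart_source hx)).1
    (hV x)).contMDiffWithinAt (s := (𝓒 p).source)
  exact this.congr (fun z hz ↦ toModel_apply hz _) (toModel_apply hx _)

lemma contDiffOn_fieldRep {V : VField m M} (hV : IsSmoothField V) :
    ContDiffOn ℝ ∞ (fieldRep p V) (𝓒 p).target :=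
  contDiffOn_comp_chart_symm (contMDiffOn_toModel hV)

lemma contMDiffOn_fromModel (p : M) (u : 𝓔) : ContMDiffOn (𝓡 m) (𝓡 m).tangent ∞
    (fun x ↦ (⟨x, fromModel m p x u⟩ : TangentBundle (𝓡 m) M)) (𝓒 p).source := by
  intro x hx
  have hb := mem_baseSet_of_mem_chart_source hx
  refine (((𝓣 p).contMDiffWithinAt_section _ hb).2 ?_)
  have key : ∀ z ∈ (𝓒 p).source, (𝓣 p ⟨z, fromModel m p z u⟩).2 = u := fun z hz ↦ by
    rw [← toModel_apply hz, toModel_fromModel hz]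
  exact (contMDiffWithinAt_const (c := u)).congr key (key x hx)

lemma isSmoothField_of_contMDiffOn {V : VField m M}
    (hV : ∀ p : M, ContMDiffOn (𝓡 m) 𝓘(ℝ, 𝓔) ∞ (fun x ↦ toModel m p x (V x)) (𝓒 p).source) :
    IsSmoothField V := by
  intro x
  have hx := mem_chart_source 𝓔 x
  refine ((𝓣 x).contMDiffAt_section_iff (mem_baseSet_of_mem_chart_source hx)).2 ?_
  refine ((hV x).contMDiffAt ((𝓒 x).open_source.mem_nhds hx)).congr_of_eventuallyEq ?_
  filter_upwards [(𝓒 x).open_source.mem_nhds hx] with z hz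
  exact (toModel_apply hz _).symm

lemma contDiffOn_metricRep {g : BilinField m M} (hg : IsSemiRiemannianMetric g) :
    ContDiffOn ℝ ∞ (metricRep p g) (𝓒 p).target := by
  rw [contDiffOn_clm_apply]; intro u
  rw [contDiffOn_clm_apply]; intro v
  refine contDiffOn_comp_chart_symm (f := fun x ↦ g x (fromModel m p x u) (fromModel m p x v)) ?_
  have := ContMDiffOn.clm_bundle_apply₂ (F₃ := ℝ) (E₃ := fun _ : M ↦ ℝ)
    hg.smooth.contMDiffOn (contMDiffOn_fromModel p u) (contMDiffOn_fromModel p v)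
  intro x hx
  exact (contMDiffWithinAt_totalSpace.1 (this x hx)).2

end

end Charts

/-! ### Directional derivatives and Lie brackets in charts -/

section Charts

variable {m : ℕ} {M : Type*} [TopologicalSpace M] [ChartedSpace (EuclideanSpace ℝ (Fin m)) M]
  [IsManifold (𝓡 m) ∞ M]

local notation "𝓔" => EuclideanSpace ℝ (Fin m)
local notation "𝓒" => chartAt (EuclideanSpace ℝ (Fin m))
local notation "𝓣" => trivializationAt (EuclideanSpace ℝ (Fin m)) (TangentSpace (𝓡 m))

section

variable {p x : M}

lemma mdifferentiableAt_iff_comp_chart_symm {F : Type*} [NormedAddCommGroup F] [NormedSpace ℝ F]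
    {f : M → F} (hx : x ∈ (𝓒 p).source) : MDifferentiableAt (𝓡 m) 𝓘(ℝ, F) f x ↔
      DifferentiableAt ℝ (fun y ↦ f ((𝓒 p).symm y)) (𝓒 p x) := by
  have h1 : MDifferentiableAt (𝓡 m) 𝓘(ℝ, 𝓔) (𝓒 p) x :=
    mdifferentiableAt_atlas (chart_mem_atlas _ _) hx
  have h2 : MDifferentiableAt 𝓘(ℝ, 𝓔) (𝓡 m) (𝓒 p).symm (𝓒 p x) :=
    mdifferentiableAt_atlas_symm (chart_mem_atlas _ _) ((𝓒 p).map_source hx)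
  rw [← mdifferentiableAt_iff_differentiableAt]
  constructor
  · intro h
    exact MDifferentiableAt.comp_of_eq _ h h2 ((𝓒 p).left_inv hx)
  · intro h
    refine (h.comp x h1).congr_of_eventuallyEq ?_
    filter_upwards [(𝓒 p).open_source.mem_nhds hx] with z hz
    simp [(𝓒 p).left_inv hz]

lemma mdifferentiableAt_field_iff {V : VField m M} (hx : x ∈ (𝓒 p).source) :
    MDifferentiableAt (𝓡 m) (𝓡 m).tangent (fun x ↦ (⟨x, V x⟩ : TangentBundle (𝓡 m) M)) x ↔
      DifferentiableAt ℝ (fieldRep p V) (𝓒 p x) := by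
  have h1 := (𝓣 p).mdifferentiableAt_section_iff (𝓡 m) V (mem_baseSet_of_mem_chart_source hx)
  refine h1.trans (Iff.trans ?_ (mdifferentiableAt_iff_comp_chart_symm hx
    (f := fun z ↦ toModel m p z (V z))))
  have : (fun z ↦ toModel m p z (V z)) =ᶠ[𝓝 x] fun z ↦ (𝓣 p ⟨z, V z⟩).2 := by
    filter_upwards [(𝓒 p).open_source.mem_nhds hx] with z hz using toModel_apply hz _
  exact this.symm.mdifferentiableAt_iff

lemma dirDeriv_eq {f : M → ℝ} (hx : x ∈ (𝓒 p).source)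
    (hf : DifferentiableAt ℝ (fun y ↦ f ((𝓒 p).symm y)) (𝓒 p x)) (v : TangentSpace (𝓡 m) x) :
    dirDeriv f x v = fderiv ℝ (fun y ↦ f ((𝓒 p).symm y)) (𝓒 p x) (toModel m p x v) := by
  have h2 : MDifferentiableAt 𝓘(ℝ, 𝓔) (𝓡 m) (𝓒 p).symm (𝓒 p x) :=
    mdifferentiableAt_atlas_symm (chart_mem_atlas _ _) ((𝓒 p).map_source hx)
  have hf' := (mdifferentiableAt_iff_comp_chart_symm hx).2 hf
  have h3 := mfderiv_comp_apply_of_eq _ hf' h2 ((𝓒 p).left_inv hx) (toModel m p x v)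
  rw [mfderiv_eq_fderiv] at h3
  have h4 := congrArg (mfderiv (𝓡 m) 𝓘(ℝ, ℝ) f x) (fromModel_toModel hx v)
  rw [fromModel_eq_mfderiv hx] at h4
  exact h4.symm.trans h3.symm

lemma fieldRep_chart (V : VField m M) (hx : x ∈ (𝓒 p).source) :
    fieldRep p V (𝓒 p x) = toModel m p x (V x) := by
  unfold fieldRep
  rw [(𝓒 p).left_inv hx]

lemma mlieBracket_eq_lieBracket {F : Type*} [NormedAddCommGroup F] [NormedSpace ℝ F]
    (X Y : F → F) : VectorField.mlieBracket 𝓘(ℝ, F) X Y = VectorField.lieBracket ℝ X Y := by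
  have h1 := VectorField.mlieBracketWithin_univ (𝕜 := ℝ) (I := 𝓘(ℝ, F)) (V := X) (W := Y)
  have h2 := VectorField.mlieBracketWithin_eq_lieBracketWithin (𝕜 := ℝ) (V := X) (W := Y) (s := Set.univ)
  exact h1.symm.trans (h2.trans VectorField.lieBracketWithin_univ)

/-- Brackets are natural under pullback by the inverse chart, and that pullback of a field is its
coordinate representation. -/
lemma toModel_mlieBracket {X Y : VField m M} (hx : x ∈ (𝓒 p).source)
    (hX : DifferentiableAt ℝ (fieldRep p X) (𝓒 p x))
    (hY : DifferentiableAt ℝ (fieldRep p Y) (𝓒 p x)) :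
    toModel m p x (VectorField.mlieBracket (𝓡 m) X Y x) =
      fderiv ℝ (fieldRep p Y) (𝓒 p x) (fieldRep p X (𝓒 p x))
        - fderiv ℝ (fieldRep p X) (𝓒 p x) (fieldRep p Y (𝓒 p x)) := by
  have : IsManifold (𝓡 m) (minSmoothness ℝ 2) M :=
    .of_le (n := ∞) (by simpa using ENat.LEInfty.out)
  have hy := (𝓒 p).map_source hx
  have e : ∀ V : VField m M, ∀ y ∈ (𝓒 p).target,
      VectorField.mpullback 𝓘(ℝ, 𝓔) (𝓡 m) (𝓒 p).symm V y = fieldRep p V y := by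
    intro V y hy
    have hz := (𝓒 p).map_target hy
    have h1 := fromModel_eq_mfderiv hz
    rw [(𝓒 p).right_inv hy] at h1
    rw [VectorField.mpullback_apply, ← h1]
    have : (fromModel m p ((𝓒 p).symm y)).inverse = toModel m p ((𝓒 p).symm y) :=
      ContinuousLinearMap.inverse_eq (by ext u; simp [fromModel_toModel hz])
        (by ext u; simp [toModel_fromModel hz])
    exact congrArg (fun L ↦ L (V ((𝓒 p).symm y))) this
  have e' : ∀ V : VField m M, VectorField.mpullback 𝓘(ℝ, 𝓔) (𝓡 m) (𝓒 p).symm V =ᶠ[𝓝 (𝓒 p x)]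
      fieldRep p V := fun V ↦ by
    filter_upwards [(𝓒 p).open_target.mem_nhds hy] with z hz using e V z hz
  have hX' := (mdifferentiableAt_field_iff hx).2 hX
  have hY' := (mdifferentiableAt_field_iff hx).2 hY
  have hs : ContMDiffAt 𝓘(ℝ, 𝓔) (𝓡 m) ∞ (𝓒 p).symm (𝓒 p x) :=
    (contMDiffOn_chart_symm (n := ∞)).contMDiffAt ((𝓒 p).open_target.mem_nhds hy)
  rw [← (𝓒 p).left_inv hx] at hX' hY'
  have key := VectorField.mpullback_mlieBracket hX' hY' hs (by simpa using ENat.LEInfty.out)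
  rw [e _ _ hy, fieldRep_chart _ hx] at key
  refine key.trans ?_
  have h5 := Filter.EventuallyEq.mlieBracket_vectorField_eq (I := 𝓘(ℝ, 𝓔)) (e' X) (e' Y)
  exact h5.trans (congrFun (mlieBracket_eq_lieBracket _ _) _)

end

end Charts

/-! ### Connection, traces and curvature in charts -/

section Charts

variable {m : ℕ} {M : Type*} [TopologicalSpace M] [ChartedSpace (EuclideanSpace ℝ (Fin m)) M]
  [IsManifold (𝓡 m) ∞ M]

local notation "𝓔" => EuclideanSpace ℝ (Fin m)
local notation "𝓒" => chartAt (EuclideanSpace ℝ (Fin m))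
local notation "𝓣" => trivializationAt (EuclideanSpace ℝ (Fin m)) (TangentSpace (𝓡 m))

section

variable {g : BilinField m M}

omit [IsManifold (𝓡 m) ∞ M] in
lemma stdVec_eq_basisFun (x : M) (i : Fin m) :
    stdVec x i = (EuclideanSpace.basisFun (Fin m) ℝ).toBasis i := by
  rw [OrthonormalBasis.coe_toBasis, EuclideanSpace.basisFun_apply]
  rfl

omit [IsManifold (𝓡 m) ∞ M] in
lemma sum_coord_smul_stdVec (x : M) (v : TangentSpace (𝓡 m) x) :
    ∑ i, coord x v i • stdVec x i = v := by
  have := (EuclideanSpace.basisFun (Fin m) ℝ).toBasis.sum_repr (show 𝓔 from v)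
  simp only [← stdVec_eq_basisFun x] at this
  exact this

omit [IsManifold (𝓡 m) ∞ M] in
lemma trace_eq_sum_coord (x : M) (L : TangentSpace (𝓡 m) x →ₗ[ℝ] TangentSpace (𝓡 m) x) :
    LinearMap.trace ℝ (TangentSpace (𝓡 m) x) L = ∑ i, coord x (L (stdVec x i)) i := by
  have := LinearMap.trace_eq_matrix_trace ℝ (EuclideanSpace.basisFun (Fin m) ℝ).toBasis
    (show 𝓔 →ₗ[ℝ] 𝓔 from L)
  refine this.trans (Finset.sum_congr rfl fun i _ ↦ ?_)
  rw [Matrix.diag_apply, LinearMap.toMatrix_apply, ← stdVec_eq_basisFun x]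
  rfl

lemma isUnit_det_gram (hg : IsSemiRiemannianMetric g) (x : M) : IsUnit (gram g x).det := by
  rw [isUnit_iff_ne_zero]
  intro h0
  obtain ⟨v, hv, h⟩ := Matrix.exists_mulVec_eq_zero_iff.2 h0
  set w : TangentSpace (𝓡 m) x := WithLp.toLp 2 v with hw
  have hc : ∀ i, coord x w i = v i := fun i ↦ rfl
  refine hv ?_
  have : w = 0 := by
    refine hg.nondegenerate x w fun u ↦ ?_
    have h2 : ∀ i, g x (stdVec x i) w = 0 := fun i ↦ by
      have := congrFun h i
      rw [← sum_coord_smul_stdVec x w, map_sum]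
      simpa [Matrix.mulVec, dotProduct, gram, hc, mul_comm] using this
    rw [hg.symm, ← sum_coord_smul_stdVec x u]
    simp [h2]
  ext i
  rw [← hc, this]
  rfl

lemma sum_inv_gram_mul (hg : IsSemiRiemannianMetric g) (x : M) (w : TangentSpace (𝓡 m) x)
    (i : Fin m) : ∑ j, (gram g x)⁻¹ i j * g x w (stdVec x j) = coord x w i := by
  have h1 : (fun j ↦ g x w (stdVec x j)) = gram g x *ᵥ coord x w := by
    ext j
    conv_lhs => rw [hg.symm, ← sum_coord_smul_stdVec x w, map_sum]
    simp [Matrix.mulVec, dotProduct, gram, mul_comm]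
  have h2 : (gram g x)⁻¹ *ᵥ (gram g x *ᵥ coord x w) = coord x w := by
    rw [Matrix.mulVec_mulVec, Matrix.nonsing_inv_mul _ (isUnit_det_gram hg x), Matrix.one_mulVec]
  rw [← h1] at h2
  exact congrFun h2 i

lemma sharp_eq (hg : IsSemiRiemannianMetric g) {x : M} {α : TangentSpace (𝓡 m) x → ℝ}
    {w : TangentSpace (𝓡 m) x} (h : ∀ z, α z = g x w z) : sharp g x α = w := by
  unfold sharp
  simp only [h, sum_inv_gram_mul hg]
  exact sum_coord_smul_stdVec x w

lemma metricTrace_eq_trace (hg : IsSemiRiemannianMetric g) {x : M}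
    {B : TangentSpace (𝓡 m) x → TangentSpace (𝓡 m) x → ℝ}
    {L : TangentSpace (𝓡 m) x →ₗ[ℝ] TangentSpace (𝓡 m) x} (h : ∀ u v, g x (L u) v = B u v) :
    metricTrace g x B = LinearMap.trace ℝ (TangentSpace (𝓡 m) x) L := by
  unfold metricTrace
  simp only [← h, sum_inv_gram_mul hg, trace_eq_sum_coord]

lemma localMetric_metricRep (hg : IsSemiRiemannianMetric g) (p : M) :
    LocalMetric (𝓒 p).target (metricRep p g) where
  isOpen := (𝓒 p).open_target
  smooth := contDiffOn_metricRep hg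
  symm y _ u v := hg.symm _ _ _
  nondeg y hy v h := by
    have hz := (𝓒 p).map_target hy
    have h1 : fromModel m p ((𝓒 p).symm y) v = 0 := hg.nondegenerate _ _ fun w ↦ by
      have := h (toModel m p _ w)
      rwa [metricRep_apply, fromModel_toModel hz] at this
    rw [← toModel_fromModel hz v, h1, map_zero]

variable {p x : M}

lemma metricRep_toModel (hx : x ∈ (𝓒 p).source) (v w : TangentSpace (𝓡 m) x) :
    metricRep p g (𝓒 p x) (toModel m p x v) (toModel m p x w) = g x v w := by
  rw [metricRep_apply, (𝓒 p).left_inv hx, fromModel_toModel hx, fromModel_toModel hx]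

lemma metricRep_fieldRep {y : 𝓔} (hy : y ∈ (𝓒 p).target) (V W : VField m M) :
    metricRep p g y (fieldRep p V y) (fieldRep p W y) =
      g ((𝓒 p).symm y) (V ((𝓒 p).symm y)) (W ((𝓒 p).symm y)) := by
  have hz := (𝓒 p).map_target hy
  rw [metricRep_apply]
  unfold fieldRep
  rw [fromModel_toModel hz, fromModel_toModel hz]

lemma dirDeriv_metric (hg : IsSemiRiemannianMetric g) (hx : x ∈ (𝓒 p).source) {Y Z : VField m M}
    (hY : DifferentiableAt ℝ (fieldRep p Y) (𝓒 p x))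
    (hZ : DifferentiableAt ℝ (fieldRep p Z) (𝓒 p x)) (v : TangentSpace (𝓡 m) x) :
    dirDeriv (fun y ↦ g y (Y y) (Z y)) x v =
      fderiv ℝ (metricRep p g) (𝓒 p x) (toModel m p x v) (fieldRep p Y (𝓒 p x))
        (fieldRep p Z (𝓒 p x))
      + metricRep p g (𝓒 p x) (fderiv ℝ (fieldRep p Y) (𝓒 p x) (toModel m p x v))
        (fieldRep p Z (𝓒 p x))
      + metricRep p g (𝓒 p x) (fieldRep p Y (𝓒 p x))
        (fderiv ℝ (fieldRep p Z) (𝓒 p x) (toModel m p x v)) := by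
  have hy := (𝓒 p).map_source hx
  have h1 := (((localMetric_metricRep hg p).differentiableAt hy).hasFDerivAt.clm_apply
    hY.hasFDerivAt).clm_apply hZ.hasFDerivAt
  have h2 := h1.congr_of_eventuallyEq
    (f₁ := fun y ↦ g ((𝓒 p).symm y) (Y ((𝓒 p).symm y)) (Z ((𝓒 p).symm y))) (by
      filter_upwards [(𝓒 p).open_target.mem_nhds hy] with z hz
        using (metricRep_fieldRep hz Y Z).symm)
  rw [dirDeriv_eq hx h2.differentiableAt, h2.fderiv]
  simp
  ring

/-- The derivatives of X and Z cancel between the metric and bracket terms, so only the derivative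
of Y survives. Hence the value does not depend on how tangent vectors are extended in `nabla`. -/
lemma koszul_eq (hg : IsSemiRiemannianMetric g) (hx : x ∈ (𝓒 p).source) {X Y Z : VField m M}
    (hX : DifferentiableAt ℝ (fieldRep p X) (𝓒 p x))
    (hY : DifferentiableAt ℝ (fieldRep p Y) (𝓒 p x))
    (hZ : DifferentiableAt ℝ (fieldRep p Z) (𝓒 p x)) :
    koszul g X Y Z x = 2 * metricRep p g (𝓒 p x)
      (covDeriv (metricRep p g) (fieldRep p Y) (𝓒 p x) (fieldRep p X (𝓒 p x)))
      (fieldRep p Z (𝓒 p x)) := by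
  have hy := (𝓒 p).map_source hx
  have hG := localMetric_metricRep hg p
  unfold koszul
  rw [dirDeriv_metric hg hx hY hZ, dirDeriv_metric hg hx hZ hX, dirDeriv_metric hg hx hX hY]
  simp only [← metricRep_toModel (g := g) hx, toModel_mlieBracket hx hX hY,
    toModel_mlieBracket hx hY hZ, toModel_mlieBracket hx hZ hX, ← fieldRep_chart _ hx]
  rw [covDeriv_apply, map_add, _root_.add_apply, hG.apply_christoffel hy]
  simp only [map_sub, _root_.sub_apply]
  rw [hG.fderiv_symm hy (fieldRep p Y _) (fieldRep p Z _)]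
  simp only [hG.symm _ hy (fieldRep p X _), hG.symm _ hy (fieldRep p Y _),
    hG.symm _ hy (fieldRep p Z _)]
  ring

lemma fieldRep_ext (v : TangentSpace (𝓡 m) x) {y : 𝓔} (hy : y ∈ (𝓒 x).target) :
    fieldRep x (ext v) y = v := by
  have hz := (𝓒 x).map_target hy
  unfold fieldRep
  rw [ext_apply v hz]
  exact toModel_fromModel hz v

lemma differentiableAt_fieldRep_ext (hx : x ∈ (𝓒 p).source) (v : TangentSpace (𝓡 m) x) :
    DifferentiableAt ℝ (fieldRep p (ext v)) (𝓒 p x) := by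
  rw [← mdifferentiableAt_field_iff hx, mdifferentiableAt_field_iff (mem_chart_source 𝓔 x)]
  refine (differentiableAt_const (c := (show 𝓔 from v))).congr_of_eventuallyEq ?_
  filter_upwards [(𝓒 x).open_target.mem_nhds (mem_chart_target 𝓔 x)] with z hz
    using fieldRep_ext v hz

lemma toModel_ext (v : TangentSpace (𝓡 m) x) : ext v x = v := by
  rw [ext_apply v (mem_chart_source 𝓔 x)]
  exact fromModel_self x v

lemma toModel_nabla (hg : IsSemiRiemannianMetric g) (hx : x ∈ (𝓒 p).source) {Y : VField m M}
    (hY : DifferentiableAt ℝ (fieldRep p Y) (𝓒 p x)) (v : TangentSpace (𝓡 m) x) :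
    toModel m p x (nabla g Y x v) =
      covDeriv (metricRep p g) (fieldRep p Y) (𝓒 p x) (toModel m p x v) := by
  set u := covDeriv (metricRep p g) (fieldRep p Y) (𝓒 p x) (toModel m p x v) with hu
  rw [← toModel_fromModel hx u]
  congr 1
  refine sharp_eq hg fun z ↦ ?_
  rw [koszul_eq hg hx (differentiableAt_fieldRep_ext hx v) hY (differentiableAt_fieldRep_ext hx z),
    fieldRep_chart _ hx, fieldRep_chart _ hx, toModel_ext, toModel_ext, ← hu,
    ← metricRep_toModel (g := g) hx, toModel_fromModel hx]
  ring

lemma metricTrace_eq_formTrace (hg : IsSemiRiemannianMetric g) (hx : x ∈ (𝓒 p).source)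
    {B : TangentSpace (𝓡 m) x → TangentSpace (𝓡 m) x → ℝ} {B' : 𝓔 →L[ℝ] 𝓔 →L[ℝ] ℝ}
    (h : ∀ u v, B u v = B' (toModel m p x u) (toModel m p x v)) :
    metricTrace g x B = formTrace (metricRep p g (𝓒 p x)) B' := by
  have hy := (𝓒 p).map_source hx
  have hG := (localMetric_metricRep hg p).nondeg _ hy
  set e : TangentSpace (𝓡 m) x ≃ₗ[ℝ] 𝓔 := LinearEquiv.ofLinearMap
    (toModel m p x : TangentSpace (𝓡 m) x →ₗ[ℝ] 𝓔) (fromModel m p x : 𝓔 →ₗ[ℝ] TangentSpace (𝓡 m) x)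
    (LinearMap.ext fun u ↦ toModel_fromModel hx u)
    (LinearMap.ext fun u ↦ fromModel_toModel hx u) with he
  let L' : 𝓔 →ₗ[ℝ] 𝓔 :=
    ContinuousLinearMap.toLinearMap ((metricRep p g (𝓒 p x)).inverse ∘L B')
  have h1 : metricTrace g x B = LinearMap.trace ℝ (TangentSpace (𝓡 m) x) (e.symm.conj L') := by
    refine metricTrace_eq_trace hg fun u v ↦ ?_
    rw [← metricRep_toModel (g := g) hx, h]
    have : toModel m p x (e.symm.conj L' u) = L' (toModel m p x u) :=
      toModel_fromModel hx _
    rw [this]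
    exact DFunLike.congr_fun (apply_inverse_of_nondegenerate hG _) _
  rw [h1, LinearMap.trace_conj']
  rfl

/-- The extensions have constant coordinates in the chart at `x`: their bracket vanishes there and
∇_v w is just Γ(v,w). Differentiating this once more gives the curvature. In `ricciEnd` the traced
vector is the last argument. -/
lemma curv_eq (hg : IsSemiRiemannianMetric g) (u v w : 𝓔) :
    curv g x u v w = ricciEnd (metricRep x g) (𝓒 x x) u w v := by
  have hx := mem_chart_source 𝓔 x
  have hy := mem_chart_target 𝓔 x
  have hG := localMetric_metricRep hg x
  have hΓ : DifferentiableAt ℝ (christoffel (metricRep x g)) (𝓒 x x) :=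
    (hG.contDiffOn_christoffel.contDiffAt (hG.isOpen.mem_nhds hy)).differentiableAt (by simp)
  have hself : ∀ v : 𝓔, toModel m x x (ext (x := x) v x) = v := fun v ↦
    (toModel_self x _).trans (toModel_ext (x := x) v)
  have hb : toModel m x x (VectorField.mlieBracket (𝓡 m) (ext (x := x) u) (ext (x := x) v) x) = 0 := by
    have hc : ∀ v : 𝓔, fderiv ℝ (fieldRep x (ext (x := x) v)) (𝓒 x x) = 0 := fun v ↦ by
      have : fieldRep x (ext (x := x) v) =ᶠ[𝓝 (𝓒 x x)] fun _ ↦ v := by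
        filter_upwards [hG.isOpen.mem_nhds hy] with z hz using fieldRep_ext v hz
      rw [this.fderiv_eq]
      exact fderiv_const_apply _
    rw [toModel_mlieBracket hx (differentiableAt_fieldRep_ext hx u)
      (differentiableAt_fieldRep_ext hx v), hc, hc]
    simp
  have h2 : ∀ u v : 𝓔,
      toModel m x x (nabla g (fun y ↦ nabla g (ext (x := x) w) y (ext (x := x) v y)) x (ext (x := x) u x)) =
      fderiv ℝ (christoffel (metricRep x g)) (𝓒 x x) u v w +
      christoffel (metricRep x g) (𝓒 x x) u (christoffel (metricRep x g) (𝓒 x x) v w) := by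
    intro u v
    have h3 : fieldRep x (fun y ↦ nabla g (ext (x := x) w) y (ext (x := x) v y)) =ᶠ[𝓝 (𝓒 x x)]
        fun y ↦ christoffel (metricRep x g) y v w := by
      filter_upwards [hG.isOpen.mem_nhds hy] with z hz
      have hz' := (𝓒 x).map_target hz
      have h4 : fieldRep x (ext (x := x) w) =ᶠ[𝓝 z] fun _ ↦ w := by
        filter_upwards [hG.isOpen.mem_nhds hz] with z hz using fieldRep_ext w hz
      have h5 : DifferentiableAt ℝ (fieldRep x (ext (x := x) w)) (𝓒 x ((𝓒 x).symm z)) := by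
        rw [(𝓒 x).right_inv hz]
        exact (differentiableAt_const (c := w)).congr_of_eventuallyEq h4
      have h6 := toModel_nabla hg hz' h5 (ext (x := x) v ((𝓒 x).symm z))
      refine h6.trans ?_
      have h7 : toModel m x ((𝓒 x).symm z) (ext (x := x) v ((𝓒 x).symm z)) = v := fieldRep_ext v hz
      rw [h7, (𝓒 x).right_inv hz, covDeriv_apply, h4.fderiv_eq, fieldRep_ext w hz]
      simp
    have h8 := (hΓ.hasFDerivAt.clm_apply (hasFDerivAt_const v _)).clm_apply
      (hasFDerivAt_const w _)
    have h9 := h8.congr_of_eventuallyEq h3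
    rw [toModel_nabla hg hx h9.differentiableAt, covDeriv_apply, h9.fderiv, h3.eq_of_nhds,
      hself]
    simp
  rw [← toModel_self x (curv g x u v w)]
  unfold curv curvField
  rw [map_add, map_sub, h2, h2, toModel_nabla hg hx (differentiableAt_fieldRep_ext hx w), hb,
    map_zero, ricciEnd_apply]
  abel

end

end Charts

/-! ### Smooth tensor fields and the exterior derivative in charts -/

section Charts

variable {m : ℕ} {M : Type*} [TopologicalSpace M] [ChartedSpace (EuclideanSpace ℝ (Fin m)) M]
  [IsManifold (𝓡 m) ∞ M]

local notation "𝓔" => EuclideanSpace ℝ (Fin m)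
local notation "𝓒" => chartAt (EuclideanSpace ℝ (Fin m))
local notation "𝓣" => trivializationAt (EuclideanSpace ℝ (Fin m)) (TangentSpace (𝓡 m))

section

variable {p x : M}

lemma contMDiffOn_of_comp_chart_symm {F : Type*} [NormedAddCommGroup F] [NormedSpace ℝ F] {f : M → F}
    (hf : ContDiffOn ℝ ∞ (fun y ↦ f ((𝓒 p).symm y)) (𝓒 p).target) :
    ContMDiffOn (𝓡 m) 𝓘(ℝ, F) ∞ f (𝓒 p).source := by
  refine ((contMDiffOn_iff_contDiffOn.2 hf).comp (contMDiffOn_chart (n := ∞))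
    (fun y hy ↦ (𝓒 p).map_source hy)).congr fun z hz ↦ ?_
  simp [(𝓒 p).left_inv hz]

/-- A smooth one-form. -/
def IsSmoothForm (η : OneForm m M) : Prop :=
  ContMDiff (𝓡 m) ((𝓡 m).prod 𝓘(ℝ, 𝓔 →L[ℝ] ℝ)) ∞
    (fun x ↦ TotalSpace.mk' (𝓔 →L[ℝ] ℝ) (E := fun x : M ↦ TangentSpace (𝓡 m) x →L[ℝ] ℝ) x (η x))

/-- A smooth tensor field of type `(1,1)`. -/
def IsSmoothEnd (φ : EndField m M) : Prop :=
  ContMDiff (𝓡 m) ((𝓡 m).prod 𝓘(ℝ, 𝓔 →L[ℝ] 𝓔)) ∞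
    (fun x ↦ TotalSpace.mk' (𝓔 →L[ℝ] 𝓔)
      (E := fun x : M ↦ TangentSpace (𝓡 m) x →L[ℝ] TangentSpace (𝓡 m) x) x (φ x))

lemma IsSmoothForm.contMDiffOn_apply {η : OneForm m M} (hη : IsSmoothForm η) {s : Set M}
    {V : VField m M} (hV : ContMDiffOn (𝓡 m) (𝓡 m).tangent ∞
      (fun x ↦ (⟨x, V x⟩ : TangentBundle (𝓡 m) M)) s) :
    ContMDiffOn (𝓡 m) 𝓘(ℝ, ℝ) ∞ (fun x ↦ η x (V x)) s := by
  have := ContMDiffOn.clm_bundle_apply (F₁ := 𝓔) (F₂ := ℝ) (E₂ := fun _ : M ↦ ℝ)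
    hη.contMDiffOn hV
  intro x hx
  exact (contMDiffWithinAt_totalSpace.1 (this x hx)).2

lemma contDiffOn_formRep {η : OneForm m M} (hη : IsSmoothForm η) :
    ContDiffOn ℝ ∞ (formRep p η) (𝓒 p).target := by
  rw [contDiffOn_clm_apply]; intro u
  exact contDiffOn_comp_chart_symm (f := fun x ↦ η x (fromModel m p x u))
    (hη.contMDiffOn_apply (contMDiffOn_fromModel p u))

lemma IsSmoothEnd.contMDiffOn_apply {φ : EndField m M} (hφ : IsSmoothEnd φ) {s : Set M}
    {V : VField m M} (hV : ContMDiffOn (𝓡 m) (𝓡 m).tangent ∞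
      (fun x ↦ (⟨x, V x⟩ : TangentBundle (𝓡 m) M)) s) :
    ContMDiffOn (𝓡 m) (𝓡 m).tangent ∞
      (fun x ↦ (⟨x, φ x (V x)⟩ : TangentBundle (𝓡 m) M)) s :=
  ContMDiffOn.clm_bundle_apply (F₁ := 𝓔) (F₂ := 𝓔)
    (E₂ := fun x : M ↦ TangentSpace (𝓡 m) x) hφ.contMDiffOn hV

lemma contMDiffOn_toModel_of_contMDiffOn {V : VField m M} (hV : ContMDiffOn (𝓡 m) (𝓡 m).tangent ∞
      (fun x ↦ (⟨x, V x⟩ : TangentBundle (𝓡 m) M)) (𝓒 p).source) :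
    ContMDiffOn (𝓡 m) 𝓘(ℝ, 𝓔) ∞ (fun x ↦ toModel m p x (V x)) (𝓒 p).source := by
  intro x hx
  have := (((𝓣 p).contMDiffAt_section_iff (mem_baseSet_of_mem_chart_source hx)).1
    ((hV x hx).contMDiffAt ((𝓒 p).open_source.mem_nhds hx))).contMDiffWithinAt (s := (𝓒 p).source)
  exact this.congr (fun z hz ↦ toModel_apply hz _) (toModel_apply hx _)

lemma contDiffOn_endRep {φ : EndField m M} (hφ : IsSmoothEnd φ) :
    ContDiffOn ℝ ∞ (endRep p φ) (𝓒 p).target := by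
  rw [contDiffOn_clm_apply]; intro u
  exact contDiffOn_comp_chart_symm (f := fun x ↦ toModel m p x (φ x (fromModel m p x u)))
    (contMDiffOn_toModel_of_contMDiffOn (hφ.contMDiffOn_apply (contMDiffOn_fromModel p u)))

lemma contMDiff_bilinField {g : BilinField m M}
    (hg : ∀ p : M, ContDiffOn ℝ ∞ (metricRep p g) (𝓒 p).target) :
    ContMDiff (𝓡 m) ((𝓡 m).prod 𝓘(ℝ, 𝓔 →L[ℝ] 𝓔 →L[ℝ] ℝ)) ∞
      (fun x ↦ TotalSpace.mk' (𝓔 →L[ℝ] 𝓔 →L[ℝ] ℝ)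
        (E := fun x : M ↦ TangentSpace (𝓡 m) x →L[ℝ] TangentSpace (𝓡 m) x →L[ℝ] ℝ) x (g x)) := by
  intro p
  rw [contMDiffAt_hom_bundle]
  refine ⟨contMDiffAt_id, ?_⟩
  have h1 : ContMDiffOn (𝓡 m) 𝓘(ℝ, 𝓔 →L[ℝ] 𝓔 →L[ℝ] ℝ) ∞ (fun x ↦ metricRep p g (𝓒 p x))
      (𝓒 p).source := by
    refine (contMDiffOn_iff_contDiffOn.2 (hg p)).comp (contMDiffOn_chart (n := ∞))
      (fun y hy ↦ (𝓒 p).map_source hy)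
  refine (h1.contMDiffAt ((𝓒 p).open_source.mem_nhds (mem_chart_source 𝓔 p))).congr_of_eventuallyEq ?_
  filter_upwards [(𝓒 p).open_source.mem_nhds (mem_chart_source 𝓔 p)] with z hz
  have hb := mem_baseSet_of_mem_chart_source hz
  ext u v
  refine (inCoordinates_apply_eq₂ (E₃ := fun _ : M ↦ ℝ) hb hb (Set.mem_univ _)).trans ?_
  rw [metricRep_apply, (𝓒 p).left_inv hz]
  have e : ∀ u, (𝓣 p).symm z u = fromModel m p z u := fun u ↦ ((𝓣 p).symmL_apply hb _).symm
  rw [e, e]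
  simp

/-- The derivatives of the extended vectors, which need not be constant in the chart at `p`, cancel
against the bracket term. -/
lemma extD_eq {η : OneForm m M} (hη : IsSmoothForm η) (hx : x ∈ (𝓒 p).source)
    (v w : TangentSpace (𝓡 m) x) : extD η x v w = (1 / 2 : ℝ) *
      (fderiv ℝ (formRep p η) (𝓒 p x) (toModel m p x v) (toModel m p x w)
        - fderiv ℝ (formRep p η) (𝓒 p x) (toModel m p x w) (toModel m p x v)) := by
  have hy := (𝓒 p).map_source hx
  have hd : DifferentiableAt ℝ (formRep p η) (𝓒 p x) := ((contDiffOn_formRep hη).contDiffAt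
    ((𝓒 p).open_target.mem_nhds hy)).differentiableAt (by simp)
  have h1 : ∀ v w : TangentSpace (𝓡 m) x, dirDeriv (fun y ↦ η y (ext w y)) x v =
      fderiv ℝ (formRep p η) (𝓒 p x) (toModel m p x v) (toModel m p x w)
      + formRep p η (𝓒 p x) (fderiv ℝ (fieldRep p (ext w)) (𝓒 p x) (toModel m p x v)) := by
    intro v w
    have h2 := hd.hasFDerivAt.clm_apply (differentiableAt_fieldRep_ext hx w).hasFDerivAt
    have h3 := h2.congr_of_eventuallyEq
      (f₁ := fun y ↦ η ((𝓒 p).symm y) (ext w ((𝓒 p).symm y))) (by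
        filter_upwards [(𝓒 p).open_target.mem_nhds hy] with z hz
        rw [formRep_apply]
        unfold fieldRep
        rw [fromModel_toModel ((𝓒 p).map_target hz)])
    rw [dirDeriv_eq hx h3.differentiableAt, h3.fderiv, fieldRep_chart _ hx, toModel_ext]
    simp
    ring
  have h4 : ∀ u : TangentSpace (𝓡 m) x, η x u = formRep p η (𝓒 p x) (toModel m p x u) := by
    intro u
    rw [formRep_apply, (𝓒 p).left_inv hx, fromModel_toModel hx]
  unfold extD
  rw [h1, h1, h4, toModel_mlieBracket hx (differentiableAt_fieldRep_ext hx v)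
    (differentiableAt_fieldRep_ext hx w), fieldRep_chart _ hx, fieldRep_chart _ hx, toModel_ext,
    toModel_ext, map_sub]
  ring

end

end Charts

/-! ### The deformed structure is paracontact; its Ricci tensor -/

section Structure

variable {n : ℕ} {M : Type*} [TopologicalSpace M]
  [ChartedSpace (EuclideanSpace ℝ (Fin (2 * n + 1))) M]
  [IsManifold (𝓡 (2 * n + 1)) ∞ M]

local notation "𝓔" => EuclideanSpace ℝ (Fin (2 * n + 1))
local notation "𝓒" => chartAt (EuclideanSpace ℝ (Fin (2 * n + 1)))

variable {S : Tensors n M} {t : ℝ} {p x : M}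

lemma IsParacontactMetric.localParacontact (hS : IsParacontactMetric S) (p : M) :
    LocalParacontact (𝓒 p).target (endRep p S.φ) (fieldRep p S.ξ) (formRep p S.η)
      (metricRep p S.g) where
  toLocalMetric := localMetric_metricRep hS.metric p
  smooth_φ := contDiffOn_endRep hS.smooth_φ
  smooth_ξ := contDiffOn_fieldRep hS.smooth_ξ
  smooth_η := contDiffOn_formRep hS.smooth_η
  η_ξ y hy := by
    rw [formRep_apply]
    unfold fieldRep
    rw [fromModel_toModel ((𝓒 p).map_target hy), hS.η_ξ]
  dη_ξ y hy v := by
    have hz := (𝓒 p).map_target hy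
    have := hS.dη_ξ ((𝓒 p).symm y) (fromModel _ p _ v)
    rw [extD_eq hS.smooth_η hz, (𝓒 p).right_inv hy, toModel_fromModel hz] at this
    unfold fieldRep
    linarith
  η_eq y hy v := by
    rw [formRep_apply, metricRep_apply, hS.η_eq]
    unfold fieldRep
    rw [fromModel_toModel ((𝓒 p).map_target hy)]
  dη_eq y hy v w := by
    have hz := (𝓒 p).map_target hy
    have := hS.dη_eq ((𝓒 p).symm y) (fromModel _ p _ v) (fromModel _ p _ w)
    rw [extD_eq hS.smooth_η hz, (𝓒 p).right_inv hy, toModel_fromModel hz,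
      toModel_fromModel hz] at this
    rw [this, metricRep_apply, endRep_apply, fromModel_toModel hz]
  φ_sq y hy v := by
    have hz := (𝓒 p).map_target hy
    rw [endRep_apply, endRep_apply, fromModel_toModel hz, hS.φ_sq, map_sub, map_smul,
      toModel_fromModel hz]
    rfl

lemma metricRep_deform (S : Tensors n M) (t : ℝ) (p : M) :
    metricRep p (S.deform t).g = deformMetric t (formRep p S.η) (metricRep p S.g) := by
  ext y u v
  rw [deformMetric_apply, metricRep_apply, metricRep_apply, formRep_apply, formRep_apply]
  simp [Tensors.deform]

lemma extD_smul {η : OneForm (2 * n + 1) M} (hη : IsSmoothForm η) (hη' : IsSmoothForm (t • η))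
    (v w : TangentSpace (𝓡 (2 * n + 1)) x) : extD (t • η) x v w = t * extD η x v w := by
  have hx := mem_chart_source 𝓔 x
  have e : formRep x (t • η) = t • formRep x η := rfl
  have hd : DifferentiableAt ℝ (formRep x η) (𝓒 x x) := ((contDiffOn_formRep hη).contDiffAt
    ((𝓒 x).open_target.mem_nhds (mem_chart_target 𝓔 x))).differentiableAt (by simp)
  rw [extD_eq hη hx, extD_eq hη' hx, e, fderiv_const_smul hd]
  simp only [_root_.smul_apply, smul_eq_mul]
  ring

/-- One factor t comes from η and n from the copies of dη. -/
lemma wedgeForm_smul {η : OneForm (2 * n + 1) M} (hη : IsSmoothForm η)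
    (hη' : IsSmoothForm (t • η)) (v : Fin (2 * n + 1) → TangentSpace (𝓡 (2 * n + 1)) x) :
    wedgeForm (t • η) x v = t ^ (n + 1) * wedgeForm η x v := by
  unfold wedgeForm
  rw [Finset.mul_sum]
  refine Finset.sum_congr rfl fun σ _ ↦ ?_
  simp only [extD_smul hη hη', Finset.prod_mul_distrib, Finset.prod_const, Finset.card_univ,
    Fintype.card_fin]
  have : (t • η) x (v (σ 0)) = t * η x (v (σ 0)) := rfl
  rw [this]
  ring

omit [IsManifold (𝓡 (2 * n + 1)) ∞ M] in
lemma deform_g_apply (S : Tensors n M) (t : ℝ) (x : M) (v w : TangentSpace (𝓡 (2 * n + 1)) x) :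
    (S.deform t).g x v w = t * S.g x v w + t * (t - 1) * (S.η x v * S.η x w) := by
  simp [Tensors.deform]

lemma IsParacontactMetric.η_φ (hS : IsParacontactMetric S) (x : M)
    (v : TangentSpace (𝓡 (2 * n + 1)) x) : S.η x (S.φ x v) = 0 := by
  rw [hS.η_eq, ← hS.dη_eq, hS.dη_ξ]

lemma IsParacontactMetric.deform (hS : IsParacontactMetric S) (ht : t ≠ 0) :
    IsParacontactMetric (S.deform t) := by
  have hη' : IsSmoothForm (t • S.η) := ContMDiff.const_smul_section hS.smooth_η
  have hη : IsSmoothForm S.η := hS.smooth_η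
  have e1 : ∀ x v w, extD (S.deform t).η x v w = t * extD S.η x v w := fun x v w ↦
    extD_smul hη hη' v w
  have e2 : ∀ x, (S.deform t).ξ x = t⁻¹ • S.ξ x := fun x ↦ rfl
  have e3 : ∀ x v, (S.deform t).η x v = t * S.η x v := fun x v ↦ rfl
  have e4 : ∀ x v, (S.deform t).φ x v = S.φ x v := fun x v ↦ rfl
  refine ⟨hS.smooth_φ, ContMDiff.const_smul_section hS.smooth_ξ, hη',
    ⟨contMDiff_bilinField fun p ↦ ?_, fun x v w ↦ ?_, fun x v h ↦ ?_⟩, fun x ↦ ?_, fun x ↦ ?_,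
    fun x v ↦ ?_, fun x v ↦ ?_, fun x v w ↦ ?_, fun x v ↦ ?_⟩
  · rw [metricRep_deform]
    have h1 := contDiffOn_formRep (p := p) hη
    have h2 := contDiffOn_metricRep (p := p) hS.metric
    rw [contDiffOn_clm_apply]; intro u
    rw [contDiffOn_clm_apply]; intro v
    simp only [deformMetric_apply]
    fun_prop
  · rw [deform_g_apply, deform_g_apply, hS.metric.symm]
    ring
  -- Testing against ξ gives t²η(v) = 0. Then η(v) = 0, and the deformed form at v reduces to t
  -- g(v,·).
  · have h1 := h (S.ξ x)
    rw [deform_g_apply, hS.metric.symm, ← hS.η_eq, hS.η_ξ] at h1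
    have h2 : S.η x v = 0 := by
      have : t * t * S.η x v = 0 := by linear_combination h1
      simpa [ht] using this
    refine hS.metric.nondegenerate x v fun w ↦ ?_
    have h3 := h w
    rw [deform_g_apply, h2] at h3
    simpa [ht] using h3
  · obtain ⟨v, hv⟩ := hS.contact x
    refine ⟨v, ?_⟩
    have := wedgeForm_smul hη hη' v
    change wedgeForm (t • S.η) x v ≠ 0
    rw [this]
    exact mul_ne_zero (pow_ne_zero _ ht) hv
  · rw [e3, e2, map_smul, hS.η_ξ]
    simp [ht]
  · rw [e1, e2, ← hS.dη_ξ x v, hS.dη_eq, hS.dη_eq, map_smul]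
    simp only [_root_.smul_apply, smul_eq_mul]
    rw [← hS.dη_eq, hS.dη_ξ]
    simp
  · rw [e3, deform_g_apply, e2, map_smul, map_smul, hS.η_ξ, _root_.smul_apply, ← hS.η_eq]
    simp only [smul_eq_mul]
    field_simp
    ring
  · rw [e1, deform_g_apply, e4, hS.η_φ, hS.dη_eq]
    ring
  · rw [e4, e4, e3, e2, hS.φ_sq, smul_smul]
    congr 2
    field_simp

lemma ricci_eq_trace {g : BilinField (2 * n + 1) M} (hg : IsSemiRiemannianMetric g) (x : M)
    (v w : 𝓔) : ricci g x v w = LinearMap.trace ℝ 𝓔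
      (ricciEnd (metricRep x g) (𝓒 x x) v w : 𝓔 →L[ℝ] 𝓔) := by
  have := trace_eq_sum_coord x (ContinuousLinearMap.toLinearMap (ricciEnd (metricRep x g) (𝓒 x x) v w))
  refine Eq.trans ?_ this.symm
  refine Finset.sum_congr rfl fun i _ ↦ ?_
  exact congrArg (fun u ↦ coord x u i) (curv_eq hg v (stdVec x i) w)

lemma ricciEnd_smul_right {E : Type*} [NormedAddCommGroup E] [NormedSpace ℝ E]
    (G : E → E →L[ℝ] E →L[ℝ] ℝ) (y v w : E) (c : ℝ) :
    ricciEnd G y v (c • w) = c • ricciEnd G y v w := by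
  ext z
  simp only [ricciEnd_apply, _root_.smul_apply, map_smul, smul_add, smul_sub]

/-- The coordinate result leaves the value at ξ unchanged; linearity in ξ_t = t⁻¹ξ supplies the
factor. -/
lemma IsParacontactMetric.ricci_deform (hS : IsParacontactMetric S) (ht : t ≠ 0) (x : M)
    {X : TangentSpace (𝓡 (2 * n + 1)) x} (hX : S.η x X = 0) :
    ricci (S.deform t).g x X ((S.deform t).ξ x) = ricci S.g x X (S.ξ x) / t := by
  have hx := mem_chart_source 𝓔 x
  have hy := mem_chart_target 𝓔 x
  have hS' := hS.deform ht
  have h := hS.localParacontact x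
  have hG := localMetric_metricRep hS'.metric x
  have hξ : fieldRep x S.ξ (𝓒 x x) = S.ξ x := (fieldRep_chart _ hx).trans (toModel_self x _)
  have hη : formRep x S.η (𝓒 x x) X = 0 := by
    refine (formRep_apply x S.η _ _).trans ?_
    rw [(𝓒 x).left_inv hx]
    exact (congrArg (S.η x) (fromModel_self x X)).trans hX
  rw [metricRep_deform] at hG
  have key := h.trace_ricciEnd_deformMetric ht hG hy hη
  have e1 : ricci S.g x X (S.ξ x) = _ := ricci_eq_trace hS.metric x X (S.ξ x)
  have e2 : ricci (S.deform t).g x X (t⁻¹ • S.ξ x) = _ :=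
    ricci_eq_trace hS'.metric x X (t⁻¹ • S.ξ x)
  rw [hξ, ← metricRep_deform] at key
  have e3 : (ricciEnd (metricRep x (S.deform t).g) (𝓒 x x) X (t⁻¹ • S.ξ x)) =
      t⁻¹ • (ricciEnd (metricRep x (S.deform t).g) (𝓒 x x) X (S.ξ x)) :=
    ricciEnd_smul_right _ _ _ _ _
  change ricci (S.deform t).g x X (t⁻¹ • S.ξ x) = _
  rw [e1, e2, ← key]
  have e4 := congrArg (fun L : 𝓔 →L[ℝ] 𝓔 ↦ LinearMap.trace ℝ 𝓔 L) e3
  refine e4.trans ?_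
  simp only [ContinuousLinearMap.toLinearMap_smul, map_smul, smul_eq_mul]
  rw [div_eq_inv_mul]

end Structure

/-! ### Volume densities and Jacobi's formula -/

section Density

open Polynomial in
lemma hasDerivAt_det_one_add_smul {ι : Type*} [Fintype ι] [DecidableEq ι] (A : Matrix ι ι ℝ) :
    HasDerivAt (fun s : ℝ ↦ (1 + s • A).det) A.trace 0 := by
  have h := ((1 + (X : ℝ[X]) • A.map C).det).hasDerivAt 0
  rw [Matrix.derivative_det_one_add_X_smul] at h
  refine h.congr_of_eventuallyEq (Filter.Eventually.of_forall fun s ↦ ?_)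
  change _ = evalRingHom s _
  rw [RingHom.map_det]
  refine congrArg Matrix.det (Matrix.ext fun i j ↦ ?_)
  simp only [smul_eq_mul, Matrix.add_apply, Matrix.smul_apply, RingHom.mapMatrix_apply,
    Matrix.map_apply, map_add, coe_evalRingHom]
  rw [eval_mul, eval_X, eval_C]
  congr 1
  by_cases hij : i = j
  · subst hij
    simp only [Matrix.one_apply_eq, eval_one]
  · simp only [Matrix.one_apply_ne hij, eval_zero]

lemma contDiff_det {ι : Type*} [Fintype ι] [DecidableEq ι] :
    ContDiff ℝ ∞ fun A : ι → ι → ℝ ↦ (Matrix.of A).det := by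
  simp only [Matrix.det_apply, Matrix.of_apply]
  refine ContDiff.sum fun σ _ ↦ ContDiff.const_smul _ (contDiff_prod fun i _ ↦ ?_)
  fun_prop

/-- Jacobi's formula. -/
lemma fderiv_det_apply {ι : Type*} [Fintype ι] [DecidableEq ι] {A : ι → ι → ℝ}
    (hA : IsUnit (Matrix.of A).det) (H : ι → ι → ℝ) :
    fderiv ℝ (fun A : ι → ι → ℝ ↦ (Matrix.of A).det) A H =
      (Matrix.of A).det * ((Matrix.of A)⁻¹ * Matrix.of H).trace := by
  have h1 : HasDerivAt (fun s : ℝ ↦ A + s • H) H 0 := by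
    simpa using ((hasDerivAt_id (0 : ℝ)).smul_const H).const_add A
  have hd : HasFDerivAt (fun A : ι → ι → ℝ ↦ (Matrix.of A).det) _ (A + (0 : ℝ) • H) :=
    ((contDiff_det (ι := ι)).differentiable (by simp) _).hasFDerivAt
  have h2 := hd.comp_hasDerivAt (0 : ℝ) h1
  have h3 := (hasDerivAt_det_one_add_smul ((Matrix.of A)⁻¹ * Matrix.of H)).const_mul
    (Matrix.of A).det
  have h4 : ∀ s : ℝ, (Matrix.of A).det * (1 + s • ((Matrix.of A)⁻¹ * Matrix.of H)).det =
      (Matrix.of (A + s • H)).det := by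
    intro s
    rw [← Matrix.det_mul, mul_add, mul_one, Matrix.mul_smul, ← mul_assoc,
      Matrix.mul_nonsing_inv _ hA, one_mul]
    rfl
  simp only [h4] at h3
  have h5 := h2.unique h3
  rwa [zero_smul, add_zero] at h5

variable {m : ℕ}

local notation "𝓔" => EuclideanSpace ℝ (Fin m)

/-- The matrix of a bilinear form in the standard basis. -/
def formMatrix (G : 𝓔 →L[ℝ] 𝓔 →L[ℝ] ℝ) : Matrix (Fin m) (Fin m) ℝ :=
  Matrix.of fun i j ↦ G (EuclideanSpace.single i 1) (EuclideanSpace.single j 1)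

/-- The matrix of an endomorphism in the standard basis. -/
def endMatrix (L : 𝓔 →L[ℝ] 𝓔) : Matrix (Fin m) (Fin m) ℝ :=
  Matrix.of fun i j ↦ L (EuclideanSpace.single j 1) i

/-- The volume density of a metric on a Euclidean space. -/
def volDensity (G : 𝓔 →L[ℝ] 𝓔 →L[ℝ] ℝ) : ℝ := Real.sqrt |(formMatrix G).det|

lemma endMatrix_eq (L : 𝓔 →L[ℝ] 𝓔) : endMatrix L = LinearMap.toMatrix
    (EuclideanSpace.basisFun (Fin m) ℝ).toBasis (EuclideanSpace.basisFun (Fin m) ℝ).toBasis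
    (L : 𝓔 →ₗ[ℝ] 𝓔) := by
  ext i j
  rw [LinearMap.toMatrix_apply, OrthonormalBasis.coe_toBasis, EuclideanSpace.basisFun_apply]
  rfl

lemma det_endMatrix (L : 𝓔 →L[ℝ] 𝓔) : (endMatrix L).det = L.det := by
  rw [endMatrix_eq, LinearMap.det_toMatrix]

lemma trace_endMatrix (L : 𝓔 →L[ℝ] 𝓔) :
    (endMatrix L).trace = LinearMap.trace ℝ 𝓔 (L : 𝓔 →ₗ[ℝ] 𝓔) := by
  rw [endMatrix_eq, ← LinearMap.trace_eq_matrix_trace]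

lemma sum_smul_single (u : 𝓔) : ∑ i, u i • EuclideanSpace.single i (1 : ℝ) = u := by
  have := (EuclideanSpace.basisFun (Fin m) ℝ).sum_repr u
  simpa using this

lemma formMatrix_left (G : 𝓔 →L[ℝ] 𝓔 →L[ℝ] ℝ) (L : 𝓔 →L[ℝ] 𝓔) :
    formMatrix (G ∘L L) = (endMatrix L)ᵀ * formMatrix G := by
  ext i j
  have := congrArg (fun u ↦ G u (EuclideanSpace.single j 1))
    (sum_smul_single (L (EuclideanSpace.single i 1)))
  simp only [map_sum, map_smul] at this
  simpa [formMatrix, endMatrix, Matrix.mul_apply, _root_.sum_apply] using this.symm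

lemma formMatrix_flip (G : 𝓔 →L[ℝ] 𝓔 →L[ℝ] ℝ) : formMatrix G.flip = (formMatrix G)ᵀ := rfl

lemma formMatrix_add (G H : 𝓔 →L[ℝ] 𝓔 →L[ℝ] ℝ) :
    formMatrix (G + H) = formMatrix G + formMatrix H := rfl

lemma det_formMatrix_comp {G G' : 𝓔 →L[ℝ] 𝓔 →L[ℝ] ℝ} {L K : 𝓔 →L[ℝ] 𝓔}
    (h : ∀ u v, G' u v = G (L u) (K v)) :
    (formMatrix G').det = L.det * K.det * (formMatrix G).det := by
  have e : G' = (((G ∘L L).flip) ∘L K).flip := by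
    ext u v
    simp [h]
  rw [e, formMatrix_flip, formMatrix_left, formMatrix_flip, formMatrix_left]
  simp only [Matrix.det_transpose, Matrix.det_mul, det_endMatrix]
  ring

lemma volDensity_comp {G G' : 𝓔 →L[ℝ] 𝓔 →L[ℝ] ℝ} {L : 𝓔 →L[ℝ] 𝓔}
    (h : ∀ u v, G' u v = G (L u) (L v)) : volDensity G' = |L.det| * volDensity G := by
  unfold volDensity
  rw [det_formMatrix_comp h, abs_mul, Real.sqrt_mul (abs_nonneg _), abs_mul,
    Real.sqrt_mul_self (abs_nonneg _)]

/-- The endomorphism acts in one slot only, so its determinant appears under the square root; in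
`volDensity_comp` it acts in both. -/
lemma volDensity_comp_left {G G' : 𝓔 →L[ℝ] 𝓔 →L[ℝ] ℝ} {L : 𝓔 →L[ℝ] 𝓔}
    (h : ∀ u v, G' u v = G (L u) v) : volDensity G' = Real.sqrt |L.det| * volDensity G := by
  unfold volDensity
  rw [det_formMatrix_comp (L := L) (K := .id ℝ _) (by simpa using h), abs_mul,
    Real.sqrt_mul (abs_nonneg _)]
  have : (ContinuousLinearMap.id ℝ 𝓔).det = 1 := by
    simp [ContinuousLinearMap.det]
  rw [this, mul_one]

lemma det_formMatrix_ne_zero {G : 𝓔 →L[ℝ] 𝓔 →L[ℝ] ℝ} (hG : ∀ v, (∀ w, G v w = 0) → v = 0) :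
    (formMatrix G).det ≠ 0 := by
  intro h0
  obtain ⟨v, hv, h⟩ := Matrix.exists_vecMul_eq_zero_iff.2 h0
  refine hv ?_
  have h1 : (WithLp.toLp 2 v : 𝓔) = 0 := by
    refine hG _ fun w ↦ ?_
    rw [← sum_smul_single w, map_sum]
    refine Finset.sum_eq_zero fun j _ ↦ ?_
    have h2 := congrFun h j
    rw [map_smul, ← sum_smul_single (WithLp.toLp 2 v : 𝓔), map_sum]
    have h3 : (∑ i, G ((WithLp.toLp 2 v : 𝓔) i • EuclideanSpace.single i 1))
        (EuclideanSpace.single j 1) = 0 := by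
      simpa [Matrix.vecMul, dotProduct, formMatrix, _root_.sum_apply] using h2
    rw [h3, smul_zero]
  exact congrArg WithLp.ofLp h1

lemma volDensity_pos {G : 𝓔 →L[ℝ] 𝓔 →L[ℝ] ℝ} (hG : ∀ v, (∀ w, G v w = 0) → v = 0) :
    0 < volDensity G := Real.sqrt_pos.2 (abs_pos.2 (det_formMatrix_ne_zero hG))

namespace LocalMetric

variable {Ω : Set (EuclideanSpace ℝ (Fin m))} {y : EuclideanSpace ℝ (Fin m)}
  {G : EuclideanSpace ℝ (Fin m) →
    EuclideanSpace ℝ (Fin m) →L[ℝ] EuclideanSpace ℝ (Fin m) →L[ℝ] ℝ}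

lemma contDiffOn_det (h : LocalMetric Ω G) : ContDiffOn ℝ ∞ (fun y ↦ (formMatrix (G y)).det) Ω := by
  refine contDiff_det.comp_contDiffOn ?_
  have := h.smooth
  refine contDiffOn_pi.2 fun i ↦ contDiffOn_pi.2 fun j ↦ ?_
  fun_prop

lemma contDiffOn_volDensity (h : LocalMetric Ω G) : ContDiffOn ℝ ∞ (fun y ↦ volDensity (G y)) Ω := by
  intro y hy
  have h0 := det_formMatrix_ne_zero (h.nondeg y hy)
  have h1 := (h.contDiffOn_det y hy)
  have h2 : ContDiffWithinAt ℝ ∞ (fun y ↦ |(formMatrix (G y)).det|) Ω y :=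
    ContDiffAt.comp_contDiffWithinAt (g := fun x : ℝ ↦ |x|) y (contDiffAt_abs h0) h1
  exact h2.sqrt (abs_ne_zero.2 h0)

/-- With P = Γ(v,·), metric compatibility reads ∂_v G = PᵀG + GP, so tr(G⁻¹ ∂_v G) = 2 tr P.
Jacobi's formula and the square root turn this into the factor tr P. -/
lemma fderiv_volDensity (h : LocalMetric Ω G) (hy : y ∈ Ω) (v : 𝓔) : fderiv ℝ (fun y ↦ volDensity (G y)) y v =
    volDensity (G y) * LinearMap.trace ℝ 𝓔 (christoffel G y v : 𝓔 →ₗ[ℝ] 𝓔) := by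
  have h0 := det_formMatrix_ne_zero (h.nondeg y hy)
  let P := christoffel G y v
  have hM : formMatrix (fderiv ℝ G y v) = (endMatrix P)ᵀ * formMatrix (G y)
      + formMatrix (G y) * endMatrix P := by
    have e : fderiv ℝ G y v = G y ∘L P + (G y ∘L P).flip := by
      ext u w
      rw [h.fderiv_eq hy, h.symm y hy u]
      rfl
    have es : (formMatrix (G y))ᵀ = formMatrix (G y) := by
      ext i j
      exact h.symm y hy _ _
    rw [e, formMatrix_add, formMatrix_flip, formMatrix_left, Matrix.transpose_mul,
      Matrix.transpose_transpose, es]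
  have h1 : HasFDerivAt (fun y ↦ fun i j ↦ formMatrix (G y) i j)
      (ContinuousLinearMap.pi fun i ↦ ContinuousLinearMap.pi fun j ↦
        ((fderiv ℝ G y).flip (EuclideanSpace.single i 1)).flip (EuclideanSpace.single j 1)) y := by
    refine hasFDerivAt_pi.2 fun i ↦ hasFDerivAt_pi.2 fun j ↦ ?_
    have hd := (h.differentiableAt hy).hasFDerivAt
    have := (hd.clm_apply (hasFDerivAt_const (EuclideanSpace.single i (1 : ℝ)) y)).clm_apply
      (hasFDerivAt_const (EuclideanSpace.single j (1 : ℝ)) y)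
    simp only [ContinuousLinearMap.comp_zero, zero_add] at this
    exact this
  have h2 : HasFDerivAt (fun A : Fin m → Fin m → ℝ ↦ (Matrix.of A).det) _
      (fun i j ↦ formMatrix (G y) i j) :=
    ((contDiff_det (ι := Fin m)).differentiable (by simp) _).hasFDerivAt
  have h3 := h2.comp y h1
  have h4 : HasFDerivAt (fun y ↦ (formMatrix (G y)).det) _ y := h3
  have h4' : HasFDerivAt (fun y ↦ |(formMatrix (G y)).det|) _ y :=
    HasDerivAt.comp_hasFDerivAt (h₂ := fun x : ℝ ↦ |x|) y (hasDerivAt_abs h0) h4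
  have h5 := h4'.sqrt (abs_ne_zero.2 h0)
  have h6 : HasFDerivAt (fun y ↦ volDensity (G y)) _ y := h5
  rw [h6.fderiv]
  have h7 := fderiv_det_apply (A := fun i j ↦ formMatrix (G y) i j) (isUnit_iff_ne_zero.2 h0)
    (fun i j ↦ formMatrix (fderiv ℝ G y v) i j)
  have h8 : ((formMatrix (G y))⁻¹ * formMatrix (fderiv ℝ G y v)).trace =
      2 * LinearMap.trace ℝ 𝓔 (P : 𝓔 →ₗ[ℝ] 𝓔) := by
    rw [hM, mul_add, Matrix.trace_add, ← mul_assoc, ← mul_assoc, Matrix.trace_mul_comm,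
      ← mul_assoc, Matrix.mul_nonsing_inv _ (isUnit_iff_ne_zero.2 h0),
      Matrix.nonsing_inv_mul _ (isUnit_iff_ne_zero.2 h0), one_mul, one_mul,
      Matrix.trace_transpose, trace_endMatrix]
    ring
  have h9 : fderiv ℝ (fun A : Fin m → Fin m → ℝ ↦ (Matrix.of A).det)
      (fun i j ↦ formMatrix (G y) i j) (fun i j ↦ formMatrix (fderiv ℝ G y v) i j) =
      (formMatrix (G y)).det * (2 * LinearMap.trace ℝ 𝓔 (P : 𝓔 →ₗ[ℝ] 𝓔)) :=
    h7.trans (congrArg _ h8)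
  simp only [_root_.smul_apply, smul_eq_mul, ContinuousLinearMap.comp_apply]
  change 1 / (2 * Real.sqrt |(formMatrix (G y)).det|) *
    (SignType.sign (formMatrix (G y)).det * (fderiv ℝ (fun A : Fin m → Fin m → ℝ ↦
      (Matrix.of A).det) (fun i j ↦ formMatrix (G y) i j)
      (fun i j ↦ formMatrix (fderiv ℝ G y v) i j))) =
    Real.sqrt |(formMatrix (G y)).det| * LinearMap.trace ℝ 𝓔 (P : 𝓔 →ₗ[ℝ] 𝓔)
  rw [h9]
  have h10 : (SignType.sign (formMatrix (G y)).det : ℝ) * (formMatrix (G y)).det =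
    |(formMatrix (G y)).det| := sign_mul_self _
  have h11 := Real.mul_self_sqrt (abs_nonneg (formMatrix (G y)).det)
  have h12 : Real.sqrt |(formMatrix (G y)).det| ≠ 0 := (volDensity_pos (h.nondeg y hy)).ne'
  field_simp
  linear_combination LinearMap.trace ℝ 𝓔 (P : 𝓔 →ₗ[ℝ] 𝓔) * (h10 - h11)

end LocalMetric

end Density

/-! ### The semi-Riemannian volume measure -/

section Charts

variable {m : ℕ} {M : Type*} [TopologicalSpace M] [ChartedSpace (EuclideanSpace ℝ (Fin m)) M]
  [IsManifold (𝓡 m) ∞ M]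

local notation "𝓔" => EuclideanSpace ℝ (Fin m)
local notation "𝓒" => chartAt (EuclideanSpace ℝ (Fin m))
local notation "𝓣" => trivializationAt (EuclideanSpace ℝ (Fin m)) (TangentSpace (𝓡 m))

section Volume

lemma volDensity_nonneg (G : 𝓔 →L[ℝ] 𝓔 →L[ℝ] ℝ) : 0 ≤ volDensity G := Real.sqrt_nonneg _

variable {g : BilinField m M} {p q x : M}

lemma hasFDerivAt_coordChange {y : 𝓔} (hy : y ∈ (𝓒 p).target) (hq : (𝓒 p).symm y ∈ (𝓒 q).source) :
    HasFDerivAt (fun z ↦ 𝓒 q ((𝓒 p).symm z))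
      (show 𝓔 →L[ℝ] 𝓔 from toModel m q ((𝓒 p).symm y) ∘L fromModel m p ((𝓒 p).symm y)) y := by
  have h1 : MDifferentiableAt 𝓘(ℝ, 𝓔) (𝓡 m) (𝓒 p).symm y :=
    mdifferentiableAt_atlas_symm (chart_mem_atlas _ _) hy
  have h2 : MDifferentiableAt (𝓡 m) 𝓘(ℝ, 𝓔) (𝓒 q) ((𝓒 p).symm y) :=
    mdifferentiableAt_atlas (chart_mem_atlas _ _) hq
  have h3 := (h2.hasMFDerivAt.comp y h1.hasMFDerivAt).hasFDerivAt
  have h4 := fromModel_eq_mfderiv ((𝓒 p).map_target hy)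
  rw [(𝓒 p).right_inv hy] at h4
  rw [toModel_eq_mfderiv hq, h4]
  exact h3

lemma metricRep_coordChange {y : 𝓔} (hq : (𝓒 p).symm y ∈ (𝓒 q).source)
    (u v : 𝓔) : metricRep p g y u v = metricRep q g (𝓒 q ((𝓒 p).symm y))
      (toModel m q ((𝓒 p).symm y) (fromModel m p ((𝓒 p).symm y) u))
      (toModel m q ((𝓒 p).symm y) (fromModel m p ((𝓒 p).symm y) v)) := by
  rw [metricRep_toModel hq, metricRep_apply]

lemma chartDensity_eq {y : 𝓔} (hy : y ∈ (𝓒 p).target) :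
    chartDensity g p y = volDensity (metricRep p g y) := by
  have h4 := fromModel_eq_mfderiv ((𝓒 p).map_target hy)
  rw [(𝓒 p).right_inv hy] at h4
  unfold chartDensity volDensity formMatrix
  simp only [metricRep_apply]
  rw [h4]
  rfl

variable [MeasurableSpace M] [BorelSpace M]

omit [IsManifold (𝓡 m) ∞ M] in
lemma measurableSet_target_inter_preimage (p : M) {s : Set M} (hs : MeasurableSet s) :
    MeasurableSet ((𝓒 p).target ∩ (𝓒 p).symm ⁻¹' s) := by
  have h : Measurable ((𝓒 p).target.domRestrict (𝓒 p).symm) :=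
    (continuousOn_iff_continuous_domRestrict.1 (𝓒 p).continuousOn_symm).measurable
  have := MeasurableSet.subtype_image (𝓒 p).open_target.measurableSet (h hs)
  convert this using 1
  ext y
  simp [and_comm]

omit [BorelSpace M] in
lemma chartVolume_eq (g : BilinField m M) (p : M) : chartVolume g p =
    (((volume : Measure 𝓔).restrict (𝓒 p).target).withDensity
      fun y ↦ ENNReal.ofReal (volDensity (metricRep p g y))).map (𝓒 p).symm := by
  unfold chartVolume
  congr 1
  refine withDensity_congr_ae ?_
  refine ae_restrict_of_forall_mem (𝓒 p).open_target.measurableSet fun y hy ↦ ?_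
  simp only [chartDensity_eq hy]

omit [IsManifold (𝓡 m) ∞ M] in
lemma aemeasurable_chart_symm (p : M) :
    AEMeasurable (𝓒 p).symm ((volume : Measure 𝓔).restrict (𝓒 p).target) :=
  (𝓒 p).continuousOn_symm.aemeasurable (𝓒 p).open_target.measurableSet

lemma chartVolume_apply (g : BilinField m M) (p : M) {s : Set M} (hs : MeasurableSet s) :
    chartVolume g p s = ∫⁻ y in (𝓒 p).target ∩ (𝓒 p).symm ⁻¹' s,
      ENNReal.ofReal (volDensity (metricRep p g y)) := by
  rw [chartVolume_eq, Measure.map_apply_of_aemeasurable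
    ((aemeasurable_chart_symm p).mono_ac (withDensity_absolutelyContinuous _ _)) hs,
    withDensity_apply', Measure.restrict_restrict' (𝓒 p).open_target.measurableSet, Set.inter_comm]

lemma chartVolume_inter_source (g : BilinField m M) (p : M) {s : Set M} (hs : MeasurableSet s) :
    chartVolume g p (s ∩ (𝓒 p).source) = chartVolume g p s := by
  rw [chartVolume_apply g p (hs.inter (𝓒 p).open_source.measurableSet), chartVolume_apply g p hs]
  congr 2
  ext y
  simp only [Set.mem_inter_iff, Set.mem_preimage]
  exact ⟨fun h ↦ ⟨h.1, h.2.1⟩, fun h ↦ ⟨h.1, h.2, (𝓒 p).map_target h.1⟩⟩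

/-- Change of variables along the transition map: its Jacobian is exactly the factor by which the
density changes. -/
lemma chartVolume_congr (g : BilinField m M) {s : Set M} (hs : MeasurableSet s)
    (hp : s ⊆ (𝓒 p).source) (hq : s ⊆ (𝓒 q).source) : chartVolume g p s = chartVolume g q s := by
  rw [chartVolume_apply g p hs, chartVolume_apply g q hs]
  have e : (𝓒 q).target ∩ (𝓒 q).symm ⁻¹' s =
      (fun z ↦ 𝓒 q ((𝓒 p).symm z)) '' ((𝓒 p).target ∩ (𝓒 p).symm ⁻¹' s) := by
    ext z
    constructor
    · rintro ⟨hz, hzs⟩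
      have hx := hp hzs
      refine ⟨𝓒 p ((𝓒 q).symm z), ⟨(𝓒 p).map_source hx, ?_⟩, ?_⟩
      · rw [Set.mem_preimage, (𝓒 p).left_inv hx]
        exact hzs
      · simp only
        rw [(𝓒 p).left_inv hx, (𝓒 q).right_inv hz]
    · rintro ⟨y, ⟨hy, hys⟩, rfl⟩
      have hx := hq hys
      refine ⟨(𝓒 q).map_source hx, ?_⟩
      rw [Set.mem_preimage, (𝓒 q).left_inv hx]
      exact hys
  have hA := measurableSet_target_inter_preimage (m := m) p hs
  have hd : ∀ y ∈ (𝓒 p).target ∩ (𝓒 p).symm ⁻¹' s, HasFDerivWithinAt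
      (fun z ↦ 𝓒 q ((𝓒 p).symm z))
      (show 𝓔 →L[ℝ] 𝓔 from toModel m q ((𝓒 p).symm y) ∘L fromModel m p ((𝓒 p).symm y))
      ((𝓒 p).target ∩ (𝓒 p).symm ⁻¹' s) y := fun y hy ↦
    (hasFDerivAt_coordChange hy.1 (hq hy.2)).hasFDerivWithinAt
  rw [e, lintegral_image_eq_lintegral_abs_det_fderiv_mul volume hA hd]
  · refine setLIntegral_congr_fun hA fun y hy ↦ ?_
    rw [← ENNReal.ofReal_mul (abs_nonneg _)]
    congr 1
    exact volDensity_comp (metricRep_coordChange (hq hy.2))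
  · intro y hy z hz h
    have h1 := congrArg (𝓒 q).symm h
    rw [(𝓒 q).left_inv (hq hy.2), (𝓒 q).left_inv (hq hz.2)] at h1
    have h2 := congrArg (𝓒 p) h1
    rwa [(𝓒 p).right_inv hy.1, (𝓒 p).right_inv hz.1] at h2

lemma chartVolume_restrict_comm (g : BilinField m M) (p q : M) :
    (chartVolume g p).restrict (𝓒 q).source = (chartVolume g q).restrict (𝓒 p).source := by
  have hp := (𝓒 p).open_source.measurableSet
  have hq := (𝓒 q).open_source.measurableSet
  ext s hs
  rw [Measure.restrict_apply hs, Measure.restrict_apply hs,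
    ← chartVolume_inter_source g p (hs.inter hq), ← chartVolume_inter_source g q (hs.inter hp),
    Set.inter_right_comm]
  exact chartVolume_congr g ((hs.inter hp).inter hq) (fun x hx ↦ hx.1.2) fun x hx ↦ hx.2

lemma volumeMeasure_restrict_source (g : BilinField m M) (p : M) :
    (volumeMeasure g).restrict (𝓒 p).source = chartVolume g p := by
  have hp := (𝓒 p).open_source.measurableSet
  have hself : (chartVolume g p).restrict (𝓒 p).source = chartVolume g p := by
    ext s hs
    rw [Measure.restrict_apply hs, chartVolume_inter_source g p hs]
  refine le_antisymm ?_ ?_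
  -- Each `chartVolume g q` splits into its part on the source at `p`, which is at most `chartVolume
  -- g p` by compatibility on overlaps, and its part off that source.
  · have h1 : volumeMeasure g ≤
        chartVolume g p + (volumeMeasure g).restrict (𝓒 p).sourceᶜ := by
      refine iSup_le fun q ↦ ?_
      rw [← Measure.restrict_add_restrict_compl (μ := chartVolume g q) hp,
        ← chartVolume_restrict_comm g p q]
      refine add_le_add Measure.restrict_le_self (Measure.restrict_mono le_rfl ?_)
      exact le_iSup (chartVolume g) q
    refine (Measure.restrict_mono le_rfl h1).trans_eq ?_
    rw [Measure.restrict_add, hself, Measure.restrict_restrict hp]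
    simp
  · conv_lhs => rw [← hself]
    exact Measure.restrict_mono le_rfl (le_iSup (chartVolume g) p)

lemma isLocallyFiniteMeasure_volumeMeasure (hg : IsSemiRiemannianMetric g) :
    IsLocallyFiniteMeasure (volumeMeasure g) := by
  refine ⟨fun x ↦ ?_⟩
  have hy := mem_chart_target 𝓔 x
  obtain ⟨ε, hε, hb⟩ := Metric.nhds_basis_closedBall.mem_iff.1 ((𝓒 x).open_target.mem_nhds hy)
  let V := (𝓒 x).source ∩ 𝓒 x ⁻¹' Metric.ball (𝓒 x x) ε
  have hV : IsOpen V := (𝓒 x).isOpen_inter_preimage Metric.isOpen_ball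
  refine ⟨V, hV.mem_nhds ⟨mem_chart_source 𝓔 x, Metric.mem_ball_self hε⟩, ?_⟩
  have h1 : volumeMeasure g V = chartVolume g x V := by
    rw [← volumeMeasure_restrict_source, Measure.restrict_apply hV.measurableSet,
      Set.inter_eq_left.2 (fun z hz ↦ hz.1)]
  rw [h1, chartVolume_apply g x hV.measurableSet]
  have h2 : (𝓒 x).target ∩ (𝓒 x).symm ⁻¹' V ⊆ Metric.closedBall (𝓒 x x) ε := by
    rintro y ⟨hy, hyV⟩
    have := hyV.2
    rw [Set.mem_preimage, (𝓒 x).right_inv hy] at this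
    exact Metric.ball_subset_closedBall this
  refine (lintegral_mono_set h2).trans_lt ?_
  have h3 : IntegrableOn (fun y ↦ volDensity (metricRep x g y)) (Metric.closedBall (𝓒 x x) ε) :=
    (((localMetric_metricRep hg x).contDiffOn_volDensity.continuousOn).mono hb).integrableOn_compact
      (isCompact_closedBall _ _)
  exact h3.lintegral_lt_top

lemma setIntegral_source (hg : IsSemiRiemannianMetric g) (p : M) {f : M → ℝ} (hf : Continuous f) :
    ∫ x in (𝓒 p).source, f x ∂(volumeMeasure g) =
      ∫ y in (𝓒 p).target, volDensity (metricRep p g y) * f ((𝓒 p).symm y) := by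
  rw [volumeMeasure_restrict_source, chartVolume_eq, integral_map
    ((aemeasurable_chart_symm p).mono_ac (withDensity_absolutelyContinuous _ _))
    hf.aestronglyMeasurable, integral_withDensity_eq_integral_toReal_smul₀]
  · refine setIntegral_congr_fun (𝓒 p).open_target.measurableSet fun y hy ↦ ?_
    rw [ENNReal.toReal_ofReal (volDensity_nonneg _), smul_eq_mul]
  · exact (((localMetric_metricRep hg p).contDiffOn_volDensity.continuousOn).aemeasurable
      (𝓒 p).open_target.measurableSet).ennreal_ofReal
  · exact Filter.Eventually.of_forall fun _ ↦ ENNReal.ofReal_lt_top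

/-- Scaling by c commutes with the supremum of measures because scaling by c⁻¹ inverts it. -/
lemma volumeMeasure_eq_smul {g g' : BilinField m M} {c : ℝ} (hc : 0 < c)
    (h : ∀ p : M, ∀ y ∈ (𝓒 p).target,
      volDensity (metricRep p g' y) = c * volDensity (metricRep p g y)) :
    volumeMeasure g' = ENNReal.ofReal c • volumeMeasure g := by
  have hc0 : ENNReal.ofReal c ≠ 0 := by simpa using hc
  have h1 : ∀ p, chartVolume g' p = ENNReal.ofReal c • chartVolume g p := fun p ↦ by
    ext s hs
    rw [Measure.smul_apply, chartVolume_apply g' p hs, chartVolume_apply g p hs, smul_eq_mul,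
      ← lintegral_const_mul' _ _ ENNReal.ofReal_ne_top]
    refine setLIntegral_congr_fun (measurableSet_target_inter_preimage p hs) fun y hy ↦ ?_
    rw [h p y hy.1, ENNReal.ofReal_mul hc.le]
  unfold volumeMeasure
  simp only [h1]
  refine le_antisymm (iSup_le fun p ↦ ?_) ?_
  · gcongr
    exact le_iSup (chartVolume g) p
  · have h2 : (⨆ p, chartVolume g p) ≤
        (ENNReal.ofReal c)⁻¹ • ⨆ p, ENNReal.ofReal c • chartVolume g p := by
      refine iSup_le fun p ↦ ?_
      calc chartVolume g p = (ENNReal.ofReal c)⁻¹ • ENNReal.ofReal c • chartVolume g p := by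
            rw [smul_smul, ENNReal.inv_mul_cancel hc0 ENNReal.ofReal_ne_top, one_smul]
        _ ≤ _ := by
            gcongr
            exact le_iSup (fun p ↦ ENNReal.ofReal c • chartVolume g p) p
    calc ENNReal.ofReal c • (⨆ p, chartVolume g p) ≤ ENNReal.ofReal c •
          (ENNReal.ofReal c)⁻¹ • ⨆ p, ENNReal.ofReal c • chartVolume g p := by gcongr
      _ = _ := by
          rw [smul_smul, ENNReal.mul_inv_cancel hc0 ENNReal.ofReal_ne_top, one_smul]

end Volume

end Charts

/-! ### The volume of the deformed metric -/

section Structure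

variable {n : ℕ} {M : Type*} [TopologicalSpace M]
  [ChartedSpace (EuclideanSpace ℝ (Fin (2 * n + 1))) M]
  [IsManifold (𝓡 (2 * n + 1)) ∞ M]

local notation "𝓔" => EuclideanSpace ℝ (Fin (2 * n + 1))
local notation "𝓒" => chartAt (EuclideanSpace ℝ (Fin (2 * n + 1)))

variable {S : Tensors n M} {t : ℝ}

lemma volDensity_deformMetric {η : 𝓔 → 𝓔 →L[ℝ] ℝ} {G : 𝓔 → 𝓔 →L[ℝ] 𝓔 →L[ℝ] ℝ} {y ξ : 𝓔}
    (h1 : η y ξ = 1) (h2 : ∀ v, η y v = G y ξ v) :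
    volDensity (deformMetric t η G y) = Real.sqrt |t ^ (2 * n + 2)| * volDensity (G y) := by
  -- Chosen so that the deformed metric is G(L·,·). The scalar contributes t^(2n+1) to the
  -- determinant and the rank-one perturbation contributes 1 + (t-1)η(ξ) = t.
  let L : 𝓔 →L[ℝ] 𝓔 := t • (.id ℝ 𝓔 + (η y).smulRight ((t - 1) • ξ))
  have hL : L.det = t ^ (2 * n + 2) := by
    have : (L : 𝓔 →ₗ[ℝ] 𝓔) = t • LinearMap.transvection (η y : 𝓔 →ₗ[ℝ] ℝ) ((t - 1) • ξ) := by
      ext u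
      simp [L, LinearMap.transvection]
    unfold ContinuousLinearMap.det
    rw [this, LinearMap.det_smul, LinearMap.transvection.det]
    simp [h1]
    ring
  rw [← hL]
  refine volDensity_comp_left fun u v ↦ ?_
  rw [deformMetric_apply]
  simp [L, h2]
  ring

lemma IsParacontactMetric.volumeMeasure_deform [MeasurableSpace M] [BorelSpace M]
    (hS : IsParacontactMetric S) (ht : t ≠ 0) : volumeMeasure (S.deform t).g =
      ENNReal.ofReal (Real.sqrt |t ^ (2 * n + 2)|) • volumeMeasure S.g := by
  refine volumeMeasure_eq_smul (Real.sqrt_pos.2 (by positivity)) fun p y hy ↦ ?_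
  have h := hS.localParacontact p
  rw [metricRep_deform]
  exact volDensity_deformMetric (h.η_ξ y hy) (h.η_eq y hy)

end Structure

/-! ### The divergence theorem -/

section Charts

variable {m : ℕ} {M : Type*} [TopologicalSpace M] [ChartedSpace (EuclideanSpace ℝ (Fin m)) M]
  [IsManifold (𝓡 m) ∞ M]

local notation "𝓔" => EuclideanSpace ℝ (Fin m)
local notation "𝓒" => chartAt (EuclideanSpace ℝ (Fin m))
local notation "𝓣" => trivializationAt (EuclideanSpace ℝ (Fin m)) (TangentSpace (𝓡 m))

section Divergence

lemma integral_fderiv_apply_eq_zero {F : Type*} [NormedAddCommGroup F] [NormedSpace ℝ F]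
    [FiniteDimensional ℝ F] [MeasurableSpace F] [BorelSpace F] (μ : Measure F)
    [μ.IsAddHaarMeasure] {f : F → ℝ} (hf : ContDiff ℝ 1 f) (hc : HasCompactSupport f) (v : F) :
    ∫ x, fderiv ℝ f x v ∂μ = 0 := by
  have h1 : Integrable (fun x ↦ fderiv ℝ f x v) μ :=
    ((hf.continuous_fderiv (by simp)).clm_apply continuous_const).integrable_of_hasCompactSupport
      (hc.fderiv_apply (𝕜 := ℝ) v)
  have h2 := integral_mul_fderiv_eq_neg_fderiv_mul_of_integrable (μ := μ) (f := fun _ : F ↦ (1 : ℝ))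
    (g := f) (v := v) (by simp) (by simpa using h1)
    (by simpa using hf.continuous.integrable_of_hasCompactSupport hc)
    (fun x _ ↦ differentiableAt_const _) (fun x _ ↦ hf.differentiable (by simp) x)
  simpa using h2

/-- The divergence theorem for compactly supported vector fields on an open subset of a
Euclidean space. -/
lemma integral_volDensity_mul_trace_covDeriv {Ω K : Set 𝓔} {G : 𝓔 → 𝓔 →L[ℝ] 𝓔 →L[ℝ] ℝ}
    (h : LocalMetric Ω G) {Z : 𝓔 → 𝓔} (hZ : ContDiffOn ℝ ∞ Z Ω) (hK : IsCompact K) (hKΩ : K ⊆ Ω)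
    (h0 : ∀ y ∈ Ω, y ∉ K → Z y = 0) :
    ∫ y in Ω, volDensity (G y) * LinearMap.trace ℝ 𝓔 (covDeriv G Z y : 𝓔 →L[ℝ] 𝓔) = 0 := by
  classical
  -- The field √|det G| Z extended by zero is smooth on the whole space, because Z vanishes off the
  -- compact K inside Ω.
  let W : 𝓔 → 𝓔 := Ω.indicator fun y ↦ volDensity (G y) • Z y
  have hW0 : ∀ y, y ∉ K → W y = 0 := fun y hy ↦ by
    by_cases hΩ : y ∈ Ω
    · simp only [W, Set.indicator_of_mem hΩ, h0 y hΩ hy, smul_zero]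
    · exact Set.indicator_of_notMem hΩ _
  have hWΩ : ∀ y ∈ Ω, W =ᶠ[𝓝 y] fun y ↦ volDensity (G y) • Z y := fun y hy ↦ by
    filter_upwards [h.isOpen.mem_nhds hy] with z hz using Set.indicator_of_mem hz _
  have hWK : ∀ y, y ∉ K → W =ᶠ[𝓝 y] fun _ ↦ 0 := fun y hy ↦ by
    filter_upwards [hK.isClosed.isOpen_compl.mem_nhds hy] with z hz using hW0 z hz
  have hWs : ContDiff ℝ ∞ W := by
    rw [contDiff_iff_contDiffAt]
    intro y
    by_cases hy : y ∈ K
    · have hn := h.isOpen.mem_nhds (hKΩ hy)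
      exact ((h.contDiffOn_volDensity.contDiffAt hn).smul
        (hZ.contDiffAt hn)).congr_of_eventuallyEq (hWΩ y (hKΩ hy))
    · exact contDiffAt_const.congr_of_eventuallyEq (hWK y hy)
  have hWc : HasCompactSupport W := .intro hK hW0
  -- The classical formula √|det G| div Z = Σ ∂_i(√|det G| Zⁱ). By `fderiv_volDensity` and symmetry
  -- of Γ, the derivative of the density accounts for the Christoffel part of the trace.
  have key : ∀ y ∈ Ω, volDensity (G y) * LinearMap.trace ℝ 𝓔 (covDeriv G Z y : 𝓔 →L[ℝ] 𝓔) =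
      ∑ i, fderiv ℝ (fun y ↦ W y i) y (EuclideanSpace.single i 1) := by
    intro y hy
    have hn := h.isOpen.mem_nhds hy
    have h1 : DifferentiableAt ℝ (fun y ↦ volDensity (G y)) y :=
      (h.contDiffOn_volDensity.contDiffAt hn).differentiableAt (by simp)
    have h2 : DifferentiableAt ℝ Z y := (hZ.contDiffAt hn).differentiableAt (by simp)
    have h3 := (h1.hasFDerivAt.smul h2.hasFDerivAt).congr_of_eventuallyEq (hWΩ y hy)
    have h4 : ∀ i, fderiv ℝ (fun y ↦ W y i) y (EuclideanSpace.single i 1) =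
        endMatrix (fderiv ℝ W y) i i := fun i ↦ by
      have := ((EuclideanSpace.proj (𝕜 := ℝ) i).hasFDerivAt (x := W y)).comp y
        h3.differentiableAt.hasFDerivAt
      have h5 : HasFDerivAt (fun y ↦ W y i) _ y := this
      rw [h5.fderiv]
      rfl
    simp only [h4]
    change _ = (endMatrix (fderiv ℝ W y)).trace
    have h6 : covDeriv G Z y = fderiv ℝ Z y + christoffel G y (Z y) := by
      ext1 v
      rw [covDeriv_apply, h.christoffel_symm hy]
      rfl
    have h7 : LinearMap.trace ℝ 𝓔
        ((fderiv ℝ (fun y ↦ volDensity (G y)) y).smulRight (Z y) : 𝓔 →ₗ[ℝ] 𝓔) =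
        fderiv ℝ (fun y ↦ volDensity (G y)) y (Z y) := LinearMap.trace_smulRight _ _
    rw [trace_endMatrix, h3.fderiv, h6, ContinuousLinearMap.toLinearMap_add,
      ContinuousLinearMap.toLinearMap_add, map_add, map_add, h7, h.fderiv_volDensity hy,
      ContinuousLinearMap.toLinearMap_smul, map_smul, smul_eq_mul]
    ring
  rw [setIntegral_congr_fun h.isOpen.measurableSet key,
    setIntegral_eq_integral_of_forall_compl_eq_zero]
  · have hWi : ∀ i, ContDiff ℝ 1 fun y ↦ W y i := fun i ↦
      ((EuclideanSpace.proj (𝕜 := ℝ) i).contDiff.comp hWs).of_le (by simp)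
    have hWci : ∀ i, HasCompactSupport fun y ↦ W y i := fun i ↦
      hWc.comp_left (g := fun w : 𝓔 ↦ w i) rfl
    rw [integral_finsetSum]
    · exact Finset.sum_eq_zero fun i _ ↦ integral_fderiv_apply_eq_zero _ (hWi i) (hWci i) _
    · intro i _
      exact (((hWi i).continuous_fderiv (by simp)).clm_apply
        continuous_const).integrable_of_hasCompactSupport ((hWci i).fderiv_apply (𝕜 := ℝ) _)
  · intro y hy
    refine Finset.sum_eq_zero fun i _ ↦ ?_
    have : (fun y ↦ W y i) =ᶠ[𝓝 y] fun _ ↦ 0 := by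
      filter_upwards [hWK y fun hK ↦ hy (hKΩ hK)] with z hz
      rw [hz]
      rfl
    rw [this.fderiv_eq]
    simp

variable {g : BilinField m M} {p x : M}

/-- The divergence of a vector field. -/
def divergence (g : BilinField m M) (Z : VField m M) (x : M) : ℝ :=
  ∑ i, coord x (nabla g Z x (stdVec x i)) i

lemma IsSmoothField.differentiableAt_fieldRep {Z : VField m M} (hZ : IsSmoothField Z)
    (hx : x ∈ (𝓒 p).source) : DifferentiableAt ℝ (fieldRep p Z) (𝓒 p x) :=
  ((contDiffOn_fieldRep hZ).contDiffAt ((𝓒 p).open_target.mem_nhds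
    ((𝓒 p).map_source hx))).differentiableAt (by simp)

lemma divergence_eq (hg : IsSemiRiemannianMetric g) (hx : x ∈ (𝓒 p).source) {Z : VField m M}
    (hZ : DifferentiableAt ℝ (fieldRep p Z) (𝓒 p x)) : divergence g Z x =
      LinearMap.trace ℝ 𝓔 (covDeriv (metricRep p g) (fieldRep p Z) (𝓒 p x) : 𝓔 →L[ℝ] 𝓔) := by
  let e : TangentSpace (𝓡 m) x ≃ₗ[ℝ] 𝓔 := LinearEquiv.ofLinearMap
    (toModel m p x : TangentSpace (𝓡 m) x →ₗ[ℝ] 𝓔) (fromModel m p x : 𝓔 →ₗ[ℝ] TangentSpace (𝓡 m) x)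
    (LinearMap.ext fun u ↦ toModel_fromModel hx u)
    (LinearMap.ext fun u ↦ fromModel_toModel hx u)
  let L : 𝓔 →ₗ[ℝ] 𝓔 := ContinuousLinearMap.toLinearMap
    (covDeriv (metricRep p g) (fieldRep p Z) (𝓒 p x))
  have h1 : LinearMap.trace ℝ (TangentSpace (𝓡 m) x) (e.symm.conj L) = divergence g Z x := by
    rw [trace_eq_sum_coord]
    refine Finset.sum_congr rfl fun i _ ↦ ?_
    congr 1
    have := toModel_nabla hg hx hZ (stdVec x i)
    rw [← fromModel_toModel hx (nabla g Z x (stdVec x i)), this]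
    rfl
  rw [← h1, LinearMap.trace_conj']

lemma continuous_divergence (hg : IsSemiRiemannianMetric g) {Z : VField m M}
    (hZ : IsSmoothField Z) : Continuous (divergence g Z) := by
  rw [continuous_iff_continuousAt]
  intro p
  have hG := localMetric_metricRep hg p
  let τ : (𝓔 →L[ℝ] 𝓔) →ₗ[ℝ] ℝ :=
    { toFun := fun L ↦ LinearMap.trace ℝ 𝓔 (L : 𝓔 →ₗ[ℝ] 𝓔)
      map_add' := fun B C ↦ by rw [← map_add]; rfl
      map_smul' := fun c B ↦ by rw [RingHom.id_apply, ← map_smul]; rfl }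
  have h1 : ContinuousOn (fun y ↦ τ (covDeriv (metricRep p g) (fieldRep p Z) y)) (𝓒 p).target :=
    (LinearMap.continuous_of_finiteDimensional τ).comp_continuousOn
      (hG.contDiffOn_covDeriv (contDiffOn_fieldRep hZ)).continuousOn
  have h2 : ContinuousOn (fun x ↦ τ (covDeriv (metricRep p g) (fieldRep p Z) (𝓒 p x)))
      (𝓒 p).source := h1.comp (𝓒 p).continuousOn fun x hx ↦ (𝓒 p).map_source hx
  have hn := (𝓒 p).open_source.mem_nhds (mem_chart_source 𝓔 p)
  refine (h2.continuousAt hn).congr ?_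
  filter_upwards [hn] with x hx
  exact (divergence_eq hg hx (hZ.differentiableAt_fieldRep hx)).symm

lemma divergence_eq_zero (hg : IsSemiRiemannianMetric g) {Z : VField m M}
    (hZ : ∀ᶠ y in 𝓝 x, Z y = 0) : divergence g Z x = 0 := by
  have hx := mem_chart_source 𝓔 x
  have hy := mem_chart_target 𝓔 x
  have h1 : fieldRep x Z =ᶠ[𝓝 (𝓒 x x)] fun _ ↦ 0 := by
    have h2 := (𝓒 x).continuousAt_symm hy
    rw [ContinuousAt, (𝓒 x).left_inv hx] at h2
    filter_upwards [h2.eventually hZ] with z hz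
    unfold fieldRep
    rw [hz, map_zero]
  rw [divergence_eq hg hx ((differentiableAt_const 0).congr_of_eventuallyEq h1)]
  have : covDeriv (metricRep x g) (fieldRep x Z) (𝓒 x x) = 0 := by
    ext1 v
    rw [covDeriv_apply, h1.fderiv_eq, h1.eq_of_nhds]
    simp
  rw [this]
  simp

lemma divergence_sum (hg : IsSemiRiemannianMetric g) {ι : Type*} [Fintype ι] {Z : ι → VField m M}
    (hZ : ∀ i, IsSmoothField (Z i)) (x : M) :
    divergence g (fun y ↦ ∑ i, Z i y) x = ∑ i, divergence g (Z i) x := by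
  have hx := mem_chart_source 𝓔 x
  have hd := fun i ↦ (hZ i).differentiableAt_fieldRep hx
  have e : fieldRep x (fun y ↦ ∑ i, Z i y) = fun y ↦ ∑ i, fieldRep x (Z i) y := by
    funext y
    unfold fieldRep
    rw [map_sum]
  have hs : HasFDerivAt (fun y ↦ ∑ i, fieldRep x (Z i) y)
      (∑ i, fderiv ℝ (fieldRep x (Z i)) (𝓒 x x)) (𝓒 x x) :=
    HasFDerivAt.fun_sum fun i _ ↦ (hd i).hasFDerivAt
  rw [divergence_eq hg hx (by rw [e]; exact hs.differentiableAt), e]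
  simp only [fun i ↦ divergence_eq hg hx (hd i)]
  rw [← map_sum]
  congr 1
  ext1 v
  rw [LinearMap.sum_apply]
  change covDeriv _ _ _ v = ∑ i, covDeriv _ _ _ v
  simp only [covDeriv_apply, hs.fderiv, Finset.sum_add_distrib, map_sum, _root_.sum_apply]

variable [MeasurableSpace M] [BorelSpace M]

lemma integral_divergence_of_subset_source [T2Space M] (hg : IsSemiRiemannianMetric g)
    {Z : VField m M} (hZ : IsSmoothField Z) {K : Set M} (hK : IsCompact K)
    (hKp : K ⊆ (𝓒 p).source) (h0 : ∀ x, x ∉ K → Z x = 0) :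
    ∫ x, divergence g Z x ∂(volumeMeasure g) = 0 := by
  have hd0 : ∀ x, x ∉ K → divergence g Z x = 0 := fun x hx ↦ divergence_eq_zero hg (by
    filter_upwards [hK.isClosed.isOpen_compl.mem_nhds hx] with z hz using h0 z hz)
  rw [← setIntegral_eq_integral_of_forall_compl_eq_zero (s := (𝓒 p).source)
    (fun x hx ↦ hd0 x fun hxK ↦ hx (hKp hxK)), setIntegral_source hg p (continuous_divergence hg hZ)]
  have h1 : ∀ y ∈ (𝓒 p).target, volDensity (metricRep p g y) * divergence g Z ((𝓒 p).symm y) =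
      volDensity (metricRep p g y) * LinearMap.trace ℝ 𝓔
        (covDeriv (metricRep p g) (fieldRep p Z) y : 𝓔 →L[ℝ] 𝓔) := fun y hy ↦ by
    have hx := (𝓒 p).map_target hy
    rw [divergence_eq hg hx (hZ.differentiableAt_fieldRep hx), (𝓒 p).right_inv hy]
  rw [setIntegral_congr_fun (𝓒 p).open_target.measurableSet h1]
  refine integral_volDensity_mul_trace_covDeriv (localMetric_metricRep hg p)
    (contDiffOn_fieldRep hZ) (K := 𝓒 p '' K) (hK.image_of_continuousOn
      ((𝓒 p).continuousOn.mono hKp)) ?_ ?_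
  · rintro _ ⟨x, hx, rfl⟩
    exact (𝓒 p).map_source (hKp hx)
  · intro y hy hyK
    unfold fieldRep
    rw [h0, map_zero]
    intro hx
    exact hyK ⟨_, hx, (𝓒 p).right_inv hy⟩

/-- The divergence theorem for compactly supported vector fields. -/
lemma integral_divergence [T2Space M] [SecondCountableTopology M] (hg : IsSemiRiemannianMetric g)
    {Z : VField m M} (hZ : IsSmoothField Z) {K : Set M} (hK : IsCompact K)
    (h0 : ∀ x, x ∉ K → Z x = 0) : ∫ x, divergence g Z x ∂(volumeMeasure g) = 0 := by
  have : LocallyCompactSpace M := ChartedSpace.locallyCompactSpace 𝓔 M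
  have := isLocallyFiniteMeasure_volumeMeasure hg
  obtain ⟨T, -, hT⟩ := hK.elim_nhds_subcover (fun p ↦ (𝓒 p).source)
    fun p _ ↦ (𝓒 p).open_source.mem_nhds (mem_chart_source 𝓔 p)
  -- A partition of unity on K splits Z into finitely many smooth fields, each with compact support
  -- in one chart. Off K all the pieces vanish along with Z.
  obtain ⟨f, hf⟩ := SmoothPartitionOfUnity.exists_isSubordinate (𝓡 m) hK.isClosed
    (fun p : T ↦ (𝓒 (p : M)).source) (fun p ↦ (𝓒 (p : M)).open_source) (by
      intro x hx
      simpa using hT hx)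
  let W : T → VField m M := fun p x ↦ f p x • Z x
  have hW : ∀ p, IsSmoothField (W p) := fun p ↦
    ContMDiff.smul_section (f := f p) (f p).contMDiff hZ
  have hW0 : ∀ p x, x ∉ K → W p x = 0 := fun p x hx ↦ by simp only [W, h0 x hx, smul_zero]
  have hZW : Z = fun x ↦ ∑ p, W p x := by
    funext x
    by_cases hx : x ∈ K
    · have := f.sum_eq_one hx
      rw [finsum_eq_sum_of_fintype] at this
      simp only [W, ← Finset.sum_smul, this, one_smul]
    · simp only [hW0 _ x hx, Finset.sum_const_zero, h0 x hx]
  have hd : divergence g Z = fun x ↦ ∑ p, divergence g (W p) x := by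
    funext x
    conv_lhs => rw [hZW]
    exact divergence_sum hg hW x
  rw [hd, integral_finsetSum]
  · refine Finset.sum_eq_zero fun p _ ↦ integral_divergence_of_subset_source (p := (p : M)) hg (hW p)
      (K := K ∩ tsupport (f p)) (hK.inter_right (isClosed_tsupport _))
      (fun x hx ↦ hf p hx.2) fun x hx ↦ ?_
    by_cases hxK : x ∈ K
    · have : f p x = 0 := image_eq_zero_of_notMem_tsupport fun h ↦ hx ⟨hxK, h⟩
      simp only [W, this, zero_smul]
    · exact hW0 p x hxK
  · intro p _
    refine (continuous_divergence hg (hW p)).integrable_of_hasCompactSupport (.intro hK fun x hx ↦ ?_)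
    exact divergence_eq_zero hg (by
      filter_upwards [hK.isClosed.isOpen_compl.mem_nhds hx] with z hz using hW0 p z hz)

end Divergence

end Charts

/-! ### First variation of the energy density in coordinates -/

section LocalVariation

variable {E : Type*} [NormedAddCommGroup E] [NormedSpace ℝ E] [FiniteDimensional ℝ E]

/-- The functional `B ↦ formTrace G B` as a continuous linear map. -/
def formTraceL (G : E →L[ℝ] E →L[ℝ] ℝ) : (E →L[ℝ] E →L[ℝ] ℝ) →L[ℝ] ℝ :=
  LinearMap.toContinuousLinearMap
    { toFun := formTrace G
      map_add' := fun B C ↦ by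
        unfold formTrace
        rw [← map_add, ContinuousLinearMap.comp_add]
        rfl
      map_smul' := fun c B ↦ by
        unfold formTrace
        rw [RingHom.id_apply, ← map_smul, ContinuousLinearMap.comp_smul]
        rfl }

lemma formTrace_flip {G B : E →L[ℝ] E →L[ℝ] ℝ} (hG : ∀ v, (∀ w, G v w = 0) → v = 0)
    (hs : ∀ u v, G u v = G v u) : formTrace G B.flip = formTrace G B := by
  refine trace_eq_of_adjoint hG fun u v ↦ ?_
  simp only [ContinuousLinearMap.coe_coe, ContinuousLinearMap.comp_apply,
    apply_inverse_of_nondegenerate hG]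
  rw [hs, apply_inverse_of_nondegenerate hG]
  rfl

namespace LocalMetric

variable {Ω : Set E} {I : Set ℝ} {G : E → E →L[ℝ] E →L[ℝ] ℝ} {W : ℝ × E → E} {s : ℝ} {y : E}

lemma contDiffOn_formTrace (h : LocalMetric Ω G) {F : Type*} [NormedAddCommGroup F]
    [NormedSpace ℝ F] {S : Set F} {q : F → E} (hq : ContDiffOn ℝ ∞ q S) (hqS : Set.MapsTo q S Ω)
    {B : F → E →L[ℝ] E →L[ℝ] ℝ} (hB : ContDiffOn ℝ ∞ B S) :
    ContDiffOn ℝ ∞ (fun z ↦ formTrace (G (q z)) (B z)) S := by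
  let τ : (E →L[ℝ] E) →L[ℝ] ℝ := LinearMap.toContinuousLinearMap
    { toFun := fun L ↦ LinearMap.trace ℝ E (L : E →ₗ[ℝ] E)
      map_add' := fun B C ↦ by rw [← map_add]; rfl
      map_smul' := fun c B ↦ by rw [RingHom.id_apply, ← map_smul]; rfl }
  have h1 : ContDiffOn ℝ ∞ (fun z ↦ (G (q z)).inverse) S := h.contDiffOn_inverse.comp hq hqS
  exact τ.contDiff.comp_contDiffOn (h1.clm_comp hB)

omit [FiniteDimensional ℝ E] in
-- Expressing the spatial derivative through the joint derivative of W makes smoothness in (s,y) and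
-- differentiation in s accessible.
lemma covDeriv_section (hW : DifferentiableAt ℝ W (s, y)) :
    covDeriv G (fun z ↦ W (s, z)) y =
      fderiv ℝ W (s, y) ∘L .inr ℝ ℝ E + (christoffel G y).flip (W (s, y)) := by
  have h1 : HasFDerivAt (fun z : E ↦ (s, z)) (.inr ℝ ℝ E) y := hasFDerivAt_prodMk_right s y
  have h2 : HasFDerivAt (fun z ↦ W (s, z)) _ y := hW.hasFDerivAt.comp y h1
  ext v
  rw [covDeriv_apply, h2.fderiv]
  rfl

lemma contDiffOn_covDeriv_section (h : LocalMetric Ω G) (hI : IsOpen I)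
    (hW : ContDiffOn ℝ ∞ W (I ×ˢ Ω)) :
    ContDiffOn ℝ ∞ (fun z : ℝ × E ↦ covDeriv G (fun y ↦ W (z.1, y)) z.2) (I ×ˢ Ω) := by
  have hO := hI.prod h.isOpen
  have h1 : ContDiffOn ℝ ∞ (fderiv ℝ W) (I ×ˢ Ω) := hW.fderiv_of_isOpen hO (by simp)
  have h2 : ContDiffOn ℝ ∞ (fun z : ℝ × E ↦ christoffel G z.2) (I ×ˢ Ω) :=
    h.contDiffOn_christoffel.comp contDiffOn_snd fun z hz ↦ hz.2
  have h3 : ContDiffOn ℝ ∞ (fun z : ℝ × E ↦ fderiv ℝ W z ∘L .inr ℝ ℝ E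
      + (christoffel G z.2).flip (W z)) (I ×ˢ Ω) := by
    rw [contDiffOn_clm_apply]; intro u
    simp only [_root_.add_apply, ContinuousLinearMap.comp_apply, ContinuousLinearMap.flip_apply]
    fun_prop
  refine h3.congr fun z hz ↦ covDeriv_section ?_
  exact (hW.contDiffAt (hO.mem_nhds hz)).differentiableAt (by simp)

/-- The coordinate expression of the energy density of a family of vector fields is smooth. -/
lemma contDiffOn_energy (h : LocalMetric Ω G) (hI : IsOpen I) (hW : ContDiffOn ℝ ∞ W (I ×ˢ Ω)) :
    ContDiffOn ℝ ∞ (fun z : ℝ × E ↦ formTrace (G z.2) (G z.2 + (G z.2).bilinearComp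
      (covDeriv G (fun y ↦ W (z.1, y)) z.2) (covDeriv G (fun y ↦ W (z.1, y)) z.2)))
      (I ×ˢ Ω) := by
  have h1 := h.contDiffOn_covDeriv_section hI hW
  have h2 : ContDiffOn ℝ ∞ (fun z : ℝ × E ↦ G z.2) (I ×ˢ Ω) :=
    h.smooth.comp contDiffOn_snd fun z hz ↦ hz.2
  refine h.contDiffOn_formTrace contDiffOn_snd (fun z hz ↦ hz.2) ?_
  rw [contDiffOn_clm_apply]; intro u
  rw [contDiffOn_clm_apply]; intro v
  simp only [_root_.add_apply, ContinuousLinearMap.bilinearComp_apply]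
  exact ((h2.clm_apply contDiffOn_const).clm_apply contDiffOn_const).add
    ((h2.clm_apply (h1.clm_apply contDiffOn_const)).clm_apply (h1.clm_apply contDiffOn_const))

omit [FiniteDimensional ℝ E] in
-- The metric does not depend on s, so ∂_s∇W = ∇∂_sW reduces to symmetry of the second derivative of
-- W.
lemma hasDerivAt_covDeriv_section (h : LocalMetric Ω G) (hI : IsOpen I)
    (hW : ContDiffOn ℝ ∞ W (I ×ˢ Ω)) (hs : s ∈ I) (hy : y ∈ Ω) :
    HasDerivAt (fun s ↦ covDeriv G (fun z ↦ W (s, z)) y)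
      (covDeriv G (fun z ↦ fderiv ℝ W (s, z) (1, 0)) y) s := by
  have hO := hI.prod h.isOpen
  have hn := hO.mem_nhds (Set.mk_mem_prod hs hy)
  have hWs : ContDiffAt ℝ ∞ W (s, y) := hW.contDiffAt hn
  have hd : DifferentiableAt ℝ (fderiv ℝ W) (s, y) :=
    (hWs.fderiv_right (m := ∞) (by simp)).differentiableAt (by simp)
  have hsymm : IsSymmSndFDerivAt ℝ W (s, y) :=
    hWs.isSymmSndFDerivAt (by simpa using ENat.LEInfty.out)
  have h1 : HasDerivAt (fun s : ℝ ↦ (s, y)) (1, 0) s := (hasDerivAt_id s).prodMk (hasDerivAt_const s y)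
  have h2 : HasDerivAt (fun s ↦ fderiv ℝ W (s, y)) (fderiv ℝ (fderiv ℝ W) (s, y) (1, 0)) s :=
    hd.hasFDerivAt.comp_hasDerivAt s h1
  have h3 : HasDerivAt (fun s ↦ W (s, y)) (fderiv ℝ W (s, y) (1, 0)) s :=
    (hWs.differentiableAt (by simp)).hasFDerivAt.comp_hasDerivAt s h1
  let Λ : (ℝ × E →L[ℝ] E) →L[ℝ] E →L[ℝ] E :=
    (ContinuousLinearMap.compL ℝ E (ℝ × E) E).flip (.inr ℝ ℝ E)
  have h4 : HasDerivAt (fun s ↦ fderiv ℝ W (s, y) ∘L .inr ℝ ℝ E + (christoffel G y).flip (W (s, y)))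
      (fderiv ℝ (fderiv ℝ W) (s, y) (1, 0) ∘L .inr ℝ ℝ E
        + (christoffel G y).flip (fderiv ℝ W (s, y) (1, 0))) s :=
    (Λ.hasFDerivAt.comp_hasDerivAt s h2).add
      ((christoffel G y).flip.hasFDerivAt.comp_hasDerivAt s h3)
  have h5 : (fun s ↦ covDeriv G (fun z ↦ W (s, z)) y) =ᶠ[𝓝 s]
      fun s ↦ fderiv ℝ W (s, y) ∘L .inr ℝ ℝ E + (christoffel G y).flip (W (s, y)) := by
    filter_upwards [hI.mem_nhds hs] with r hr
    exact covDeriv_section ((hW.contDiffAt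
      (hO.mem_nhds (Set.mk_mem_prod hr hy))).differentiableAt (by simp))
  have h6 : covDeriv G (fun z ↦ fderiv ℝ W (s, z) (1, 0)) y =
      fderiv ℝ (fderiv ℝ W) (s, y) (1, 0) ∘L .inr ℝ ℝ E
        + (christoffel G y).flip (fderiv ℝ W (s, y) (1, 0)) := by
    have h7 : HasFDerivAt (fun z : E ↦ (s, z)) (.inr ℝ ℝ E) y := hasFDerivAt_prodMk_right s y
    have h8 : HasFDerivAt (fun z ↦ fderiv ℝ W (s, z)) _ y := hd.hasFDerivAt.comp y h7
    have h9 := h8.clm_apply (hasFDerivAt_const ((1 : ℝ), (0 : E)) y)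
    ext v
    rw [covDeriv_apply, h9.fderiv]
    simp only [ContinuousLinearMap.comp_zero, zero_add, _root_.add_apply,
      ContinuousLinearMap.flip_apply, ContinuousLinearMap.comp_apply]
    rw [hsymm.eq]
  rw [h6]
  exact h4.congr_of_eventuallyEq h5

/-- The first variation of the energy density. -/
lemma hasDerivAt_energy (h : LocalMetric Ω G) (hI : IsOpen I)
    (hW : ContDiffOn ℝ ∞ W (I ×ˢ Ω)) (hs : s ∈ I) (hy : y ∈ Ω) :
    HasDerivAt (fun s ↦ formTrace (G y) (G y + (G y).bilinearComp
      (covDeriv G (fun y ↦ W (s, y)) y) (covDeriv G (fun y ↦ W (s, y)) y)))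
      (2 * formTrace (G y) ((G y).bilinearComp
        (covDeriv G (fun z ↦ fderiv ℝ W (s, z) (1, 0)) y) (covDeriv G (fun y ↦ W (s, y)) y))) s := by
  have h1 := h.hasDerivAt_covDeriv_section hI hW hs hy
  set N : ℝ → E →L[ℝ] E := fun s ↦ covDeriv G (fun y ↦ W (s, y)) y with hN
  set N' := covDeriv G (fun z ↦ fderiv ℝ W (s, z) (1, 0)) y with hN'
  let β : (E →L[ℝ] E) →L[ℝ] (E →L[ℝ] E) →L[ℝ] ℝ := LinearMap.toContinuousLinearMap
    { toFun := fun A ↦ LinearMap.toContinuousLinearMap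
        { toFun := fun C ↦ formTraceL (G y) ((G y).bilinearComp A C)
          map_add' := fun C D ↦ by
            rw [← map_add]
            congr 1
            ext u v
            simp
          map_smul' := fun c C ↦ by
            rw [RingHom.id_apply, ← map_smul]
            congr 1
            ext u v
            simp }
      map_add' := fun A D ↦ by
        ext1 C
        change formTraceL _ _ = formTraceL _ _ + formTraceL _ _
        rw [← map_add]
        congr 1
        ext u v
        simp
      map_smul' := fun c A ↦ by
        ext1 C
        change formTraceL _ _ = c • formTraceL _ _
        rw [← map_smul]
        congr 1
        ext u v
        simp }
  have hβ : ∀ A C, β A C = formTrace (G y) ((G y).bilinearComp A C) := fun A C ↦ rfl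
  -- Symmetry of the polarized energy merges the two terms of the product rule into the factor 2.
  have hβs : ∀ A C, β A C = β C A := fun A C ↦ by
    rw [hβ, hβ, ← formTrace_flip (h.nondeg y hy) (h.symm y hy)]
    congr 1
    ext u v
    simp [h.symm y hy (A v)]
  have h2 : HasDerivAt (fun r ↦ β (N r) (N r)) (β N' (N s) + β (N s) N') s := by
    have := (β.hasFDerivAt.comp_hasDerivAt s h1).clm_apply h1
    simpa [add_comm] using this
  have h3 := h2.const_add (formTrace (G y) (G y))
  have h4 : β N' (N s) + β (N s) N' = 2 * formTrace (G y) ((G y).bilinearComp N' (N s)) := by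
    rw [hβs (N s), hβ]
    ring
  rw [h4] at h3
  refine h3.congr_of_eventuallyEq (Filter.Eventually.of_forall fun r ↦ ?_)
  change formTraceL (G y) (G y + _) = _
  rw [map_add]
  rfl

end LocalMetric

end LocalVariation

/-! ### First variation of the energy on the manifold -/

section Charts

variable {m : ℕ} {M : Type*} [TopologicalSpace M] [ChartedSpace (EuclideanSpace ℝ (Fin m)) M]
  [IsManifold (𝓡 m) ∞ M]

local notation "𝓔" => EuclideanSpace ℝ (Fin m)
local notation "𝓒" => chartAt (EuclideanSpace ℝ (Fin m))
local notation "𝓣" => trivializationAt (EuclideanSpace ℝ (Fin m)) (TangentSpace (𝓡 m))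

section Variation

variable {g : BilinField m M} {p x : M} {W : ℝ → VField m M} {I : Set ℝ}

/-- A family of vector fields that is jointly smooth in the parameter and the point. -/
def IsSmoothFamily (I : Set ℝ) (W : ℝ → VField m M) : Prop :=
  ∀ p : M, ContDiffOn ℝ ∞ (fun z : ℝ × 𝓔 ↦ fieldRep p (W z.1) z.2) (I ×ˢ (𝓒 p).target)

lemma isSmoothFamily_of_contMDiffOn (h : ContMDiffOn ((𝓘(ℝ, ℝ)).prod (𝓡 m)) (𝓡 m).tangent ∞
    (fun q : ℝ × M ↦ (⟨q.2, W q.1 q.2⟩ : TangentBundle (𝓡 m) M)) (I ×ˢ Set.univ)) :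
    IsSmoothFamily I W := by
  intro p
  have h1 := h.mono (Set.prod_mono le_rfl (Set.subset_univ (𝓒 p).source))
  rw [(𝓣 p).contMDiffOn_iff (fun q hq ↦ (𝓣 p).mem_source.2
    (mem_baseSet_of_mem_chart_source hq.2))] at h1
  have h2 : ContMDiffOn 𝓘(ℝ, ℝ × 𝓔) ((𝓘(ℝ, ℝ)).prod (𝓡 m)) ∞
      (fun z : ℝ × 𝓔 ↦ (z.1, (𝓒 p).symm z.2)) (I ×ˢ (𝓒 p).target) :=
    contDiff_fst.contMDiff.contMDiffOn.prodMk ((contMDiffOn_chart_symm (n := ∞)).comp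
      contDiff_snd.contMDiff.contMDiffOn fun z hz ↦ hz.2)
  have h3 := h1.2.comp h2 fun z hz ↦ ⟨hz.1, (𝓒 p).map_target hz.2⟩
  rw [contMDiffOn_iff_contDiffOn] at h3
  exact h3.congr fun z hz ↦ toModel_apply ((𝓒 p).map_target hz.2) _

lemma contMDiffOn_of_isSmoothFamily (h : IsSmoothFamily I W) :
    ContMDiffOn ((𝓘(ℝ, ℝ)).prod (𝓡 m)) (𝓡 m).tangent ∞
      (fun q : ℝ × M ↦ (⟨q.2, W q.1 q.2⟩ : TangentBundle (𝓡 m) M)) (I ×ˢ Set.univ) := by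
  rintro ⟨s, p⟩ ⟨hs, -⟩
  have hp := mem_chart_source 𝓔 p
  have h1 : ContMDiffOn ((𝓘(ℝ, ℝ)).prod (𝓡 m)) 𝓘(ℝ, ℝ × 𝓔) ∞
      (fun q : ℝ × M ↦ (q.1, 𝓒 p q.2)) (I ×ˢ (𝓒 p).source) :=
    contMDiffOn_fst.prodMk_space ((contMDiffOn_chart (n := ∞)).comp contMDiffOn_snd
      fun z hz ↦ hz.2)
  have h2 := (contMDiffOn_iff_contDiffOn.2 (h p)).comp h1
    fun q hq ↦ ⟨hq.1, (𝓒 p).map_source hq.2⟩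
  have h3 : ContMDiffOn ((𝓘(ℝ, ℝ)).prod (𝓡 m)) (𝓡 m).tangent ∞
      (fun q : ℝ × M ↦ (⟨q.2, W q.1 q.2⟩ : TangentBundle (𝓡 m) M)) (I ×ˢ (𝓒 p).source) := by
    rw [(𝓣 p).contMDiffOn_iff (fun q hq ↦ (𝓣 p).mem_source.2
      (mem_baseSet_of_mem_chart_source hq.2))]
    refine ⟨contMDiffOn_snd, h2.congr fun q hq ↦ ?_⟩
    rw [← toModel_apply hq.2]
    exact (fieldRep_chart _ hq.2).symm
  refine (h3 (s, p) ⟨hs, hp⟩).mono_of_mem_nhdsWithin ?_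
  rw [Set.prod_eq, Set.prod_eq]
  refine Filter.inter_mem ?_ ?_
  · exact Filter.mem_of_superset self_mem_nhdsWithin fun q hq ↦ hq.1
  · exact mem_nhdsWithin_of_mem_nhds
      (((𝓒 p).open_source.preimage continuous_snd).mem_nhds hp)

/-- The velocity at time `0` of a family of vector fields. -/
def variationField (W : ℝ → VField m M) : VField m M :=
  fun x ↦ fromModel m x x (deriv (fun s ↦ toModel m x x (W s x)) 0)

lemma IsSmoothFamily.hasDerivAt (h : IsSmoothFamily I W) (hI : IsOpen I) (h0 : 0 ∈ I)
    (hx : x ∈ (𝓒 p).source) : HasDerivAt (fun s ↦ toModel m p x (W s x))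
      (fderiv ℝ (fun z : ℝ × 𝓔 ↦ fieldRep p (W z.1) z.2) (0, 𝓒 p x) (1, 0)) 0 := by
  have hy := (𝓒 p).map_source hx
  have h1 : HasDerivAt (fun s : ℝ ↦ (s, 𝓒 p x)) (1, 0) 0 :=
    (hasDerivAt_id (0 : ℝ)).prodMk (hasDerivAt_const 0 _)
  have h2 := (((h p).contDiffAt ((hI.prod (𝓒 p).open_target).mem_nhds
    (Set.mk_mem_prod h0 hy))).differentiableAt (by simp)).hasFDerivAt.comp_hasDerivAt 0 h1
  refine h2.congr_of_eventuallyEq (Filter.Eventually.of_forall fun s ↦ ?_)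
  exact (fieldRep_chart (W s) hx).symm

/-- At a fixed point the change of chart is a linear map independent of s, so the velocity may be
computed in any chart. -/
lemma IsSmoothFamily.toModel_variationField (h : IsSmoothFamily I W) (hI : IsOpen I) (h0 : 0 ∈ I)
    (hx : x ∈ (𝓒 p).source) : toModel m p x (variationField W x) =
      fderiv ℝ (fun z : ℝ × 𝓔 ↦ fieldRep p (W z.1) z.2) (0, 𝓒 p x) (1, 0) := by
  have h1 := h.hasDerivAt hI h0 hx
  set d := fderiv ℝ (fun z : ℝ × 𝓔 ↦ fieldRep p (W z.1) z.2) (0, 𝓒 p x) (1, 0) with hd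
  let A : 𝓔 →L[ℝ] 𝓔 := toModel m x x ∘L fromModel m p x
  have h2 : HasDerivAt (fun s ↦ toModel m x x (W s x)) (A d) 0 := by
    refine (A.hasFDerivAt.comp_hasDerivAt (0 : ℝ) h1).congr_of_eventuallyEq
      (Filter.Eventually.of_forall fun s ↦ ?_)
    change _ = toModel m x x (fromModel m p x (toModel m p x (W s x)))
    rw [fromModel_toModel hx]
  unfold variationField
  rw [h2.deriv]
  change toModel m p x (fromModel m x x (toModel m x x (fromModel m p x d))) = d
  rw [fromModel_toModel (mem_chart_source 𝓔 x), toModel_fromModel hx]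

lemma IsSmoothFamily.fieldRep_variationField (h : IsSmoothFamily I W) (hI : IsOpen I) (h0 : 0 ∈ I)
    {y : 𝓔} (hy : y ∈ (𝓒 p).target) : fieldRep p (variationField W) y =
      fderiv ℝ (fun z : ℝ × 𝓔 ↦ fieldRep p (W z.1) z.2) (0, y) (1, 0) := by
  have := h.toModel_variationField hI h0 ((𝓒 p).map_target hy)
  rwa [(𝓒 p).right_inv hy] at this

lemma IsSmoothFamily.isSmoothField_variationField (h : IsSmoothFamily I W) (hI : IsOpen I)
    (h0 : 0 ∈ I) : IsSmoothField (variationField W) := by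
  refine isSmoothField_of_contMDiffOn fun p ↦ contMDiffOn_of_comp_chart_symm ?_
  have h1 := ((h p).fderiv_of_isOpen (m := ∞) (hI.prod (𝓒 p).open_target) (by simp)).clm_apply
    (contDiffOn_const (c := ((1 : ℝ), (0 : 𝓔))))
  have h2 := h1.comp (s := (𝓒 p).target) (g := _) (f := fun y : 𝓔 ↦ ((0 : ℝ), y))
    (contDiff_const.prodMk contDiff_id).contDiffOn fun y hy ↦ ⟨h0, hy⟩
  exact h2.congr fun y hy ↦ h.fieldRep_variationField hI h0 hy

/-- The polarization `tr_g g(∇U, ∇V)` of the vertical energy density. -/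
def crossEnergy (g : BilinField m M) (U V : VField m M) (x : M) : ℝ :=
  metricTrace g x fun u v ↦ g x (nabla g U x u) (nabla g V x v)

lemma crossEnergy_eq (hg : IsSemiRiemannianMetric g) (hx : x ∈ (𝓒 p).source) {U V : VField m M}
    (hU : DifferentiableAt ℝ (fieldRep p U) (𝓒 p x))
    (hV : DifferentiableAt ℝ (fieldRep p V) (𝓒 p x)) : crossEnergy g U V x =
      formTrace (metricRep p g (𝓒 p x)) ((metricRep p g (𝓒 p x)).bilinearComp
        (covDeriv (metricRep p g) (fieldRep p U) (𝓒 p x))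
        (covDeriv (metricRep p g) (fieldRep p V) (𝓒 p x))) := by
  refine metricTrace_eq_formTrace hg hx fun u v ↦ ?_
  rw [← metricRep_toModel (g := g) hx, toModel_nabla hg hx hU, toModel_nabla hg hx hV]
  rfl

lemma energyDensity_eq (hg : IsSemiRiemannianMetric g) (hx : x ∈ (𝓒 p).source) {V : VField m M}
    (hV : DifferentiableAt ℝ (fieldRep p V) (𝓒 p x)) : energyDensity g V x =
      (1 / 2 : ℝ) * formTrace (metricRep p g (𝓒 p x)) (metricRep p g (𝓒 p x) +
        (metricRep p g (𝓒 p x)).bilinearComp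
        (covDeriv (metricRep p g) (fieldRep p V) (𝓒 p x))
        (covDeriv (metricRep p g) (fieldRep p V) (𝓒 p x))) := by
  unfold energyDensity
  congr 1
  refine metricTrace_eq_formTrace hg hx fun u v ↦ ?_
  unfold pullbackSasaki
  rw [← metricRep_toModel (g := g) hx, ← metricRep_toModel (g := g) hx, toModel_nabla hg hx hV,
    toModel_nabla hg hx hV]
  rfl

lemma IsSmoothFamily.differentiableAt (h : IsSmoothFamily I W) (hI : IsOpen I) {s : ℝ} (hs : s ∈ I)
    {y : 𝓔} (hy : y ∈ (𝓒 p).target) : DifferentiableAt ℝ (fieldRep p (W s)) y := by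
  have h1 := ((h p).contDiffAt ((hI.prod (𝓒 p).open_target).mem_nhds
    (Set.mk_mem_prod hs hy))).differentiableAt (by simp)
  exact (h1.hasFDerivAt.comp y (hasFDerivAt_prodMk_right s y)).differentiableAt

lemma IsSmoothFamily.contDiffOn_energyDensity (h : IsSmoothFamily I W) (hI : IsOpen I)
    (hg : IsSemiRiemannianMetric g) (p : M) : ContDiffOn ℝ ∞
      (fun z : ℝ × 𝓔 ↦ energyDensity g (W z.1) ((𝓒 p).symm z.2)) (I ×ˢ (𝓒 p).target) := by
  have h1 := ((localMetric_metricRep hg p).contDiffOn_energy hI (h p)).const_smul (1 / 2 : ℝ)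
  refine h1.congr fun z hz ↦ ?_
  have hx := (𝓒 p).map_target hz.2
  rw [energyDensity_eq hg hx (by
    rw [(𝓒 p).right_inv hz.2]; exact h.differentiableAt hI hz.1 hz.2), (𝓒 p).right_inv hz.2]
  rfl

lemma IsSmoothFamily.deriv_energyDensity (h : IsSmoothFamily I W) (hI : IsOpen I) (h0 : 0 ∈ I)
    (hg : IsSemiRiemannianMetric g) (x : M) :
    deriv (fun s ↦ energyDensity g (W s) x) 0 = crossEnergy g (variationField W) (W 0) x := by
  have hx := mem_chart_source 𝓔 x
  have hy := mem_chart_target 𝓔 x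
  have h1 := ((localMetric_metricRep hg x).hasDerivAt_energy hI (h x) h0 hy).const_mul (1 / 2 : ℝ)
  have h2 : (fun s ↦ energyDensity g (W s) x) =ᶠ[𝓝 0] fun s ↦ (1 / 2 : ℝ) *
      formTrace (metricRep x g (𝓒 x x)) (metricRep x g (𝓒 x x) +
        (metricRep x g (𝓒 x x)).bilinearComp
        (covDeriv (metricRep x g) (fieldRep x (W s)) (𝓒 x x))
        (covDeriv (metricRep x g) (fieldRep x (W s)) (𝓒 x x))) := by
    filter_upwards [hI.mem_nhds h0] with s hs
    exact energyDensity_eq hg hx (h.differentiableAt hI hs hy)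
  rw [(h1.congr_of_eventuallyEq h2).deriv, crossEnergy_eq hg hx
    ((h.isSmoothField_variationField hI h0).differentiableAt_fieldRep hx)
    (h.differentiableAt hI h0 hy)]
  have h3 : fieldRep x (variationField W) =ᶠ[𝓝 (𝓒 x x)]
      fun y ↦ fderiv ℝ (fun z : ℝ × 𝓔 ↦ fieldRep x (W z.1) z.2) (0, y) (1, 0) := by
    filter_upwards [(𝓒 x).open_target.mem_nhds hy] with y hy using
      h.fieldRep_variationField hI h0 hy
  have h4 : covDeriv (metricRep x g) (fieldRep x (variationField W)) (𝓒 x x) =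
      covDeriv (metricRep x g) (fun y ↦ fderiv ℝ (fun z : ℝ × 𝓔 ↦ fieldRep x (W z.1) z.2)
        (0, y) (1, 0)) (𝓒 x x) := by
    ext1 v
    rw [covDeriv_apply, covDeriv_apply, h3.fderiv_eq, h3.eq_of_nhds]
  rw [h4]
  ring

lemma fieldRep_congr {V V' : VField m M} (h : ∀ᶠ y in 𝓝 x, V y = V' y) (hx : x ∈ (𝓒 p).source) :
    fieldRep p V =ᶠ[𝓝 (𝓒 p x)] fieldRep p V' := by
  have h2 := (𝓒 p).continuousAt_symm ((𝓒 p).map_source hx)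
  rw [ContinuousAt, (𝓒 p).left_inv hx] at h2
  filter_upwards [h2.eventually h] with z hz
  unfold fieldRep
  rw [hz]

lemma energyDensity_congr (hg : IsSemiRiemannianMetric g) {V V' : VField m M}
    (hV : DifferentiableAt ℝ (fieldRep x V) (𝓒 x x)) (h : ∀ᶠ y in 𝓝 x, V y = V' y) :
    energyDensity g V x = energyDensity g V' x := by
  have hx := mem_chart_source 𝓔 x
  have h1 := fieldRep_congr h hx
  rw [energyDensity_eq hg hx hV, energyDensity_eq hg hx (hV.congr_of_eventuallyEq h1.symm)]
  have h4 : covDeriv (metricRep x g) (fieldRep x V) (𝓒 x x) =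
      covDeriv (metricRep x g) (fieldRep x V') (𝓒 x x) := by
    ext1 v
    rw [covDeriv_apply, covDeriv_apply, h1.fderiv_eq, h1.eq_of_nhds]
  rw [h4]

omit [IsManifold (𝓡 m) ∞ M] in
-- Differentiation under the integral sign. The s-derivative is jointly continuous, hence bounded on
-- a compact time interval times K, and it vanishes off K. A constant dominates it, and D has finite
-- measure.
lemma hasDerivAt_setIntegral_of_contDiffOn [MeasurableSpace M] [BorelSpace M] [T2Space M]
    (μ : Measure M) [IsLocallyFiniteMeasure μ] {e : ℝ → M → ℝ} {δ : ℝ} (hδ : 0 < δ)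
    (he : ∀ p : M, ContDiffOn ℝ ∞ (fun z : ℝ × 𝓔 ↦ e z.1 ((𝓒 p).symm z.2))
      (Set.Ioo (-δ) δ ×ˢ (𝓒 p).target))
    {D K : Set M} (hD : IsCompact (closure D)) (hK : IsCompact K)
    (heK : ∀ s ∈ Set.Ioo (-δ) δ, ∀ x, x ∉ K → e s x = e 0 x) :
    HasDerivAt (fun s ↦ ∫ x in D, e s x ∂μ) (∫ x in D, deriv (fun s ↦ e s x) 0 ∂μ) 0 := by
  set I := Set.Ioo (-δ) δ with hI
  have hIo : IsOpen I := isOpen_Ioo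
  have hδI : ∀ s ∈ Set.Icc (-(δ / 2)) (δ / 2), s ∈ I := fun s hs ↦
    ⟨by linarith [hs.1], by linarith [hs.2]⟩
  have h0 : (0 : ℝ) ∈ I := ⟨by linarith, hδ⟩
  have hdiff : ∀ (p x : M), x ∈ (𝓒 p).source → ∀ s ∈ I, HasDerivAt (fun s ↦ e s x)
      (fderiv ℝ (fun z : ℝ × 𝓔 ↦ e z.1 ((𝓒 p).symm z.2)) (s, 𝓒 p x) (1, 0)) s := by
    intro p x hx s hs
    have h1 : HasDerivAt (fun s : ℝ ↦ (s, 𝓒 p x)) (1, 0) s :=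
      (hasDerivAt_id s).prodMk (hasDerivAt_const s _)
    have h2 := (((he p).contDiffAt ((hIo.prod (𝓒 p).open_target).mem_nhds
      (Set.mk_mem_prod hs ((𝓒 p).map_source hx)))).differentiableAt
      (by simp)).hasFDerivAt.comp_hasDerivAt s h1
    refine h2.congr_of_eventuallyEq (Filter.Eventually.of_forall fun r ↦ ?_)
    simp [(𝓒 p).left_inv hx]
  have hcont : ∀ s ∈ I, Continuous (e s) := fun s hs ↦ by
    rw [continuous_iff_continuousAt]
    intro p
    have hn := (𝓒 p).open_source.mem_nhds (mem_chart_source 𝓔 p)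
    have h1 : ContinuousOn (fun x ↦ e s ((𝓒 p).symm (𝓒 p x))) (𝓒 p).source :=
      (he p).continuousOn.comp (f := fun x ↦ (s, 𝓒 p x))
        (continuousOn_const.prodMk (𝓒 p).continuousOn) fun x hx ↦ ⟨hs, (𝓒 p).map_source hx⟩
    refine (h1.continuousAt hn).congr ?_
    filter_upwards [hn] with x hx
    rw [(𝓒 p).left_inv hx]
  have hcont' : ContinuousOn (fun q : ℝ × M ↦ deriv (fun s ↦ e s q.2) q.1) (I ×ˢ Set.univ) := by
    rintro ⟨s, p⟩ ⟨hs, -⟩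
    have hp := mem_chart_source 𝓔 p
    have hn : I ×ˢ (𝓒 p).source ∈ 𝓝 (s, p) :=
      (hIo.prod (𝓒 p).open_source).mem_nhds (Set.mk_mem_prod hs hp)
    have h1 : ContinuousOn (fun z ↦ fderiv ℝ (fun z : ℝ × 𝓔 ↦ e z.1 ((𝓒 p).symm z.2)) z (1, 0))
        (I ×ˢ (𝓒 p).target) :=
      (((he p).fderiv_of_isOpen (m := ∞) (hIo.prod (𝓒 p).open_target) (by simp)).continuousOn).clm_apply
        continuousOn_const
    have h2 : ContinuousOn (fun q : ℝ × M ↦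
        fderiv ℝ (fun z : ℝ × 𝓔 ↦ e z.1 ((𝓒 p).symm z.2)) (q.1, 𝓒 p q.2) (1, 0))
        (I ×ˢ (𝓒 p).source) :=
      h1.comp (f := fun q : ℝ × M ↦ (q.1, 𝓒 p q.2)) (continuousOn_fst.prodMk
        ((𝓒 p).continuousOn.comp continuousOn_snd fun q hq ↦ hq.2))
        fun q hq ↦ ⟨hq.1, (𝓒 p).map_source hq.2⟩
    refine ((h2.continuousAt hn).congr ?_).continuousWithinAt
    filter_upwards [hn] with q hq
    exact (hdiff p q.2 hq.2 q.1 hq.1).deriv.symm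
  obtain ⟨C, hC⟩ := (isCompact_Icc.prod hK).exists_bound_of_continuousOn
    (hcont'.mono (Set.prod_mono hδI (Set.subset_univ K)))
  have hfin : IsFiniteMeasure (μ.restrict D) :=
    ⟨by simpa using (measure_mono subset_closure).trans_lt hD.measure_lt_top⟩
  -- The interval is halved so that its closure stays inside the range of the parameter. The maximum
  -- with 0 makes the bound valid also off K, where the derivative is zero.
  refine (hasDerivAt_integral_of_dominated_loc_of_deriv_le (μ := μ.restrict D)
    (s := Set.Ioo (-(δ / 2)) (δ / 2)) (bound := fun _ ↦ max C 0)
    (F' := fun s x ↦ deriv (fun s ↦ e s x) s) (Ioo_mem_nhds (by linarith) (by linarith))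
    ?_ ?_ ?_ ?_ (integrable_const _) ?_).2
  · filter_upwards [hIo.mem_nhds h0] with s hs using (hcont s hs).aestronglyMeasurable
  · exact ((hcont 0 h0).continuousOn.integrableOn_compact hD).mono_set subset_closure
  · have : Continuous fun x ↦ deriv (fun s ↦ e s x) 0 :=
      hcont'.comp_continuous (f := fun x ↦ ((0 : ℝ), x)) (by fun_prop) fun x ↦ ⟨h0, trivial⟩
    exact this.aestronglyMeasurable
  · refine Filter.Eventually.of_forall fun x s hs ↦ ?_
    by_cases hx : x ∈ K
    · exact (hC (s, x) ⟨Set.Ioo_subset_Icc_self hs, hx⟩).trans (le_max_left _ _)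
    · have h1 : (fun s ↦ e s x) =ᶠ[𝓝 s] fun _ ↦ e 0 x := by
        filter_upwards [hIo.mem_nhds (hδI s (Set.Ioo_subset_Icc_self hs))] with r hr
          using heK r hr x hx
      rw [h1.deriv_eq, deriv_const, norm_zero]
      exact le_max_right _ _
  · refine Filter.Eventually.of_forall fun x s hs ↦ ?_
    have := hdiff x x (mem_chart_source 𝓔 x) s (hδI s (Set.Ioo_subset_Icc_self hs))
    rwa [← this.deriv] at this

/-- The first variation of the energy. -/
lemma IsVariation.hasDerivAt_energy [MeasurableSpace M] [BorelSpace M] [T2Space M]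
    (hg : IsSemiRiemannianMetric g) {r δ : ℝ} (hδ : 0 < δ) {V : VField m M} {D K : Set M}
    (hD : IsCompact (closure D)) (hK : IsCompact K)
    (hW : IsVariation g r V K δ W) : HasDerivAt (fun s ↦ energy g (W s) D)
      (∫ x in D, crossEnergy g (variationField W) V x ∂(volumeMeasure g)) 0 := by
  have := isLocallyFiniteMeasure_volumeMeasure hg
  have h := isSmoothFamily_of_contMDiffOn hW.smooth
  have hI : IsOpen (Set.Ioo (-δ) δ) := isOpen_Ioo
  have h0 : (0 : ℝ) ∈ Set.Ioo (-δ) δ := ⟨by linarith, hδ⟩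
  have key := hasDerivAt_setIntegral_of_contDiffOn (volumeMeasure g) hδ
    (e := fun s ↦ energyDensity g (W s)) (h.contDiffOn_energyDensity hI hg) hD hK
    (fun s hs x hx ↦ energyDensity_congr hg (h.differentiableAt hI hs (mem_chart_target 𝓔 x)) (by
      filter_upwards [hK.isClosed.isOpen_compl.mem_nhds hx] with y hy
      rw [hW.eq_off s hs y hy, hW.eq_off 0 h0 y hy]))
  simp only [h.deriv_energyDensity hI h0 hg, hW.zero] at key
  exact key

end Variation

end Charts

/-! ### Harmonic unit fields as critical points -/

section Charts

variable {m : ℕ} {M : Type*} [TopologicalSpace M] [ChartedSpace (EuclideanSpace ℝ (Fin m)) M]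
  [IsManifold (𝓡 m) ∞ M]

local notation "𝓔" => EuclideanSpace ℝ (Fin m)
local notation "𝓒" => chartAt (EuclideanSpace ℝ (Fin m))
local notation "𝓣" => trivializationAt (EuclideanSpace ℝ (Fin m)) (TangentSpace (𝓡 m))

section Harmonic

variable {E : Type*} [NormedAddCommGroup E] [NormedSpace ℝ E] [FiniteDimensional ℝ E]

lemma LocalMetric.contDiffOn_formTrace_bilinearComp {Ω : Set E} {G : E → E →L[ℝ] E →L[ℝ] ℝ}
    (h : LocalMetric Ω G) {A B : E → E →L[ℝ] E} (hA : ContDiffOn ℝ ∞ A Ω)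
    (hB : ContDiffOn ℝ ∞ B Ω) :
    ContDiffOn ℝ ∞ (fun y ↦ formTrace (G y) ((G y).bilinearComp (A y) (B y))) Ω := by
  have h1 : ContDiffOn ℝ ∞ (fun y ↦ (G y).bilinearComp (A y) (B y)) Ω := by
    rw [contDiffOn_clm_apply]; intro u
    rw [contDiffOn_clm_apply]; intro v
    have h2 : ContDiffOn ℝ ∞ (fun y ↦ G y (A y u) (B y v)) Ω :=
      (h.smooth.clm_apply (hA.clm_apply contDiffOn_const)).clm_apply
        (hB.clm_apply contDiffOn_const)
    exact h2
  exact h.contDiffOn_formTrace (q := fun y ↦ y) contDiffOn_id (fun y hy ↦ hy) h1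

variable {g : BilinField m M} {p x : M}

lemma continuous_crossEnergy (hg : IsSemiRiemannianMetric g) {U V : VField m M}
    (hU : IsSmoothField U) (hV : IsSmoothField V) : Continuous (crossEnergy g U V) := by
  rw [continuous_iff_continuousAt]
  intro p
  have hG := localMetric_metricRep hg p
  have hUc := hG.contDiffOn_covDeriv (contDiffOn_fieldRep hU)
  have hVc := hG.contDiffOn_covDeriv (contDiffOn_fieldRep hV)
  have h1 := hG.contDiffOn_formTrace_bilinearComp hUc hVc
  have h2 := h1.continuousOn.comp (𝓒 p).continuousOn fun x hx ↦ (𝓒 p).map_source hx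
  have hn := (𝓒 p).open_source.mem_nhds (mem_chart_source 𝓔 p)
  refine (h2.continuousAt hn).congr ?_
  filter_upwards [hn] with x hx
  exact (crossEnergy_eq hg hx (hU.differentiableAt_fieldRep hx)
    (hV.differentiableAt_fieldRep hx)).symm

lemma IsVariation.variationField_eq_zero {r δ : ℝ} (hδ : 0 < δ) {V : VField m M} {K : Set M}
    {W : ℝ → VField m M} (hW : IsVariation g r V K δ W) (hx : x ∉ K) :
    variationField W x = 0 := by
  have h1 : (fun s ↦ toModel m x x (W s x)) =ᶠ[𝓝 0] fun _ ↦ toModel m x x (V x) := by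
    filter_upwards [Ioo_mem_nhds (neg_lt_zero.2 hδ) hδ] with s hs
    rw [hW.eq_off s hs x hx]
  unfold variationField
  rw [h1.deriv_eq, deriv_const, map_zero]

/-- Differentiate the constant length g(W_s, W_s) = r at s = 0. -/
lemma IsVariation.apply_variationField (hg : IsSemiRiemannianMetric g) {r δ : ℝ} (hδ : 0 < δ)
    {V : VField m M} {K : Set M} {W : ℝ → VField m M} (hW : IsVariation g r V K δ W) (x : M) :
    g x (variationField W x) (V x) = 0 := by
  have hx := mem_chart_source 𝓔 x
  have h := isSmoothFamily_of_contMDiffOn hW.smooth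
  have h0 : (0 : ℝ) ∈ Set.Ioo (-δ) δ := ⟨by linarith, hδ⟩
  have h1 := h.hasDerivAt isOpen_Ioo h0 hx
  rw [← h.toModel_variationField isOpen_Ioo h0 hx] at h1
  have h2 := ((metricRep x g (𝓒 x x)).hasFDerivAt.comp_hasDerivAt (0 : ℝ) h1).clm_apply h1
  have h3 : (fun s ↦ metricRep x g (𝓒 x x) (toModel m x x (W s x)) (toModel m x x (W s x)))
      =ᶠ[𝓝 0] fun _ ↦ r := by
    filter_upwards [isOpen_Ioo.mem_nhds h0] with s hs
    rw [metricRep_toModel hx, hW.length s hs x]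
  have h4 := h2.unique ((hasDerivAt_const (0 : ℝ) r).congr_of_eventuallyEq h3)
  have h5 : metricRep x g (𝓒 x x) (toModel m x x (variationField W x)) (toModel m x x (W 0 x)) +
      metricRep x g (𝓒 x x) (toModel m x x (W 0 x)) (toModel m x x (variationField W x)) = 0 := h4
  rw [metricRep_toModel hx, metricRep_toModel hx, hg.symm x (W 0 x), hW.zero] at h5
  linarith

/-- A unit vector field and an orthogonal vector field span a variation through unit fields. -/
def unitVariation (g : BilinField m M) (V U : VField m M) (s : ℝ) : VField m M := fun x ↦
  ((1 - s ^ 2 * (g x (U x) (U x) / 4)) / (1 + s ^ 2 * (g x (U x) (U x) / 4))) • V x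
    + (s / (1 + s ^ 2 * (g x (U x) (U x) / 4))) • U x

omit [IsManifold (𝓡 m) ∞ M] in
-- With c = g(U,U)/4 this is (1 - s²c)² + 4s²c = (1 + s²c)², the rational parametrization of a
-- conic. It holds for every sign of g(U,U), so one smooth formula serves U of any causal type.
lemma apply_unitVariation {V U : VField m M} (hg : ∀ v w, g x v w = g x w v)
    (hV : g x (V x) (V x) = 1) (hU : g x (U x) (V x) = 0) {s : ℝ}
    (hs : 1 + s ^ 2 * (g x (U x) (U x) / 4) ≠ 0) :
    g x (unitVariation g V U s x) (unitVariation g V U s x) = 1 := by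
  have hU' : g x (V x) (U x) = 0 := by rw [hg, hU]
  unfold unitVariation
  simp only [map_add, map_smul, _root_.add_apply, _root_.smul_apply, hV, hU, hU', smul_eq_mul]
  generalize g x (U x) (U x) = q at hs ⊢
  have hq : q = 4 * (q / 4) := by ring
  generalize q / 4 = c at hs hq
  subst hq
  field_simp
  ring

lemma isSmoothFamily_unitVariation (hg : IsSemiRiemannianMetric g) {V U : VField m M}
    (hV : IsSmoothField V) (hU : IsSmoothField U) {I : Set ℝ}
    (hI : ∀ s ∈ I, ∀ x, 1 + s ^ 2 * (g x (U x) (U x) / 4) ≠ 0) :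
    IsSmoothFamily I (unitVariation g V U) := by
  intro p
  have hG := localMetric_metricRep hg p
  have h1 := contDiffOn_fieldRep (p := p) hV
  have h2 := contDiffOn_fieldRep (p := p) hU
  have hs : Set.MapsTo (Prod.snd : ℝ × 𝓔 → 𝓔) (I ×ˢ (𝓒 p).target) (𝓒 p).target :=
    fun z hz ↦ hz.2
  have h3 : ContDiffOn ℝ ∞ (fun z : ℝ × 𝓔 ↦ fieldRep p V z.2) (I ×ˢ (𝓒 p).target) :=
    h1.comp contDiffOn_snd hs
  have h4 : ContDiffOn ℝ ∞ (fun z : ℝ × 𝓔 ↦ fieldRep p U z.2) (I ×ˢ (𝓒 p).target) :=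
    h2.comp contDiffOn_snd hs
  have h5 : ContDiffOn ℝ ∞ (fun z : ℝ × 𝓔 ↦
      g ((𝓒 p).symm z.2) (U ((𝓒 p).symm z.2)) (U ((𝓒 p).symm z.2))) (I ×ˢ (𝓒 p).target) := by
    have := ((hG.smooth.clm_apply h2).clm_apply h2).comp contDiffOn_snd hs
    exact this.congr fun z hz ↦ (metricRep_fieldRep hz.2 U U).symm
  have h6 : ContDiffOn ℝ ∞ (fun z : ℝ × 𝓔 ↦ z.1) (I ×ˢ (𝓒 p).target) := contDiffOn_fst
  have h7 : ContDiffOn ℝ ∞ (fun z : ℝ × 𝓔 ↦ z.1 ^ 2 *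
      (g ((𝓒 p).symm z.2) (U ((𝓒 p).symm z.2)) (U ((𝓒 p).symm z.2)) / 4)) (I ×ˢ (𝓒 p).target) :=
    (h6.pow 2).mul (h5.div_const 4)
  have h8 := contDiffOn_const (c := (1 : ℝ)).add h7
  refine ((((contDiffOn_const (c := (1 : ℝ)).sub h7).div h8 fun z hz ↦ hI z.1 hz.1 _).smul h3).add
    ((h6.div h8 fun z hz ↦ hI z.1 hz.1 _).smul h4)).congr fun z hz ↦ ?_
  unfold fieldRep unitVariation
  simp only [map_add, map_smul]
  rfl

lemma variationField_unitVariation (V U : VField m M) (x : M) :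
    variationField (unitVariation g V U) x = U x := by
  have hx := mem_chart_source 𝓔 x
  set c := g x (U x) (U x) / 4 with hc
  have h1 : HasDerivAt (fun s : ℝ ↦ s ^ 2 * c) 0 0 := by
    simpa using ((hasDerivAt_id (0 : ℝ)).pow 2).mul_const c
  have h2 : HasDerivAt (fun s : ℝ ↦ 1 + s ^ 2 * c) 0 0 := h1.const_add 1
  have h3 : HasDerivAt (fun s : ℝ ↦ (1 - s ^ 2 * c) / (1 + s ^ 2 * c)) 0 0 := by
    simpa using (h1.const_sub 1).fun_div h2 (by simp)
  have h4 : HasDerivAt (fun s : ℝ ↦ s / (1 + s ^ 2 * c)) 1 0 := by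
    simpa using (hasDerivAt_id' (0 : ℝ)).fun_div h2 (by simp)
  have h5 : HasDerivAt (fun s : ℝ ↦ ((1 - s ^ 2 * c) / (1 + s ^ 2 * c)) • toModel m x x (V x)
      + (s / (1 + s ^ 2 * c)) • toModel m x x (U x)) (toModel m x x (U x)) 0 := by
    simpa using (h3.smul_const (toModel m x x (V x))).fun_add (h4.smul_const (toModel m x x (U x)))
  have h6 : (fun s ↦ toModel m x x (unitVariation g V U s x)) =
      fun s : ℝ ↦ ((1 - s ^ 2 * c) / (1 + s ^ 2 * c)) • toModel m x x (V x)
      + (s / (1 + s ^ 2 * c)) • toModel m x x (U x) := by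
    funext s
    unfold unitVariation
    rw [map_add, map_smul, map_smul]
  unfold variationField
  rw [h6, h5.deriv, fromModel_toModel hx]

lemma exists_isVariation_unitVariation [T2Space M] (hg : IsSemiRiemannianMetric g) {V U : VField m M}
    (hV : IsSmoothField V) (hVV : ∀ x, g x (V x) (V x) = 1) (hU : IsSmoothField U)
    (hUV : ∀ x, g x (U x) (V x) = 0) {K : Set M} (hK : IsCompact K) (hUK : ∀ x, x ∉ K → U x = 0) :
    ∃ δ > 0, IsVariation g 1 V K δ (unitVariation g V U) := by
  have hq : Continuous fun x ↦ g x (U x) (U x) := by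
    rw [continuous_iff_continuousAt]
    intro p
    have h1 := (((localMetric_metricRep hg p).smooth.clm_apply (contDiffOn_fieldRep hU)).clm_apply
      (contDiffOn_fieldRep hU)).continuousOn.comp (𝓒 p).continuousOn
        fun x hx ↦ (𝓒 p).map_source hx
    have hn := (𝓒 p).open_source.mem_nhds (mem_chart_source 𝓔 p)
    refine (h1.continuousAt hn).congr ?_
    filter_upwards [hn] with x hx
    simp only [Function.comp_apply]
    rw [metricRep_fieldRep ((𝓒 p).map_source hx), (𝓒 p).left_inv hx]
  obtain ⟨C₀, hC₀⟩ := hK.exists_bound_of_continuousOn hq.continuousOn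
  set C := max C₀ 0 with hC
  have hCb : ∀ x, |g x (U x) (U x)| ≤ C := fun x ↦ by
    by_cases hx : x ∈ K
    · exact (hC₀ x hx).trans (le_max_left _ _)
    · rw [hUK x hx]
      simp [hC]
  have hC0 : 0 ≤ C := le_max_right _ _
  -- With C ≥ |g(U,U)|, finite since U has compact support, |s|(1 + C) < 1 forces s²C ≤ 1. The
  -- denominators are then at least 3/4.
  have hpos : ∀ s ∈ Set.Ioo (-(1 / (1 + C))) (1 / (1 + C)), ∀ x,
      1 + s ^ 2 * (g x (U x) (U x) / 4) ≠ 0 := by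
    intro s hs x
    have h1 : |s| < 1 / (1 + C) := abs_lt.2 hs
    have h2 : |s| * (1 + C) < 1 := by rwa [lt_div_iff₀ (by linarith)] at h1
    have h3 := abs_nonneg s
    have h4 : s ^ 2 * C ≤ 1 := by
      rw [← sq_abs]
      nlinarith [mul_nonneg h3 hC0]
    have h5 := neg_le_of_abs_le (hCb x)
    have h6 : -(s ^ 2 * C) ≤ s ^ 2 * g x (U x) (U x) := by nlinarith [sq_nonneg s]
    intro h7
    linarith
  refine ⟨1 / (1 + C), by positivity, contMDiffOn_of_isSmoothFamily
    (isSmoothFamily_unitVariation hg hV hU hpos), ?_, fun s hs x ↦ ?_, fun s hs x hx ↦ ?_⟩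
  · funext x
    simp [unitVariation]
  · exact apply_unitVariation (hg.symm x) (hVV x) (hUV x) (hpos s hs x)
  · unfold unitVariation
    simp [hUK x hx]

/-- A unit vector field `V` is harmonic if and only if the first variation of the energy vanishes
on the compactly supported vector fields orthogonal to `V`. -/
lemma isHarmonicField_iff [MeasurableSpace M] [BorelSpace M] [T2Space M] [Nonempty M]
    (hg : IsSemiRiemannianMetric g) {V : VField m M} (hV : IsSmoothField V)
    (hVV : ∀ x, g x (V x) (V x) = 1) : IsHarmonicField g V ↔
      ∀ D K : Set M, IsOpen D → IsCompact (closure D) → IsCompact K → K ⊆ D →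
        ∀ U : VField m M, IsSmoothField U → (∀ x, g x (U x) (V x) = 0) → (∀ x, x ∉ K → U x = 0) →
          ∫ x in D, crossEnergy g U V x ∂(volumeMeasure g) = 0 := by
  constructor
  · rintro ⟨-, r, -, hr, h⟩ D K hDo hD hK hKD U hU hUV hUK
    -- The length in the definition of harmonicity is existentially quantified; a point of M pins it
    -- down.
    obtain rfl : r = 1 := by
      obtain ⟨x⟩ := ‹Nonempty M›
      rw [← hr x, hVV x]
    obtain ⟨δ, hδ, hW⟩ := exists_isVariation_unitVariation hg hV hVV hU hUV hK hUK
    have h1 := hW.hasDerivAt_energy hg hδ hD hK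
    have h2 : variationField (unitVariation g V U) = U :=
      funext fun x ↦ variationField_unitVariation V U x
    rw [h2] at h1
    exact h1.unique (h D K hDo hD hK hKD δ hδ _ hW)
  · intro h
    refine ⟨hV, 1, one_ne_zero, hVV, fun D K hDo hD hK hKD δ hδ W hW ↦ ?_⟩
    have h1 := hW.hasDerivAt_energy hg hδ hD hK
    have h0 : (0 : ℝ) ∈ Set.Ioo (-δ) δ := ⟨by linarith, hδ⟩
    rwa [h D K hDo hD hK hKD (variationField W)
      ((isSmoothFamily_of_contMDiffOn hW.smooth).isSmoothField_variationField isOpen_Ioo h0)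
      (hW.apply_variationField hg hδ) fun x hx ↦ hW.variationField_eq_zero hδ hx] at h1

end Harmonic

end Charts

/-! ### Invariance of harmonicity under the deformation -/

section Structure

variable {n : ℕ} {M : Type*} [TopologicalSpace M]
  [ChartedSpace (EuclideanSpace ℝ (Fin (2 * n + 1))) M]
  [IsManifold (𝓡 (2 * n + 1)) ∞ M]

local notation "𝓔" => EuclideanSpace ℝ (Fin (2 * n + 1))
local notation "𝓒" => chartAt (EuclideanSpace ℝ (Fin (2 * n + 1)))

variable {S : Tensors n M} {t : ℝ}

lemma IsParacontactMetric.crossEnergy_deform (hS : IsParacontactMetric S) (ht : t ≠ 0)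
    {U : VField (2 * n + 1) M} (hU : IsSmoothField U) (hη : ∀ x, S.η x (U x) = 0) (x : M) :
    crossEnergy (S.deform t).g U (S.deform t).ξ x = t⁻¹ * crossEnergy S.g U S.ξ x +
      (t - 1) / t * divergence S.g (fun y ↦ S.φ y (U y)) x := by
  have hx := mem_chart_source 𝓔 x
  have hy := mem_chart_target 𝓔 x
  have hS' := hS.deform ht
  have h := hS.localParacontact x
  have hG := localMetric_metricRep hS'.metric x
  rw [metricRep_deform] at hG
  have hUd := hU.differentiableAt_fieldRep hx
  have hηU : formRep x S.η (𝓒 x x) (fieldRep x U (𝓒 x x)) = 0 := by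
    rw [formRep_apply, fieldRep_chart _ hx, (𝓒 x).left_inv hx, fromModel_toModel hx, hη]
  have hξ : fieldRep x (S.deform t).ξ = fun z ↦ t⁻¹ • fieldRep x S.ξ z := by
    funext z
    exact map_smul _ _ _
  have hφU : fieldRep x (fun y ↦ S.φ y (U y)) =ᶠ[𝓝 (𝓒 x x)]
      fun z ↦ endRep x S.φ z (fieldRep x U z) := by
    filter_upwards [(𝓒 x).open_target.mem_nhds hy] with z hz
    rw [endRep_apply]
    unfold fieldRep
    rw [fromModel_toModel ((𝓒 x).map_target hz)]
  have hd : DifferentiableAt ℝ (fun z ↦ endRep x S.φ z (fieldRep x U z)) (𝓒 x x) :=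
    (h.hasFDerivAt_φ hy).differentiableAt.clm_apply hUd
  have hcov : covDeriv (metricRep x S.g) (fieldRep x fun y ↦ S.φ y (U y)) (𝓒 x x) =
      covDeriv (metricRep x S.g) (fun z ↦ endRep x S.φ z (fieldRep x U z)) (𝓒 x x) := by
    ext1 v
    rw [covDeriv_apply, covDeriv_apply, hφU.fderiv_eq, hφU.eq_of_nhds]
  rw [crossEnergy_eq hS'.metric hx hUd (hS'.smooth_ξ.differentiableAt_fieldRep hx),
    crossEnergy_eq hS.metric hx hUd (hS.smooth_ξ.differentiableAt_fieldRep hx),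
    divergence_eq hS.metric hx (hd.congr_of_eventuallyEq hφU), hcov, metricRep_deform, hξ]
  exact h.formTrace_deformMetric ht hG hy hUd hηU (fun u v ↦ rfl) fun u v ↦ rfl

/-- Both conditions say η(u) = 0, so the two variational problems have the same test fields. -/
lemma deform_orthogonal_iff (hS : IsParacontactMetric S) (ht : t ≠ 0) (x : M)
    (u : TangentSpace (𝓡 (2 * n + 1)) x) :
    (S.deform t).g x u ((S.deform t).ξ x) = 0 ↔ S.g x u (S.ξ x) = 0 := by
  have hS' := hS.deform ht
  rw [hS'.metric.symm, ← hS'.η_eq, hS.metric.symm, ← hS.η_eq]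
  change t * S.η x u = 0 ↔ _
  simp [ht]

lemma IsParacontactMetric.setIntegral_crossEnergy_deform [MeasurableSpace M] [BorelSpace M]
    [T2Space M] [SecondCountableTopology M] (hS : IsParacontactMetric S) (ht : t ≠ 0)
    {D K : Set M} (hD : IsCompact (closure D)) (hK : IsCompact K) (hKD : K ⊆ D)
    {U : VField (2 * n + 1) M} (hU : IsSmoothField U) (hUξ : ∀ x, S.g x (U x) (S.ξ x) = 0)
    (hUK : ∀ x, x ∉ K → U x = 0) :
    ∫ x in D, crossEnergy (S.deform t).g U (S.deform t).ξ x ∂(volumeMeasure (S.deform t).g) =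
      Real.sqrt |t ^ (2 * n + 2)| * t⁻¹ *
        ∫ x in D, crossEnergy S.g U S.ξ x ∂(volumeMeasure S.g) := by
  have := isLocallyFiniteMeasure_volumeMeasure hS.metric
  have hη : ∀ x, S.η x (U x) = 0 := fun x ↦ by rw [hS.η_eq, hS.metric.symm, hUξ]
  have hφ : IsSmoothEnd S.φ := hS.smooth_φ
  have hφU : IsSmoothField fun x ↦ S.φ x (U x) :=
    contMDiffOn_univ.1 (hφ.contMDiffOn_apply (contMDiffOn_univ.2 hU))
  have hφU0 : ∀ x, x ∉ K → S.φ x (U x) = 0 := fun x hx ↦ by rw [hUK x hx, map_zero]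
  -- φU is supported in K ⊆ D, so the integral over D is the integral over M, where the divergence
  -- theorem applies.
  have hdiv : ∫ x in D, divergence S.g (fun y ↦ S.φ y (U y)) x ∂(volumeMeasure S.g) = 0 := by
    rw [setIntegral_eq_integral_of_forall_compl_eq_zero, integral_divergence hS.metric hφU hK hφU0]
    intro x hx
    refine divergence_eq_zero hS.metric ?_
    filter_upwards [hK.isClosed.isOpen_compl.mem_nhds fun h ↦ hx (hKD h)] with y hy
      using hφU0 y hy
  have h1 : IntegrableOn (crossEnergy S.g U S.ξ) D (volumeMeasure S.g) :=
    ((continuous_crossEnergy hS.metric hU hS.smooth_ξ).continuousOn.integrableOn_compact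
      hD).mono_set subset_closure
  have h2 : IntegrableOn (divergence S.g fun y ↦ S.φ y (U y)) D (volumeMeasure S.g) :=
    ((continuous_divergence hS.metric hφU).continuousOn.integrableOn_compact
      hD).mono_set subset_closure
  rw [hS.volumeMeasure_deform ht, Measure.restrict_smul, integral_smul_measure,
    ENNReal.toReal_ofReal (Real.sqrt_nonneg _)]
  simp only [hS.crossEnergy_deform ht hU hη]
  rw [integral_add (h1.const_mul _) (h2.const_mul _), integral_const_mul, integral_const_mul, hdiv,
    smul_eq_mul]
  ring

/-- The first variations agree up to the constant |t|^(n+1)/t, which is nonzero, so they vanish on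
the same test fields. -/
lemma IsParacontactMetric.isHParacontact_deform_iff [MeasurableSpace M] [BorelSpace M]
    [T2Space M] [SecondCountableTopology M] [Nonempty M] (hS : IsParacontactMetric S)
    (ht : t ≠ 0) : IsHParacontact (S.deform t) ↔ IsHParacontact S := by
  have hS' := hS.deform ht
  have h1 : ∀ x, S.g x (S.ξ x) (S.ξ x) = 1 := fun x ↦ by rw [← hS.η_eq, hS.η_ξ]
  have h1' : ∀ x, (S.deform t).g x ((S.deform t).ξ x) ((S.deform t).ξ x) = 1 := fun x ↦ by
    rw [← hS'.η_eq, hS'.η_ξ]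
  have hc : Real.sqrt |t ^ (2 * n + 2)| * t⁻¹ ≠ 0 :=
    mul_ne_zero (Real.sqrt_pos.2 (by positivity)).ne' (inv_ne_zero ht)
  unfold IsHParacontact
  rw [isHarmonicField_iff hS'.metric hS'.smooth_ξ h1', isHarmonicField_iff hS.metric hS.smooth_ξ h1,
    and_iff_right hS', and_iff_right hS]
  simp only [deform_orthogonal_iff hS ht]
  refine forall₂_congr fun D K ↦ forall₄_congr fun hDo hD hK hKD ↦
    forall₄_congr fun U hU hUξ hUK ↦ ?_
  rw [hS.setIntegral_crossEnergy_deform ht hD hK hKD hU hUξ hUK, mul_eq_zero, or_iff_right hc]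

end Structure

end Paracontact

end

set_option maxSynthPendingDepth 1

theorem theorem3p4 (n : ℕ) (M : Type*) [TopologicalSpace M] [T2Space M]
    [SecondCountableTopology M] [ConnectedSpace M] [MeasurableSpace M] [BorelSpace M]
    [ChartedSpace (EuclideanSpace ℝ (Fin (2 * n + 1))) M]
    [IsManifold (𝓡 (2 * n + 1)) ∞ M]
    (S : Paracontact.Tensors n M) (hS : Paracontact.IsParacontactMetric S)
    (t : ℝ) (ht : t ≠ 0) :
    Paracontact.IsParacontactMetric (S.deform t) ∧
    (Paracontact.IsHParacontact (S.deform t) ↔ Paracontact.IsHParacontact S) ∧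
    ∀ (x : M) (X : TangentSpace (𝓡 (2 * n + 1)) x), S.η x X = 0 →
      Paracontact.ricci (S.deform t).g x X ((S.deform t).ξ x)
        = Paracontact.ricci S.g x X (S.ξ x) / t := by
  refine ⟨hS.deform ht, hS.isHParacontact_deform_iff ht, fun x X hX ↦ hS.ricci_deform ht x hX⟩
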